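/- Notation. Let $\mathbb D$ be the open unit disk in $\mathbb C$ and $dA$ the area measure on $\mathbb D$ normalized so that $A(\mathbb D)=1$. For $\alpha>-1$ put $\omega_\alpha(z)=(1+\alpha)(1-|z|^2)^\alpha$; for $0<p<\infty$ let $L^p_a(\omega_\alpha)$ be the space of analytic functions $f$ on $\mathbb D$ with $\|f\|_{L^p(\omega_\alpha)}=\big(\int_{\mathbb D}|f|^p\omega_\alpha\,dA\big)^{1/p}<\infty$. For a finite positive Borel measure $\mu$ on $\mathbb D$ and $\gamma>-1$ let $$T_{\mu,\gamma}(f)(z)=\int_{\mathbb D}\frac{f(w)}{(1-z\bar w)^{2+\gamma}}\,d\mu(w),\qquad z\in\mathbb D,$$ with the principal branch of the power. The operator $T_{\mu,\beta}:L^p_a(\omega_\alpha)\to L^1_a(\omega_\beta)$ is called bounded if there is a finite constant $C$ such that, for every polynomial $f$, $T_{\mu,\beta}(f)\in L^1_a(\omega_\beta)$ and $\|T_{\mu,\beta}(f)\|_{L^1(\omega_\beta)}\le C\|f\|_{L^p(\omega_\alpha)}$. The measure $\mu$ is a $q$-Carleson measure for $L^1_a(\omega_\alpha)$ if there is a constant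 $C>0$ such that $\big(\int_{\mathbb D}|f|^q\,d\mu\big)^{1/q}\le C\|f\|_{L^1(\omega_\alpha)}$ for all $f\in L^1_a(\omega_\alpha)$. The logarithmic Bloch space $\mathcal{LB}^1$ consists of the analytic functions $f$ on $\mathbb D$ with $$|f(0)|+\sup_{z\in\mathbb D}(1-|z|^2)\Big(\log\frac{2}{1-|z|^2}\Big)|f'(z)|<\infty.$$ Theorem. Let $\mu$ be a finite positive Borel measure on $\mathbb D$, let $0<p\le1$ and $-1<\alpha,\beta<\infty$. Then $T_{\mu,\beta}:L^p_a(\omega_\alpha)\to L^1_a(\omega_\beta)$ is bounded if and only if $\mu$ is a $\frac1p$-Carleson measure for $L^1_a(\omega_\alpha)$ and $T_{\mu,\frac{2+\alpha}{p}-2}(1)\in\mathcal{LB}^1$. -/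

import Mathlib

namespace BergmanToeplitz

open MeasureTheory
open scoped ENNReal NNReal ComplexConjugate

/-- The open unit disk `𝔻` in `ℂ`. -/
abbrev unitDisk : Set ℂ := Metric.ball (0 : ℂ) 1

/-- The standard weight `ω_α(z) = (1 + α) (1 - |z|²)^α`. -/
noncomputable def weight (α : ℝ) (z : ℂ) : ℝ := (1 + α) * (1 - ‖z‖ ^ 2) ^ α

/-- The measure `ω_α dA` on `𝔻`, where `dA` is Lebesgue measure divided by `π`
(so that `𝔻` has area one). -/
noncomputable def weightedArea (α : ℝ) : Measure ℂ :=
  (volume.restrict unitDisk).withDensity fun z => ENNReal.ofReal (weight α z / Real.pi)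

/-- The (quasi-)norm `‖f‖_{L^p(ω_α)} = (∫_𝔻 |f|^p ω_α dA)^{1/p}` in `[0, ∞]`, for `0 < p < ∞`. -/
noncomputable def bergmanNorm (p α : ℝ) (f : ℂ → ℂ) : ℝ≥0∞ :=
  eLpNorm f (ENNReal.ofReal p) (weightedArea α)

/-- Membership in the weighted Bergman space `L^p_a(ω_α)`. Only the values of `f` on `𝔻` matter. -/
def MemBergman (p α : ℝ) (f : ℂ → ℂ) : Prop :=
  DifferentiableOn ℂ f unitDisk ∧ bergmanNorm p α f < ∞

/-- The Toeplitz operator `T_{μ,α} f (z) = ∫ f(w) / (1 - z w̄)^{2+α} dμ(w)`, for a measure `μ`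
concentrated on `𝔻`. Since `Re (1 - z w̄) > 0` for `z, w ∈ 𝔻`, the power is the principal one. -/
noncomputable def toeplitz (μ : Measure ℂ) (α : ℝ) (f : ℂ → ℂ) (z : ℂ) : ℂ :=
  ∫ w, f w / (1 - z * conj w) ^ ((2 + α : ℝ) : ℂ) ∂μ

/-- Boundedness of `T_{μ,β} : L^p_a(ω_α) → L^q_a(ω_γ)`: the norm inequality holds for all
polynomials, with one finite constant. -/
def ToeplitzBounded (μ : Measure ℂ) (β p α q γ : ℝ) : Prop :=
  ∃ C : ℝ≥0, ∀ f : Polynomial ℂ,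
    MemBergman q γ (toeplitz μ β fun w => f.eval w) ∧
      bergmanNorm q γ (toeplitz μ β fun w => f.eval w) ≤ C * bergmanNorm p α fun w => f.eval w

/-- `μ` (a measure concentrated on `𝔻`) is a `q`-Carleson measure for `L^p_a(ω_α)`. -/
def IsCarleson (μ : Measure ℂ) (q p α : ℝ) : Prop :=
  ∃ C : ℝ≥0, 0 < C ∧ ∀ f : ℂ → ℂ, MemBergman p α f →
    eLpNorm f (ENNReal.ofReal q) μ ≤ C * bergmanNorm p α f

/-- Membership in the logarithmic Bloch space `LB^a`: `f` is analytic on `𝔻` and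
`sup_{z ∈ 𝔻} (1 - |z|²)^a log (2 / (1 - |z|²)) |f'(z)|` is finite. -/
def MemLogBloch (a : ℝ) (f : ℂ → ℂ) : Prop :=
  DifferentiableOn ℂ f unitDisk ∧
    BddAbove ((fun z : ℂ =>
      (1 - ‖z‖ ^ 2) ^ a * Real.log (2 / (1 - ‖z‖ ^ 2)) * ‖deriv f z‖) '' unitDisk)

end BergmanToeplitz

/-!
The adjoint of `T_{μ,β}` for the `L²(ω_β)` pairing is the embedding into `L²(μ)`, so `T_{μ,β}` is
bounded into `L¹_a(ω_β)` exactly when `∫ f ḡ dμ` is controlled by `‖f‖_{L^p(ω_α)}`, uniformly over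
the Bergman projections `g` of functions bounded by `1`. These `g` are uniformly Bloch. Put
`s = (2 + α) / p`, and let `k_a` be the kernel of exponent `s + 1` with pole `a`.

Sufficiency. The reproducing formula of `L²_a(ω_{s-1})` turns `∫ f ḡ dμ` into an area integral of
`f` against the conjugate of `∫ g k_a dμ`. Replacing `g` by `g(a)` in this inner integral costs a
mean oscillation, which is `O((1 - |a|²)⁻¹)` by the Carleson condition. In the remaining term the
logarithmic growth of `g(a)` is compensated by the logarithmic Bloch symbol, whose derivative is
`∫ k_a dμ` up to lower order terms. The conclusion is the inclusion of `L^p_a(ω_α)` in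
`L¹_a(ω_{s-2})`.

Necessity. Pairing a kernel with itself gives a kernel test for the measure, which yields the
Carleson condition by Jensen's inequality. Pairing a kernel with the projection of its own sign
function, which attains the logarithm at the pole, and removing the oscillation by means of the
Carleson condition, gives the logarithmic Bloch condition.
-/

namespace BergmanToeplitz

open MeasureTheory Filter Topology
open scoped ENNReal NNReal ComplexConjugate Real

/-- The defect `1 - |z|²` of a point of the disk, comparable to its distance from the circle. -/
noncomputable def defect (z : ℂ) : ℝ := 1 - ‖z‖ ^ 2

/-- The Bergman kernel `(1 - z w̄)^(-b)` of exponent `b`: `kern (2 + γ)` is the reproducing kernel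
of `L²_a(ω_γ)`. -/
noncomputable def kern (b : ℝ) (z w : ℂ) : ℂ := 1 / (1 - z * conj w) ^ (b : ℂ)

section Defect

lemma ofReal_mul_mem_unitDisk {r : ℝ} (hr0 : 0 ≤ r) (hr1 : r ≤ 1) {z : ℂ}
    (hz : z ∈ unitDisk) : (r : ℂ) * z ∈ unitDisk := by
  rw [unitDisk, mem_ball_zero_iff, norm_mul, Complex.norm_of_nonneg hr0]
  nlinarith [mem_ball_zero_iff.1 hz, norm_nonneg z]

lemma defect_pos {z : ℂ} (hz : z ∈ unitDisk) : 0 < defect z := by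
  have := mem_ball_zero_iff.1 hz
  unfold defect; nlinarith [norm_nonneg z]

lemma measurable_defect : Measurable defect := by unfold defect; fun_prop

lemma defect_le_one (z : ℂ) : defect z ≤ 1 := by
  unfold defect; nlinarith [sq_nonneg ‖z‖]

lemma defect_le_defect_ofReal_mul {r : ℝ} (hr0 : 0 ≤ r) (hr1 : r ≤ 1) (z : ℂ) :
    defect z ≤ defect (r * z) := by
  rw [defect, defect, norm_mul, Complex.norm_of_nonneg hr0]
  nlinarith [mul_le_of_le_one_left (norm_nonneg z) hr1, mul_nonneg hr0 (norm_nonneg z)]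

lemma one_sub_norm_le_defect {z : ℂ} (hz : z ∈ unitDisk) : 1 - ‖z‖ ≤ defect z := by
  have := mem_ball_zero_iff.1 hz
  unfold defect; nlinarith [norm_nonneg z]

lemma defect_le_two_mul_one_sub_norm {z : ℂ} (hz : z ∈ unitDisk) :
    defect z ≤ 2 * (1 - ‖z‖) := by
  have := mem_ball_zero_iff.1 hz
  unfold defect; nlinarith [norm_nonneg z]

lemma one_sub_norm_le_norm_one_sub_mul_conj (z : ℂ) {w : ℂ} (hw : w ∈ unitDisk) :
    1 - ‖z‖ ≤ ‖1 - z * conj w‖ := by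
  have h := norm_sub_norm_le (1 : ℂ) (z * conj w)
  rw [norm_mul, RCLike.norm_conj, norm_one] at h
  nlinarith [norm_nonneg z, mem_ball_zero_iff.1 hw]

lemma defect_le_two_mul_norm_one_sub_mul_conj {z w : ℂ} (hz : z ∈ unitDisk) (hw : w ∈ unitDisk) :
    defect z ≤ 2 * ‖1 - z * conj w‖ :=
  (defect_le_two_mul_one_sub_norm hz).trans
    (by linarith [one_sub_norm_le_norm_one_sub_mul_conj z hw])

lemma norm_one_sub_mul_conj_pos {z w : ℂ} (hz : z ∈ unitDisk) (hw : w ∈ unitDisk) :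
    0 < ‖1 - z * conj w‖ := by
  linarith [one_sub_norm_le_norm_one_sub_mul_conj z hw, mem_ball_zero_iff.1 hz]

lemma one_sub_mul_conj_ne_zero {z w : ℂ} (hz : z ∈ unitDisk) (hw : w ∈ unitDisk) :
    1 - z * conj w ≠ 0 :=
  norm_pos_iff.1 (norm_one_sub_mul_conj_pos hz hw)

lemma norm_one_sub_mul_conj_le_two {z w : ℂ} (hz : z ∈ unitDisk) (hw : w ∈ unitDisk) :
    ‖1 - z * conj w‖ ≤ 2 := by
  have h := norm_sub_le (1 : ℂ) (z * conj w)
  rw [norm_mul, RCLike.norm_conj, norm_one] at h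
  nlinarith [mem_ball_zero_iff.1 hz, mem_ball_zero_iff.1 hw, norm_nonneg z, norm_nonneg w]

lemma one_sub_mul_conj_mem_slitPlane {z w : ℂ} (hz : z ∈ unitDisk) (hw : w ∈ unitDisk) :
    1 - z * conj w ∈ Complex.slitPlane := by
  have hlt : ‖z * conj w‖ < 1 := by
    rw [norm_mul, RCLike.norm_conj]
    exact mul_lt_one_of_nonneg_of_lt_one_left (norm_nonneg z) (mem_ball_zero_iff.1 hz)
      (mem_ball_zero_iff.1 hw).le
  left
  simp only [Complex.sub_re, Complex.one_re]
  linarith [Complex.re_le_norm (z * conj w)]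

lemma norm_one_sub_mul_conj_comm (z w : ℂ) : ‖1 - z * conj w‖ = ‖1 - w * conj z‖ := by
  rw [← RCLike.norm_conj]; simp [mul_comm]

end Defect

section RealPowers

lemma rpow_neg_le_mul_rpow_neg {a b c t : ℝ} (ha : 0 < a) (hc : 0 < c) (h : a ≤ c * b)
    (ht : 0 ≤ t) : b ^ (-t) ≤ c ^ t * a ^ (-t) := by
  have hle : a / c ≤ b := (div_le_iff₀' hc).2 h
  calc b ^ (-t) ≤ (a / c) ^ (-t) :=
        Real.rpow_le_rpow_of_nonpos (by positivity) hle (by linarith)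
    _ = c ^ t * a ^ (-t) := by
        rw [Real.div_rpow ha.le hc.le, Real.rpow_neg hc.le, div_inv_eq_mul, mul_comm]

lemma rpow_le_two_rpow_abs (γ : ℝ) {x : ℝ} (h1 : 1 ≤ x) (h2 : x ≤ 2) : x ^ γ ≤ 2 ^ |γ| :=
  (Real.rpow_le_rpow_of_exponent_le h1 (le_abs_self γ)).trans
    (Real.rpow_le_rpow (by linarith) h2 (abs_nonneg γ))

lemma two_rpow_neg_abs_le_rpow (γ : ℝ) {x : ℝ} (h1 : 1 ≤ x) (h2 : x ≤ 2) :
    2 ^ (-|γ|) ≤ x ^ γ :=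
  (Real.rpow_le_rpow_of_nonpos (by linarith) h2 (neg_nonpos.2 (abs_nonneg γ))).trans
    (Real.rpow_le_rpow_of_exponent_le h1 (neg_abs_le γ))

lemma one_sub_sq_rpow (γ : ℝ) {r : ℝ} (h0 : 0 ≤ r) (h1 : r < 1) :
    (1 - r ^ 2) ^ γ = (1 + r) ^ γ * (1 - r) ^ γ := by
  rw [← Real.mul_rpow (by linarith) (by linarith)]
  congr 1; ring

end RealPowers

section Kernel

lemma norm_kern (b : ℝ) (z w : ℂ) : ‖kern b z w‖ = ‖1 - z * conj w‖ ^ (-b) := by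
  unfold kern
  rw [norm_div, norm_one, Complex.norm_cpow_real, Real.rpow_neg (norm_nonneg _), one_div]

lemma enorm_kern (b : ℝ) (z w : ℂ) :
    ‖kern b z w‖ₑ = ENNReal.ofReal (‖1 - z * conj w‖ ^ (-b)) := by
  rw [← ofReal_norm, norm_kern]

lemma enorm_kern_comm (b : ℝ) (z w : ℂ) : ‖kern b z w‖ₑ = ‖kern b w z‖ₑ := by
  rw [enorm_kern, enorm_kern, norm_one_sub_mul_conj_comm]

lemma kern_zero_left (b : ℝ) (w : ℂ) : kern b 0 w = 1 := by simp [kern]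

lemma conj_kern (b : ℝ) {z w : ℂ} (hz : z ∈ unitDisk) (hw : w ∈ unitDisk) :
    conj (kern b z w) = kern b w z := by
  have h := Complex.conj_cpow (1 - z * conj w) (b : ℂ)
    (Complex.slitPlane_arg_ne_pi (one_sub_mul_conj_mem_slitPlane hz hw))
  rw [Complex.conj_ofReal] at h
  rw [kern, map_div₀, map_one, ← h, kern]
  simp [mul_comm]

lemma measurable_kern_comp {X : Type*} [MeasurableSpace X] {F G : X → ℂ} (b : ℝ)
    (hF : Measurable F) (hG : Measurable G) : Measurable fun x => kern b (F x) (G x) := by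
  unfold kern; fun_prop

end Kernel

section WeightedArea

lemma weight_eq_mul_defect_rpow (γ : ℝ) (z : ℂ) : weight γ z = (1 + γ) * defect z ^ γ := rfl

lemma measurable_weight (γ : ℝ) : Measurable (weight γ) := by
  unfold weight; fun_prop

lemma lintegral_weightedArea (γ : ℝ) (F : ℂ → ℝ≥0∞) :
    ∫⁻ z, F z ∂weightedArea γ = ∫⁻ z in unitDisk, ENNReal.ofReal (weight γ z / π) * F z := by
  unfold weightedArea
  rw [lintegral_withDensity_eq_lintegral_mul_non_measurable _
    ((measurable_weight γ).div_const _).ennreal_ofReal (by simp)]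
  rfl

lemma ae_mem_unitDisk (γ : ℝ) : ∀ᵐ z ∂weightedArea γ, z ∈ unitDisk :=
  (withDensity_absolutelyContinuous _ _).ae_le (ae_restrict_mem measurableSet_ball)

lemma lintegral_mono_weightedArea {γ : ℝ} {F G : ℂ → ℝ≥0∞} (h : ∀ z ∈ unitDisk, F z ≤ G z) :
    ∫⁻ z, F z ∂weightedArea γ ≤ ∫⁻ z, G z ∂weightedArea γ :=
  lintegral_mono_ae ((ae_mem_unitDisk γ).mono h)

lemma lintegral_congr_weightedArea {γ : ℝ} {F G : ℂ → ℝ≥0∞} (h : ∀ z ∈ unitDisk, F z = G z) :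
    ∫⁻ z, F z ∂weightedArea γ = ∫⁻ z, G z ∂weightedArea γ :=
  lintegral_congr_ae ((ae_mem_unitDisk γ).mono h)

lemma lintegral_weightedArea_eq_mul {γ δ : ℝ} (hγ : -1 < γ) (hδ : -1 < δ) (F : ℂ → ℝ≥0∞) :
    ∫⁻ z, F z ∂weightedArea δ =
      ENNReal.ofReal ((1 + δ) / (1 + γ)) *
        ∫⁻ z, ENNReal.ofReal (defect z ^ (δ - γ)) * F z ∂weightedArea γ := by
  rw [lintegral_weightedArea, lintegral_weightedArea, ← lintegral_const_mul' _ _ (by simp)]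
  refine setLIntegral_congr_fun measurableSet_ball fun z hz => ?_
  have hd := defect_pos hz
  have hγ0 : 0 < 1 + γ := by linarith
  have hδ0 : 0 < 1 + δ := by linarith
  have hne := (Real.rpow_pos_of_pos hd γ).ne'
  simp only [weight_eq_mul_defect_rpow]
  rw [← mul_assoc, ← mul_assoc, ← ENNReal.ofReal_mul (by positivity),
    ← ENNReal.ofReal_mul (by positivity), Real.rpow_sub hd]
  congr 2
  field_simp

lemma measurePreserving_mul_weightedArea (γ : ℝ) {c : ℂ} (hc : ‖c‖ = 1) :
    MeasurePreserving (fun z => c * z) (weightedArea γ) (weightedArea γ) := by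
  have hrot : ⇑(rotation ⟨c, mem_sphere_zero_iff_norm.2 hc⟩) = fun z => c * z :=
    funext fun z => rotation_apply _ _
  have hp : MeasurePreserving (fun z : ℂ => c * z) volume volume :=
    hrot ▸ (rotation _).measurePreserving
  have hemb : MeasurableEmbedding (fun z : ℂ => c * z) :=
    hrot ▸ (rotation _).toHomeomorph.measurableEmbedding
  have hpre : (fun z : ℂ => c * z) ⁻¹' unitDisk = unitDisk := by
    ext z; simp [hc]
  refine ⟨hp.measurable, Measure.ext_of_lintegral _ fun f hf => ?_⟩
  rw [lintegral_map hf hp.measurable, lintegral_weightedArea, lintegral_weightedArea]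
  have hvol := hp.setLIntegral_comp_preimage_emb hemb
    (fun z => ENNReal.ofReal (weight γ z / π) * f z) unitDisk
  rw [hpre] at hvol
  simpa [weight, hc] using hvol

end WeightedArea

section Polar

lemma setLIntegral_unitDisk_eq_polar {F : ℂ → ℝ≥0∞} (hF : Measurable F) :
    ∫⁻ z in unitDisk, F z = ∫⁻ r in Set.Ioo (0 : ℝ) 1,
      ENNReal.ofReal r * ∫⁻ θ in Set.Ioo (-π) π, F (circleMap 0 r θ) := by
  have hsymm (q : ℝ × ℝ) : Complex.polarCoord.symm q = circleMap 0 q.1 q.2 := by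
    rw [Complex.polarCoord_symm_apply, circleMap, zero_add, Complex.exp_mul_I,
      Complex.ofReal_cos, Complex.ofReal_sin]
  have hind : ∀ q ∈ polarCoord.target,
      ENNReal.ofReal q.1 • unitDisk.indicator F (Complex.polarCoord.symm q) =
      (Set.Ioo (0 : ℝ) 1 ×ˢ Set.Ioo (-π) π).indicator
        (fun q => ENNReal.ofReal q.1 * F (circleMap 0 q.1 q.2)) q := by
    rintro q ⟨hr : 0 < q.1, hθ⟩
    have hmem : circleMap 0 q.1 q.2 ∈ unitDisk ↔ q ∈ Set.Ioo (0 : ℝ) 1 ×ˢ Set.Ioo (-π) π := by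
      rw [mem_ball_zero_iff, norm_circleMap_zero, abs_of_pos hr]
      exact ⟨fun h => ⟨⟨hr, h⟩, hθ⟩, fun h => h.1.2⟩
    rw [hsymm, smul_eq_mul]
    by_cases h : q ∈ Set.Ioo (0 : ℝ) 1 ×ˢ Set.Ioo (-π) π
    · rw [Set.indicator_of_mem h, Set.indicator_of_mem (hmem.2 h)]
    · rw [Set.indicator_of_notMem h, Set.indicator_of_notMem (mt hmem.1 h), mul_zero]
  have hmeas : Measurable fun q : ℝ × ℝ => ENNReal.ofReal q.1 * F (circleMap 0 q.1 q.2) :=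
    Measurable.mul (by fun_prop) (hF.comp (by unfold circleMap; fun_prop))
  have hsub : Set.Ioo (0 : ℝ) 1 ×ˢ Set.Ioo (-π) π ⊆ polarCoord.target :=
    fun q hq => ⟨hq.1.1, hq.2⟩
  rw [← lintegral_indicator measurableSet_ball, ← Complex.lintegral_comp_polarCoord_symm,
    setLIntegral_congr_fun polarCoord.open_target.measurableSet hind,
    setLIntegral_indicator (measurableSet_Ioo.prod measurableSet_Ioo),
    Set.inter_eq_left.2 hsub, Measure.volume_eq_prod,
    ← Measure.prod_restrict, lintegral_prod _ hmeas.aemeasurable]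
  exact lintegral_congr fun r => lintegral_const_mul' _ _ ENNReal.ofReal_ne_top

lemma lintegral_weightedArea_eq_polar (γ : ℝ) {F : ℂ → ℝ≥0∞} (hF : Measurable F) :
    ∫⁻ z, F z ∂weightedArea γ = ∫⁻ r in Set.Ioo (0 : ℝ) 1,
      ENNReal.ofReal (r * ((1 + γ) * (1 - r ^ 2) ^ γ / π)) *
        ∫⁻ θ in Set.Ioo (-π) π, F (circleMap 0 r θ) := by
  have hmeas : Measurable fun z => ENNReal.ofReal (weight γ z / π) * F z :=
    ((measurable_weight γ).div_const _).ennreal_ofReal.mul hF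
  rw [lintegral_weightedArea, setLIntegral_unitDisk_eq_polar hmeas]
  refine setLIntegral_congr_fun measurableSet_Ioo fun r hr => ?_
  simp only [weight, norm_circleMap_zero, sq_abs]
  rw [lintegral_const_mul' _ _ ENNReal.ofReal_ne_top, ← mul_assoc, ENNReal.ofReal_mul hr.1.le]

lemma lintegral_radial_weight {γ : ℝ} (hγ : -1 < γ) :
    ∫⁻ r in Set.Ioo (0 : ℝ) 1, ENNReal.ofReal (2 * r * ((1 + γ) * (1 - r ^ 2) ^ γ)) = 1 := by
  have hγ1 : 0 < 1 + γ := by linarith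
  have hpos : ∀ r ∈ Set.Ioo (0 : ℝ) 1, 0 < 1 - r ^ 2 := fun r hr => by nlinarith [hr.1, hr.2]
  have hderiv : ∀ r ∈ Set.Ioo (0 : ℝ) 1, HasDerivAt (fun r : ℝ => -(1 - r ^ 2) ^ (1 + γ))
      (2 * r * ((1 + γ) * (1 - r ^ 2) ^ γ)) r := by
    intro r hr
    refine (((hasDerivAt_pow 2 r).const_sub 1).rpow_const (p := 1 + γ)
      (Or.inl (hpos r hr).ne')).neg.congr_deriv ?_
    rw [show 1 + γ - 1 = γ by ring]; push_cast; ring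
  have hcont : ContinuousOn (fun r : ℝ => -(1 - r ^ 2) ^ (1 + γ)) (Set.Icc 0 1) :=
    (Continuous.rpow_const (by fun_prop) fun _ => Or.inr hγ1.le).neg.continuousOn
  have hnonneg : ∀ r ∈ Set.Ioo (0 : ℝ) 1, 0 ≤ 2 * r * ((1 + γ) * (1 - r ^ 2) ^ γ) := fun r hr => by
    have := hr.1
    have := hpos r hr
    positivity
  have hint : IntervalIntegrable (fun r : ℝ => 2 * r * ((1 + γ) * (1 - r ^ 2) ^ γ)) volume 0 1 :=
    intervalIntegral.intervalIntegrable_deriv_of_nonneg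
      (by simpa [Set.uIcc_of_le zero_le_one] using hcont) (by simpa using hderiv)
      (by simpa using hnonneg)
  rw [← ofReal_integral_eq_lintegral_ofReal
      ((intervalIntegrable_iff_integrableOn_Ioo_of_le zero_le_one).1 hint)
      ((ae_restrict_iff' measurableSet_Ioo).2 (ae_of_all _ hnonneg)),
    ← integral_Ioc_eq_integral_Ioo, ← intervalIntegral.integral_of_le zero_le_one,
    intervalIntegral.integral_eq_sub_of_hasDerivAt_of_le zero_le_one hcont hderiv hint]
  simp [Real.zero_rpow hγ1.ne']

theorem isProbabilityMeasure_weightedArea {γ : ℝ} (hγ : -1 < γ) :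
    IsProbabilityMeasure (weightedArea γ) := by
  constructor
  rw [← lintegral_one, lintegral_weightedArea_eq_polar γ measurable_const]
  refine Eq.trans ?_ (lintegral_radial_weight hγ)
  refine setLIntegral_congr_fun measurableSet_Ioo fun r _ => ?_
  simp only [lintegral_const, one_mul, Measure.restrict_apply_univ, Real.volume_Ioo]
  rw [← ENNReal.ofReal_mul' (by linarith [Real.pi_pos])]
  congr 1; field_simp; ring

end Polar

section AngularIntegral

lemma norm_one_sub_mul_exp_le {ρ : ℝ} (h0 : 0 ≤ ρ) (h1 : ρ ≤ 1) (θ : ℝ) :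
    ‖(1 : ℂ) - ρ * Complex.exp (θ * Complex.I)‖ ≤ 1 - ρ + |θ| := by
  have hexp : ‖Complex.exp (θ * Complex.I) - 1‖ ≤ |θ| := by
    rw [mul_comm]; exact Real.norm_exp_I_mul_ofReal_sub_one_le
  calc ‖(1 : ℂ) - ρ * Complex.exp (θ * Complex.I)‖
      = ‖((1 - ρ : ℝ) : ℂ) - ρ * (Complex.exp (θ * Complex.I) - 1)‖ := by
        congr 1; push_cast; ring
    _ ≤ (1 - ρ) + ρ * ‖Complex.exp (θ * Complex.I) - 1‖ := by
        refine (norm_sub_le _ _).trans_eq ?_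
        rw [norm_mul, Complex.norm_of_nonneg (sub_nonneg.2 h1), Complex.norm_of_nonneg h0]
    _ ≤ 1 - ρ + |θ| := by nlinarith [norm_nonneg (Complex.exp (θ * Complex.I) - 1)]

lemma one_sub_add_abs_le_mul_norm {ρ θ : ℝ} (h0 : 0 ≤ ρ) (h1 : ρ ≤ 1) (hθ : |θ| ≤ π) :
    1 - ρ + |θ| ≤ 2 * π * ‖(1 : ℂ) - ρ * Complex.exp (θ * Complex.I)‖ := by
  have hexp : ‖Complex.exp (θ * Complex.I)‖ = 1 := Complex.norm_exp_ofReal_mul_I θ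
  have hradial : 1 - ρ ≤ ‖(1 : ℂ) - ρ * Complex.exp (θ * Complex.I)‖ := by
    have h := norm_sub_norm_le (1 : ℂ) (ρ * Complex.exp (θ * Complex.I))
    rwa [norm_mul, hexp, Complex.norm_of_nonneg h0, norm_one, mul_one] at h
  have hchord : 2 / π * |θ| ≤ ‖1 - Complex.exp (θ * Complex.I)‖ := by
    rw [norm_sub_rev, mul_comm (θ : ℂ), Complex.norm_exp_I_mul_ofReal_sub_one, norm_mul,
      Real.norm_two, Real.norm_eq_abs]
    have h := Real.mul_abs_le_abs_sin (x := θ / 2) (by rw [abs_div, abs_two]; linarith)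
    rw [abs_div, abs_two] at h
    linarith
  have htriangle : ‖1 - Complex.exp (θ * Complex.I)‖ ≤
      ‖(1 : ℂ) - ρ * Complex.exp (θ * Complex.I)‖ + (1 - ρ) := by
    calc ‖1 - Complex.exp (θ * Complex.I)‖
        = ‖(1 - ρ * Complex.exp (θ * Complex.I)) -
            ((1 - ρ : ℝ) : ℂ) * Complex.exp (θ * Complex.I)‖ := by
          congr 1; push_cast; ring
      _ ≤ _ := by
          refine (norm_sub_le _ _).trans_eq ?_
          rw [norm_mul, hexp, Complex.norm_of_nonneg (sub_nonneg.2 h1), mul_one]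
  have hangle : |θ| ≤ π * ‖(1 : ℂ) - ρ * Complex.exp (θ * Complex.I)‖ := by
    rw [div_mul_eq_mul_div, div_le_iff₀ Real.pi_pos] at hchord
    nlinarith [Real.pi_pos]
  nlinarith [Real.pi_gt_three]

lemma lintegral_Ioc_rpow_mul_add_rpow_le {κ τ : ℝ} (hκ : -1 < κ) (hτ : 0 < τ) {d : ℝ}
    (hd : 0 < d) :
    ∫⁻ y in Set.Ioc (0 : ℝ) d, ENNReal.ofReal (y ^ κ * (d + y) ^ (-(1 + κ + τ))) ≤
      ENNReal.ofReal (1 / (κ + 1) * d ^ (-τ)) := by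
  calc _ ≤ ∫⁻ y in Set.Ioc (0 : ℝ) d, ENNReal.ofReal (y ^ κ * d ^ (-(1 + κ + τ))) := by
        refine setLIntegral_mono' measurableSet_Ioc fun y hy => ENNReal.ofReal_le_ofReal ?_
        exact mul_le_mul_of_nonneg_left
          (Real.rpow_le_rpow_of_nonpos hd (by linarith [hy.1]) (by linarith))
          (Real.rpow_nonneg hy.1.le _)
    _ = ENNReal.ofReal (∫ y in Set.Ioc (0 : ℝ) d, y ^ κ * d ^ (-(1 + κ + τ))) := by
        rw [ofReal_integral_eq_lintegral_ofReal]
        · exact ((intervalIntegrable_iff_integrableOn_Ioc_of_le hd.le).1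
            (intervalIntegral.intervalIntegrable_rpow' hκ)).mul_const _
        · refine (ae_restrict_iff' measurableSet_Ioc).2 (ae_of_all _ fun y hy => ?_)
          have := hy.1
          simp only [Pi.zero_apply]; positivity
    _ = _ := by
        rw [← intervalIntegral.integral_of_le hd.le, intervalIntegral.integral_mul_const,
          integral_rpow (Or.inl hκ), Real.zero_rpow (by linarith), sub_zero, div_mul_eq_mul_div,
          ← Real.rpow_add hd, show κ + 1 + -(1 + κ + τ) = -τ by ring, one_div_mul_eq_div]

lemma lintegral_Ioi_rpow_mul_add_rpow_le (κ : ℝ) {τ : ℝ} (hκτ : -1 ≤ κ + τ) (hτ : 0 < τ) {d : ℝ}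
    (hd : 0 < d) :
    ∫⁻ y in Set.Ioi d, ENNReal.ofReal (y ^ κ * (d + y) ^ (-(1 + κ + τ))) ≤
      ENNReal.ofReal (1 / τ * d ^ (-τ)) := by
  calc _ ≤ ∫⁻ y in Set.Ioi d, ENNReal.ofReal (y ^ (-1 - τ)) := by
        refine setLIntegral_mono' measurableSet_Ioi fun y hy => ENNReal.ofReal_le_ofReal ?_
        have hy0 : 0 < y := hd.trans hy
        calc y ^ κ * (d + y) ^ (-(1 + κ + τ)) ≤ y ^ κ * y ^ (-(1 + κ + τ)) :=
              mul_le_mul_of_nonneg_left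
                (Real.rpow_le_rpow_of_nonpos hy0 (by linarith) (by linarith))
                (Real.rpow_nonneg hy0.le _)
          _ = y ^ (-1 - τ) := by rw [← Real.rpow_add hy0]; congr 1; ring
    _ = ENNReal.ofReal (∫ y in Set.Ioi d, y ^ (-1 - τ)) := by
        rw [ofReal_integral_eq_lintegral_ofReal (integrableOn_Ioi_rpow_of_lt (by linarith) hd)]
        refine (ae_restrict_iff' measurableSet_Ioi).2 (ae_of_all _ fun y hy => ?_)
        exact Real.rpow_nonneg (hd.trans hy).le _
    _ = _ := by
        rw [integral_Ioi_rpow_of_lt (by linarith) hd, show -1 - τ + 1 = -τ by ring]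
        congr 1; field_simp

lemma lintegral_rpow_mul_add_rpow_le {κ τ : ℝ} (hκ : -1 < κ) (hτ : 0 < τ) {d : ℝ} (hd : 0 < d) :
    ∫⁻ y in Set.Ioi (0 : ℝ), ENNReal.ofReal (y ^ κ * (d + y) ^ (-(1 + κ + τ))) ≤
      ENNReal.ofReal ((1 / (κ + 1) + 1 / τ) * d ^ (-τ)) := by
  have hκ1 : 0 < κ + 1 := by linarith
  rw [← Set.Ioc_union_Ioi_eq_Ioi hd.le, add_mul, ENNReal.ofReal_add (by positivity) (by positivity)]
  exact (lintegral_union_le _ _ _).trans (add_le_add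
    (lintegral_Ioc_rpow_mul_add_rpow_le hκ hτ hd)
    (lintegral_Ioi_rpow_mul_add_rpow_le κ (by linarith) hτ hd))

lemma lintegral_comp_abs_le {f : ℝ → ℝ≥0∞} (hf : Measurable f) :
    ∫⁻ θ, f |θ| ≤ 2 * ∫⁻ y in Set.Ioi (0 : ℝ), f y := by
  set F := (Set.Ioi (0 : ℝ)).indicator f
  have hae : ∀ᵐ θ : ℝ, f |θ| ≤ F (-θ) + F θ := by
    filter_upwards [Measure.ae_ne volume (0 : ℝ)] with θ hθ
    rcases lt_or_gt_of_ne hθ with h | h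
    · rw [abs_of_neg h, ← Set.indicator_of_mem (Set.mem_Ioi.2 (neg_pos.2 h)) f]
      exact le_self_add
    · rw [abs_of_pos h, ← Set.indicator_of_mem (Set.mem_Ioi.2 h) f]
      exact le_add_self
  refine (lintegral_mono_ae hae).trans_eq ?_
  rw [lintegral_add_right _ (hf.indicator measurableSet_Ioi), lintegral_neg_eq_self,
    lintegral_indicator measurableSet_Ioi, two_mul]

theorem exists_lintegral_norm_one_sub_mul_exp_rpow_le {b : ℝ} (hb : 1 < b) :
    ∃ C : ℝ, 0 < C ∧ ∀ ρ : ℝ, 0 ≤ ρ → ρ < 1 →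
      ∫⁻ θ in Set.Ioo (-π) π,
        ENNReal.ofReal (‖(1 : ℂ) - ρ * Complex.exp (θ * Complex.I)‖ ^ (-b)) ≤
      ENNReal.ofReal (C * (1 - ρ) ^ (1 - b)) := by
  have hb1 : 0 < b - 1 := by linarith
  refine ⟨(2 * π) ^ b * (2 * (1 / (0 + 1) + 1 / (b - 1))), by positivity, fun ρ h0 h1 => ?_⟩
  have hd : 0 < 1 - ρ := by linarith
  have hradial := lintegral_rpow_mul_add_rpow_le (κ := 0) (by norm_num) hb1 hd
  simp only [Real.rpow_zero, one_mul, add_zero, add_sub_cancel, neg_sub] at hradial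
  calc _ ≤ ∫⁻ θ in Set.Ioo (-π) π, ENNReal.ofReal ((2 * π) ^ b) *
          ENNReal.ofReal ((1 - ρ + |θ|) ^ (-b)) := by
        refine setLIntegral_mono' measurableSet_Ioo fun θ hθ => ?_
        rw [← ENNReal.ofReal_mul (by positivity)]
        exact ENNReal.ofReal_le_ofReal (rpow_neg_le_mul_rpow_neg (by positivity) (by positivity)
          (one_sub_add_abs_le_mul_norm h0 h1.le (abs_le.2 ⟨hθ.1.le, hθ.2.le⟩)) (by linarith))
    _ ≤ ENNReal.ofReal ((2 * π) ^ b) * ∫⁻ θ, ENNReal.ofReal ((1 - ρ + |θ|) ^ (-b)) := by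
        rw [← lintegral_const_mul' _ _ ENNReal.ofReal_ne_top]
        exact setLIntegral_le_lintegral _ _
    _ ≤ ENNReal.ofReal ((2 * π) ^ b) * (2 * ENNReal.ofReal
          ((1 / (0 + 1) + 1 / (b - 1)) * (1 - ρ) ^ (1 - b))) := by
        gcongr
        refine (lintegral_comp_abs_le (f := fun y => ENNReal.ofReal ((1 - ρ + y) ^ (-b)))
          (by fun_prop)).trans ?_
        gcongr
    _ = _ := by
        rw [← ENNReal.ofReal_ofNat 2, ← ENNReal.ofReal_mul (by norm_num),
          ← ENNReal.ofReal_mul (by positivity)]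
        congr 1; ring

end AngularIntegral

section ForelliRudin

lemma lintegral_enorm_kern_eq_polar (γ b : ℝ) (a : ℂ) :
    ∫⁻ w, ‖kern b a w‖ₑ ∂weightedArea γ =
      ∫⁻ r in Set.Ioo (0 : ℝ) 1, ENNReal.ofReal (r * ((1 + γ) * (1 - r ^ 2) ^ γ / π)) *
        ∫⁻ θ in Set.Ioo (-π) π, ENNReal.ofReal
          (‖(1 : ℂ) - (‖a‖ * r : ℝ) * Complex.exp (θ * Complex.I)‖ ^ (-b)) := by
  have hm (z : ℂ) : Measurable fun w => ‖kern b z w‖ₑ :=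
    (measurable_kern_comp b measurable_const measurable_id).enorm
  have hrot : ∫⁻ w, ‖kern b a w‖ₑ ∂weightedArea γ = ∫⁻ w, ‖kern b ‖a‖ w‖ₑ ∂weightedArea γ := by
    obtain ⟨c, hc, ha⟩ := RCLike.exists_norm_eq_mul_self a
    rw [← (measurePreserving_mul_weightedArea γ (c := conj c) (by simpa using hc)).lintegral_comp
      (hm a)]
    refine lintegral_congr fun w => ?_
    have hmul : a * conj (conj c * w) = ‖a‖ * conj w := by
      rw [map_mul, Complex.conj_conj, show (‖a‖ : ℂ) = c * a from ha]; ring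
    rw [kern, kern, hmul]
  rw [hrot, lintegral_weightedArea_eq_polar γ (hm _)]
  refine lintegral_congr fun r => ?_
  congr 1
  refine lintegral_congr fun θ => ?_
  rw [enorm_kern, norm_one_sub_mul_conj_comm, circleMap, zero_add, Complex.conj_ofReal]
  congr 4; push_cast; ring

lemma setLIntegral_Ioo_comp_one_sub_le (f : ℝ → ℝ≥0∞) :
    ∫⁻ r in Set.Ioo (0 : ℝ) 1, f (1 - r) ≤ ∫⁻ y in Set.Ioi (0 : ℝ), f y := by
  have hpre : (fun r : ℝ => 1 - r) ⁻¹' Set.Ioi 0 = Set.Iio 1 := by ext; simp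
  have h := (Measure.measurePreserving_sub_left volume (1 : ℝ)).setLIntegral_comp_preimage_emb
    (MeasurableEquiv.subLeft (1 : ℝ)).measurableEmbedding f (Set.Ioi 0)
  rw [hpre] at h
  exact (lintegral_mono_set Set.Ioo_subset_Iio_self).trans_eq h

lemma radial_weight_mul_rpow_le {γ t x r : ℝ} (hγ : -1 < γ) (ht : 0 ≤ t) (hx0 : 0 ≤ x)
    (hx1 : x < 1) (hr0 : 0 < r) (hr1 : r < 1) :
    r * ((1 + γ) * (1 - r ^ 2) ^ γ / π) * (1 - x * r) ^ (1 - (2 + γ + t)) ≤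
      (1 + γ) * 2 ^ |γ| / π * 2 ^ (1 + γ + t) *
        ((1 - r) ^ γ * (1 - x + (1 - r)) ^ (-(1 + γ + t))) := by
  have hγ1 : 0 < 1 + γ := by linarith
  have hweight : (1 - r ^ 2) ^ γ ≤ 2 ^ |γ| * (1 - r) ^ γ := by
    rw [one_sub_sq_rpow γ hr0.le hr1]
    gcongr
    exact rpow_le_two_rpow_abs γ (by linarith) (by linarith)
  have hkernel : (1 - x * r) ^ (1 - (2 + γ + t)) ≤
      2 ^ (1 + γ + t) * (1 - x + (1 - r)) ^ (-(1 + γ + t)) := by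
    rw [show 1 - (2 + γ + t) = -(1 + γ + t) by ring]
    exact rpow_neg_le_mul_rpow_neg (by linarith) two_pos (by nlinarith) (by linarith)
  have hbase : 0 ≤ 1 - r ^ 2 := by nlinarith
  have hxr : 0 ≤ 1 - x * r := by nlinarith
  calc _ ≤ 1 * ((1 + γ) * (2 ^ |γ| * (1 - r) ^ γ) / π) *
        (2 ^ (1 + γ + t) * (1 - x + (1 - r)) ^ (-(1 + γ + t))) := by
        gcongr
    _ = _ := by ring

theorem exists_lintegral_enorm_kern_le {γ t : ℝ} (hγ : -1 < γ) (ht : 0 < t) :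
    ∃ C : ℝ, 0 < C ∧ ∀ a ∈ unitDisk,
      ∫⁻ w, ‖kern (2 + γ + t) a w‖ₑ ∂weightedArea γ ≤ ENNReal.ofReal (C * defect a ^ (-t)) := by
  obtain ⟨C, hC, hangle⟩ :=
    exists_lintegral_norm_one_sub_mul_exp_rpow_le (b := 2 + γ + t) (by linarith)
  have hγ1 : 0 < 1 + γ := by linarith
  have hγ2 : 0 < γ + 1 := by linarith
  set A : ℝ := C * ((1 + γ) * 2 ^ |γ| / π * 2 ^ (1 + γ + t))
  refine ⟨A * ((1 / (γ + 1) + 1 / t) * 2 ^ t), by positivity, fun a ha => ?_⟩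
  have hA : 0 < A := by positivity
  have hx0 := norm_nonneg a
  have hx1 := mem_ball_zero_iff.1 ha
  rw [lintegral_enorm_kern_eq_polar]
  set x := ‖a‖
  calc _ ≤ ∫⁻ r in Set.Ioo (0 : ℝ) 1, ENNReal.ofReal A * ENNReal.ofReal
          ((1 - r) ^ γ * (1 - x + (1 - r)) ^ (-(1 + γ + t))) := by
        refine setLIntegral_mono' measurableSet_Ioo fun r ⟨hr0, hr1⟩ => ?_
        have hbase : 0 ≤ 1 - r ^ 2 := by nlinarith
        refine (mul_le_mul_right (hangle (x * r) (by positivity) (by nlinarith)) _).trans ?_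
        rw [← ENNReal.ofReal_mul (by positivity), ← ENNReal.ofReal_mul hA.le]
        refine ENNReal.ofReal_le_ofReal ?_
        have h := mul_le_mul_of_nonneg_left
          (radial_weight_mul_rpow_le hγ ht.le hx0 hx1 hr0 hr1) hC.le
        linarith
    _ = ENNReal.ofReal A * ∫⁻ r in Set.Ioo (0 : ℝ) 1, ENNReal.ofReal
          ((1 - r) ^ γ * (1 - x + (1 - r)) ^ (-(1 + γ + t))) :=
        lintegral_const_mul' _ _ ENNReal.ofReal_ne_top
    _ ≤ ENNReal.ofReal A * ENNReal.ofReal ((1 / (γ + 1) + 1 / t) * (1 - x) ^ (-t)) := by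
        gcongr
        exact (setLIntegral_Ioo_comp_one_sub_le fun y => ENNReal.ofReal
          (y ^ γ * (1 - x + y) ^ (-(1 + γ + t)))).trans
          (lintegral_rpow_mul_add_rpow_le hγ ht (by linarith))
    _ ≤ _ := by
        have hdist : (1 - x) ^ (-t) ≤ 2 ^ t * defect a ^ (-t) :=
          rpow_neg_le_mul_rpow_neg (defect_pos ha) two_pos
            (defect_le_two_mul_one_sub_norm ha) ht.le
        rw [← ENNReal.ofReal_mul hA.le,
          show A * ((1 / (γ + 1) + 1 / t) * 2 ^ t) * defect a ^ (-t) =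
            A * ((1 / (γ + 1) + 1 / t) * (2 ^ t * defect a ^ (-t))) by ring]
        gcongr

lemma ofReal_le_lintegral_norm_one_sub_mul_exp_rpow {b x r : ℝ} (hb : 0 ≤ b) (hr0 : 0 < r)
    (hrx : r ≤ x) (hx1 : x < 1) :
    ENNReal.ofReal (2 * (1 - r) * (3 * (1 - r)) ^ (-b)) ≤
      ∫⁻ θ in Set.Ioo (-π) π, ENNReal.ofReal
        (‖(1 : ℂ) - (x * r : ℝ) * Complex.exp (θ * Complex.I)‖ ^ (-b)) := by
  have hr1 : 0 < 1 - r := by linarith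
  have hxr0 : 0 ≤ x * r := by nlinarith
  have hxr1 : 0 < 1 - x * r := by nlinarith
  have hsub : Set.Ioo (-(1 - r)) (1 - r) ⊆ Set.Ioo (-π) π :=
    Set.Ioo_subset_Ioo (by linarith [Real.pi_gt_three]) (by linarith [Real.pi_gt_three])
  calc ENNReal.ofReal (2 * (1 - r) * (3 * (1 - r)) ^ (-b))
      = ∫⁻ _ in Set.Ioo (-(1 - r)) (1 - r), ENNReal.ofReal ((3 * (1 - r)) ^ (-b)) := by
        rw [setLIntegral_const, Real.volume_Ioo, ← ENNReal.ofReal_mul (by positivity)]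
        congr 1; ring
    _ ≤ ∫⁻ θ in Set.Ioo (-(1 - r)) (1 - r), ENNReal.ofReal
          (‖(1 : ℂ) - (x * r : ℝ) * Complex.exp (θ * Complex.I)‖ ^ (-b)) := by
        refine setLIntegral_mono' measurableSet_Ioo fun θ hθ => ENNReal.ofReal_le_ofReal ?_
        have hθr : |θ| ≤ 1 - r := abs_le.2 ⟨hθ.1.le, hθ.2.le⟩
        have hpos : 0 < ‖(1 : ℂ) - (x * r : ℝ) * Complex.exp (θ * Complex.I)‖ := by
          have h := one_sub_add_abs_le_mul_norm hxr0 (by linarith)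
            (abs_le.2 ⟨(hsub hθ).1.le, (hsub hθ).2.le⟩)
          exact pos_of_mul_pos_right (by linarith [abs_nonneg θ]) Real.two_pi_pos.le
        refine Real.rpow_le_rpow_of_nonpos hpos ?_ (by linarith)
        refine (norm_one_sub_mul_exp_le hxr0 (by linarith) θ).trans ?_
        nlinarith
    _ ≤ _ := lintegral_mono_set hsub

lemma ofReal_log_sub_one_le_setLIntegral {x : ℝ} (hx0 : 0 ≤ x) (hx1 : x < 1) :
    ENNReal.ofReal (Real.log (1 / (1 - x)) - 1) ≤
      ∫⁻ r in Set.Ioc (0 : ℝ) x, ENNReal.ofReal ((1 - r)⁻¹ - 1) := by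
  have hcont : ContinuousOn (fun r : ℝ => (1 - r)⁻¹) (Set.uIcc 0 x) := by
    rw [Set.uIcc_of_le hx0]
    exact ContinuousOn.inv₀ (by fun_prop) fun r hr => by linarith [hr.2]
  have hint : IntervalIntegrable (fun r : ℝ => (1 - r)⁻¹ - 1) volume 0 x :=
    (hcont.sub continuousOn_const).intervalIntegrable
  have hnonneg : ∀ r ∈ Set.Ioc (0 : ℝ) x, 0 ≤ (1 - r)⁻¹ - 1 := fun r hr =>
    sub_nonneg.2 ((one_le_inv₀ (by linarith [hr.2])).2 (by linarith [hr.1]))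
  rw [← ofReal_integral_eq_lintegral_ofReal
      ((intervalIntegrable_iff_integrableOn_Ioc_of_le hx0).1 hint)
      ((ae_restrict_iff' measurableSet_Ioc).2 (ae_of_all _ hnonneg)),
    ← intervalIntegral.integral_of_le hx0,
    intervalIntegral.integral_sub hcont.intervalIntegrable (by simp),
    intervalIntegral.integral_comp_sub_left (fun y : ℝ => y⁻¹) 1,
    integral_inv_of_pos (by linarith) (by norm_num)]
  simp only [intervalIntegral.integral_const, smul_eq_mul, sub_zero, mul_one]
  gcongr

lemma ofReal_log_sub_one_le_lintegral_enorm_kern {γ : ℝ} (hγ : -1 < γ) {a : ℂ}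
    (ha : a ∈ unitDisk) :
    ENNReal.ofReal ((1 + γ) * 2 ^ (-|γ|) / π * 3 ^ (-(2 + γ)) * 2) *
        ENNReal.ofReal (Real.log (1 / (1 - ‖a‖)) - 1) ≤
      ∫⁻ w, ‖kern (2 + γ) a w‖ₑ ∂weightedArea γ := by
  have hγ1 : 0 < 1 + γ := by linarith
  have hx1 := mem_ball_zero_iff.1 ha
  rw [lintegral_enorm_kern_eq_polar]
  refine (mul_le_mul_right (ofReal_log_sub_one_le_setLIntegral (norm_nonneg a) hx1) _).trans ?_
  rw [← lintegral_const_mul' _ _ ENNReal.ofReal_ne_top]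
  have hsub : Set.Ioc 0 ‖a‖ ⊆ Set.Ioo 0 1 := fun r hr => ⟨hr.1, hr.2.trans_lt hx1⟩
  refine (setLIntegral_mono' measurableSet_Ioc fun r hr => ?_).trans (lintegral_mono_set hsub)
  have hr0 := hr.1
  have hr1 : 0 < 1 - r := by linarith [hr.2]
  have hbase : 0 ≤ 1 - r ^ 2 := by nlinarith
  refine le_trans ?_ (mul_le_mul_right
    (ofReal_le_lintegral_norm_one_sub_mul_exp_rpow (by linarith) hr0 hr.2 hx1) _)
  rw [← ENNReal.ofReal_mul (by positivity), ← ENNReal.ofReal_mul (by positivity)]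
  refine ENNReal.ofReal_le_ofReal ?_
  have hpow : (1 - r) ^ γ * ((1 - r) * (1 - r) ^ (-(2 + γ))) = (1 - r)⁻¹ := by
    rw [← Real.rpow_one_add' hr1.le (by linarith), ← Real.rpow_add hr1, ← Real.rpow_neg_one]
    congr 1; ring
  calc (1 + γ) * 2 ^ (-|γ|) / π * 3 ^ (-(2 + γ)) * 2 * ((1 - r)⁻¹ - 1)
      = r * ((1 + γ) * (2 ^ (-|γ|) * (1 - r) ^ γ) / π) *
          (2 * (1 - r) * (3 * (1 - r)) ^ (-(2 + γ))) := by
        rw [Real.mul_rpow (by norm_num) hr1.le,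
          show (1 - r)⁻¹ - 1 = r * (1 - r)⁻¹ by field_simp; ring, ← hpow]
        ring
    _ ≤ _ := by
        rw [one_sub_sq_rpow γ hr0.le (by linarith)]
        gcongr
        exact two_rpow_neg_abs_le_rpow γ (by linarith) (by linarith)

lemma ofReal_two_rpow_le_lintegral_enorm_kern {γ : ℝ} (hγ : -1 < γ) {a : ℂ}
    (ha : a ∈ unitDisk) :
    ENNReal.ofReal (2 ^ (-(2 + γ))) ≤ ∫⁻ w, ‖kern (2 + γ) a w‖ₑ ∂weightedArea γ := by
  have := isProbabilityMeasure_weightedArea hγ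
  calc ENNReal.ofReal (2 ^ (-(2 + γ)))
      = ∫⁻ _, ENNReal.ofReal (2 ^ (-(2 + γ))) ∂weightedArea γ := by simp
    _ ≤ _ := lintegral_mono_weightedArea fun w hw => by
        rw [enorm_kern]
        exact ENNReal.ofReal_le_ofReal (Real.rpow_le_rpow_of_nonpos
          (norm_one_sub_mul_conj_pos ha hw) (norm_one_sub_mul_conj_le_two ha hw) (by linarith))

/-- The kernel of the critical exponent is not uniformly integrable: this is the source of the
logarithm in the theorem. -/
theorem exists_log_le_lintegral_enorm_kern {γ : ℝ} (hγ : -1 < γ) :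
    ∃ C : ℝ, 0 < C ∧ ∀ a ∈ unitDisk, ENNReal.ofReal (Real.log (2 / defect a)) ≤
      ENNReal.ofReal C * ∫⁻ w, ‖kern (2 + γ) a w‖ₑ ∂weightedArea γ := by
  have hγ1 : 0 < 1 + γ := by linarith
  set c₁ : ℝ := (1 + γ) * 2 ^ (-|γ|) / π * 3 ^ (-(2 + γ)) * 2
  set c₂ : ℝ := 2 ^ (-(2 + γ))
  have hc₁ : 0 < c₁ := by positivity
  have hc₂ : 0 < c₂ := by positivity
  refine ⟨c₁⁻¹ + 2 * c₂⁻¹, by positivity, fun a ha => ?_⟩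
  have hx : 0 < 1 - ‖a‖ := by linarith [mem_ball_zero_iff.1 ha]
  have hlog : Real.log (2 / defect a) ≤ (Real.log (1 / (1 - ‖a‖)) - 1) + 2 := by
    calc Real.log (2 / defect a) ≤ Real.log (2 * (1 / (1 - ‖a‖))) := by
          rw [mul_one_div]
          have := defect_pos ha
          exact Real.log_le_log (by positivity)
            (div_le_div_of_nonneg_left two_pos.le hx (one_sub_norm_le_defect ha))
      _ = Real.log 2 + Real.log (1 / (1 - ‖a‖)) := Real.log_mul two_ne_zero (by positivity)
      _ ≤ _ := by linarith [Real.log_two_lt_d9]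
  have hcancel {c : ℝ} (hc : 0 < c) {y I : ℝ≥0∞} (h : ENNReal.ofReal c * y ≤ I) :
      y ≤ ENNReal.ofReal c⁻¹ * I := by
    calc y = ENNReal.ofReal c⁻¹ * (ENNReal.ofReal c * y) := by
          rw [← mul_assoc, ← ENNReal.ofReal_mul (by positivity), inv_mul_cancel₀ hc.ne',
            ENNReal.ofReal_one, one_mul]
      _ ≤ _ := by gcongr
  have hone : (1 : ℝ≥0∞) ≤ ENNReal.ofReal c₂⁻¹ * ∫⁻ w, ‖kern (2 + γ) a w‖ₑ ∂weightedArea γ :=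
    hcancel hc₂ (by rw [mul_one]; exact ofReal_two_rpow_le_lintegral_enorm_kern hγ ha)
  calc ENNReal.ofReal (Real.log (2 / defect a))
      ≤ ENNReal.ofReal (Real.log (1 / (1 - ‖a‖)) - 1) + 2 * 1 := by
        refine (ENNReal.ofReal_le_ofReal hlog).trans (ENNReal.ofReal_add_le.trans_eq (by simp))
    _ ≤ _ := by
        rw [ENNReal.ofReal_add (by positivity) (by positivity), add_mul,
          ENNReal.ofReal_mul two_pos.le, ENNReal.ofReal_ofNat, mul_assoc]
        gcongr
        exact hcancel hc₁ (ofReal_log_sub_one_le_lintegral_enorm_kern hγ ha)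

end ForelliRudin

section MeanValue

lemma aestronglyMeasurable_of_continuousOn {μ : Measure ℂ} (hμ : ∀ᵐ z ∂μ, z ∈ unitDisk)
    {F : ℂ → ℂ} (hF : ContinuousOn F unitDisk) : AEStronglyMeasurable F μ := by
  rw [← Measure.restrict_eq_self_of_ae_mem hμ]
  exact hF.aestronglyMeasurable measurableSet_ball

lemma measurable_indicator_of_continuousOn {F : ℂ → ℂ} (hF : ContinuousOn F unitDisk) :
    Measurable (unitDisk.indicator F) := by
  classical
  rw [← Set.piecewise_eq_indicator]
  exact hF.measurable_piecewise continuousOn_const measurableSet_ball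

lemma integral_comp_mul_circleMap {H : ℂ → ℂ} (hd : DifferentiableOn ℂ H unitDisk) {z : ℂ}
    (hz : z ∈ unitDisk) :
    ∫ θ in Set.Ioc 0 (2 * π), H (circleMap 0 1 θ * z) = 2 * π * H 0 := by
  have hmaps : Set.MapsTo (fun ζ => ζ * z) (Metric.closedBall (0 : ℂ) 1) unitDisk := by
    intro ζ hζ
    have hζ1 : ‖ζ‖ ≤ 1 := by simpa using hζ
    rw [unitDisk, mem_ball_zero_iff, norm_mul]
    nlinarith [norm_nonneg ζ, norm_nonneg z, mem_ball_zero_iff.1 hz]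
  have hdz : DiffContOnCl ℂ (fun ζ => H (ζ * z)) (Metric.ball 0 |1|) := by
    refine DifferentiableOn.diffContOnCl ?_
    rw [abs_one, closure_ball _ one_ne_zero]
    exact hd.comp (by fun_prop) hmaps
  have havg := hdz.circleAverage
  rw [Real.circleAverage_def, intervalIntegral.integral_of_le (by positivity), zero_mul] at havg
  rw [← havg, Complex.real_smul, ← mul_assoc]
  push_cast
  rw [mul_inv_cancel₀ (by simp), one_mul]

theorem integral_weightedArea_eq_apply_zero {γ : ℝ} (hγ : -1 < γ) {H : ℂ → ℂ}
    (hd : DifferentiableOn ℂ H unitDisk) (hi : Integrable H (weightedArea γ)) :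
    ∫ z, H z ∂weightedArea γ = H 0 := by
  have := isProbabilityMeasure_weightedArea hγ
  have hm := measurable_indicator_of_continuousOn hd.continuousOn
  have hae : H =ᵐ[weightedArea γ] unitDisk.indicator H :=
    (ae_mem_unitDisk γ).mono fun z hz => (Set.indicator_of_mem hz H).symm
  have hpres (θ : ℝ) : MeasurePreserving (fun z => circleMap 0 1 θ * z)
      (weightedArea γ) (weightedArea γ) :=
    measurePreserving_mul_weightedArea γ (by simp)
  have hemb (θ : ℝ) : MeasurableEmbedding fun z => circleMap 0 1 θ * z :=
    (Homeomorph.mulLeft₀ _ (circleMap_ne_center one_ne_zero)).measurableEmbedding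
  have hcirc : ∀ z ∈ unitDisk, ∫ θ in Set.Ioc 0 (2 * π),
      unitDisk.indicator H (circleMap 0 1 θ * z) = 2 * π * H 0 := fun z hz => by
    rw [← integral_comp_mul_circleMap hd hz]
    congr with θ
    refine Set.indicator_of_mem ?_ H
    simpa [unitDisk] using hz
  have hint : Integrable
      (Function.uncurry fun (θ : ℝ) z => unitDisk.indicator H (circleMap 0 1 θ * z))
      ((volume.restrict (Set.Ioc 0 (2 * π))).prod (weightedArea γ)) := by
    refine (integrable_prod_iff ?_).2 ⟨ae_of_all _ fun θ => ?_, ?_⟩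
    · exact (hm.comp (by fun_prop)).aestronglyMeasurable
    · exact (hpres θ).integrable_comp_of_integrable (hi.congr hae)
    · simp only [Function.uncurry_apply_pair,
        (hpres _).integral_comp (hemb _) fun z => ‖unitDisk.indicator H z‖]
      exact integrable_const _
  have hswap := integral_integral_swap hint
  simp only [(hpres _).integral_comp (hemb _) (unitDisk.indicator H)] at hswap
  rw [integral_congr_ae ((ae_mem_unitDisk γ).mono hcirc), ← integral_congr_ae hae] at hswap
  simpa [Real.pi_pos.le, Real.pi_ne_zero] using hswap

end MeanValue

section Mobius

/-- The involutive automorphism of the disk exchanging `0` and `a`. -/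
noncomputable def mobius (a z : ℂ) : ℂ := (a - z) / (1 - z * conj a)

lemma ofReal_defect (z : ℂ) : (defect z : ℂ) = 1 - z * conj z := by
  rw [Complex.mul_conj, Complex.normSq_eq_norm_sq, defect]; push_cast; rfl

lemma defect_mobius {a z : ℂ} (ha : a ∈ unitDisk) (hz : z ∈ unitDisk) :
    defect (mobius a z) = defect a * defect z / ‖1 - z * conj a‖ ^ 2 := by
  have h0 := one_sub_mul_conj_ne_zero hz ha
  have h0' := one_sub_mul_conj_ne_zero ha hz
  have hc : conj (1 - z * conj a) = 1 - a * conj z := by simp [mul_comm]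
  have hsq : ((‖1 - z * conj a‖ ^ 2 : ℝ) : ℂ) = (1 - z * conj a) * (1 - a * conj z) := by
    rw [← Complex.normSq_eq_norm_sq, ← Complex.mul_conj, hc]
  apply Complex.ofReal_injective
  rw [Complex.ofReal_div, hsq, Complex.ofReal_mul, ofReal_defect, ofReal_defect, ofReal_defect,
    mobius, map_div₀, hc, map_sub]
  field_simp
  ring

lemma mobius_mem {a z : ℂ} (ha : a ∈ unitDisk) (hz : z ∈ unitDisk) : mobius a z ∈ unitDisk := by
  have hpos : 0 < defect (mobius a z) := by
    rw [defect_mobius ha hz]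
    exact div_pos (mul_pos (defect_pos ha) (defect_pos hz))
      (pow_pos (norm_one_sub_mul_conj_pos hz ha) 2)
  rw [unitDisk, mem_ball_zero_iff]
  unfold defect at hpos
  nlinarith [norm_nonneg (mobius a z)]

lemma one_sub_mobius_mul_conj {a z : ℂ} (ha : a ∈ unitDisk) (hz : z ∈ unitDisk) :
    1 - mobius a z * conj a = defect a / (1 - z * conj a) := by
  have h0 := one_sub_mul_conj_ne_zero hz ha
  rw [ofReal_defect, mobius]; field_simp; ring

lemma mobius_mobius {a z : ℂ} (ha : a ∈ unitDisk) (hz : z ∈ unitDisk) :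
    mobius a (mobius a z) = z := by
  have h0 := one_sub_mul_conj_ne_zero hz ha
  have hd : (defect a : ℂ) ≠ 0 := by exact_mod_cast (defect_pos ha).ne'
  rw [mobius, one_sub_mobius_mul_conj ha hz, div_eq_iff (div_ne_zero hd h0), mobius, ofReal_defect]
  field_simp; ring

lemma mobius_zero (a : ℂ) : mobius a 0 = a := by simp [mobius]

lemma hasDerivAt_mobius {a z : ℂ} (ha : a ∈ unitDisk) (hz : z ∈ unitDisk) :
    HasDerivAt (mobius a) (-(defect a / (1 - z * conj a) ^ 2)) z := by
  have h0 := one_sub_mul_conj_ne_zero hz ha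
  have hnum : HasDerivAt (fun z : ℂ => a - z) (-1) z := by
    simpa using (hasDerivAt_id z).const_sub a
  have hden : HasDerivAt (fun z : ℂ => 1 - z * conj a) (-conj a) z := by
    simpa using ((hasDerivAt_id z).mul_const (conj a)).const_sub 1
  refine (hnum.div hden h0).congr_deriv ?_
  rw [ofReal_defect]; field_simp; ring

lemma injOn_mobius {a : ℂ} (ha : a ∈ unitDisk) : Set.InjOn (mobius a) unitDisk :=
  Set.LeftInvOn.injOn fun _ => mobius_mobius ha

lemma image_mobius {a : ℂ} (ha : a ∈ unitDisk) : mobius a '' unitDisk = unitDisk :=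
  Set.Subset.antisymm (Set.image_subset_iff.2 fun _ => mobius_mem ha)
    fun z hz => ⟨mobius a z, mobius_mem ha hz, mobius_mobius ha hz⟩

lemma measurable_mobius (a : ℂ) : Measurable (mobius a) := by
  unfold mobius; fun_prop

lemma abs_det_toSpanSingleton (d : ℂ) :
    |((ContinuousLinearMap.toSpanSingleton ℂ d).restrictScalars ℝ).det| = ‖d‖ ^ 2 := by
  have h : ((ContinuousLinearMap.toSpanSingleton ℂ d).restrictScalars ℝ).det =
      Complex.normSq d := by
    rw [ContinuousLinearMap.det, ← Algebra.norm_complex_apply]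
    have h := LinearMap.det_restrictScalars (R := ℝ)
      (f := (ContinuousLinearMap.toSpanSingleton ℂ d : ℂ →ₗ[ℂ] ℂ))
    rw [LinearMap.det_ring] at h
    simpa using h
  rw [h, Complex.normSq_eq_norm_sq, abs_of_nonneg (by positivity)]

lemma sq_norm_deriv_mobius_mul_weight {w u : ℂ} (γ : ℝ) (hw : w ∈ unitDisk) (hu : u ∈ unitDisk) :
    ‖-((defect w : ℂ) / (1 - u * conj w) ^ 2)‖ ^ 2 * weight γ (mobius w u) =
      defect w ^ (2 + γ) * ‖kern (2 + γ) w u‖ ^ 2 * weight γ u := by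
  have hdw := defect_pos hw
  have hdu := defect_pos hu
  have hN := norm_one_sub_mul_conj_pos hu hw
  rw [weight_eq_mul_defect_rpow, weight_eq_mul_defect_rpow, defect_mobius hw hu, norm_kern,
    norm_one_sub_mul_conj_comm w u, norm_neg, norm_div, norm_pow, Complex.norm_of_nonneg hdw.le,
    Real.div_rpow (by positivity) (by positivity), Real.mul_rpow hdw.le hdu.le,
    Real.rpow_neg hN.le, Real.rpow_add hdw, Real.rpow_add hN, ← Real.rpow_natCast_mul hN.le,
    mul_comm ((2 : ℕ) : ℝ) γ, Real.rpow_mul_natCast hN.le, Real.rpow_two, Real.rpow_two]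
  field_simp

/-- Under `mobius w` the measure `ω_γ dA` is multiplied by the squared modulus of the normalized
reproducing kernel at `w`. -/
theorem measurePreserving_mobius (γ : ℝ) {w : ℂ} (hw : w ∈ unitDisk) :
    MeasurePreserving (mobius w) ((weightedArea γ).withDensity fun u =>
      ENNReal.ofReal (defect w ^ (2 + γ) * ‖kern (2 + γ) w u‖ ^ 2)) (weightedArea γ) := by
  have hk : Measurable fun u => kern (2 + γ) w u :=
    measurable_kern_comp _ measurable_const measurable_id
  refine ⟨measurable_mobius w, Measure.ext_of_lintegral _ fun F hF => ?_⟩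
  have hdet : ∀ u ∈ unitDisk, HasFDerivWithinAt (mobius w)
      ((ContinuousLinearMap.toSpanSingleton ℂ
        (-(defect w / (1 - u * conj w) ^ 2) : ℂ)).restrictScalars ℝ) unitDisk u := fun u hu =>
    ((hasDerivAt_mobius hw hu).hasFDerivAt.restrictScalars ℝ).hasFDerivWithinAt
  rw [lintegral_map hF (measurable_mobius w), lintegral_withDensity_eq_lintegral_mul_non_measurable
      _ (by fun_prop) (by simp), lintegral_weightedArea, lintegral_weightedArea]
  conv_rhs => rw [← image_mobius hw]
  rw [lintegral_image_eq_lintegral_abs_det_fderiv_mul volume measurableSet_ball hdet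
    (injOn_mobius hw)]
  refine setLIntegral_congr_fun measurableSet_ball fun u hu => ?_
  have hd := defect_pos hw
  simp only [Pi.mul_apply]
  rw [← mul_assoc, ← mul_assoc, abs_det_toSpanSingleton, ← ENNReal.ofReal_mul' (by positivity),
    ← ENNReal.ofReal_mul (by positivity), ← mul_div_assoc,
    sq_norm_deriv_mobius_mul_weight γ hw hu]
  congr 2; ring

end Mobius

section ReproducingFormula

lemma kern_ne_zero (b : ℝ) {z w : ℂ} (hz : z ∈ unitDisk) (hw : w ∈ unitDisk) :
    kern b z w ≠ 0 := by
  rw [← norm_pos_iff, norm_kern]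
  exact Real.rpow_pos_of_pos (norm_one_sub_mul_conj_pos hz hw) _

lemma hasDerivAt_kern (b : ℝ) {z u : ℂ} (hz : z ∈ unitDisk) (hu : u ∈ unitDisk) :
    HasDerivAt (fun z => kern b z u) (b * conj u * kern (b + 1) z u) z := by
  have hslit := one_sub_mul_conj_mem_slitPlane hz hu
  have hbase : HasDerivAt (fun z : ℂ => 1 - z * conj u) (-conj u) z := by
    simpa using ((hasDerivAt_id z).mul_const (conj u)).const_sub 1
  have hkern : (fun z => kern b z u) = fun z => (1 - z * conj u) ^ (-b : ℂ) := by
    ext z; rw [kern, Complex.cpow_neg, one_div]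
  rw [hkern]
  refine (hbase.cpow_const hslit).congr_deriv ?_
  rw [kern, one_div, ← Complex.cpow_neg]
  push_cast
  rw [show (-(b + 1) : ℂ) = -b - 1 by ring]
  ring

lemma differentiableAt_kern_left (b : ℝ) {z w : ℂ} (hz : z ∈ unitDisk) (hw : w ∈ unitDisk) :
    DifferentiableAt ℂ (fun z => kern b z w) z :=
  (hasDerivAt_kern b hz hw).differentiableAt

lemma continuousOn_kern (b : ℝ) {w : ℂ} (hw : w ∈ unitDisk) :
    ContinuousOn (kern b w) unitDisk := by
  have h : ContinuousOn (fun u => conj (kern b u w)) unitDisk := fun u hu =>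
    (Complex.continuous_conj.continuousAt.comp
      (differentiableAt_kern_left b hu hw).continuousAt).continuousWithinAt
  exact h.congr fun u hu => (conj_kern b hu hw).symm

lemma norm_kern_le (b : ℝ) {w u : ℂ} (hw : w ∈ unitDisk) (hu : u ∈ unitDisk) :
    ‖kern b w u‖ ≤ (1 - ‖w‖) ^ (-|b|) * 2 ^ |b| := by
  have hpos := norm_one_sub_mul_conj_pos hw hu
  have hw1 : 0 < 1 - ‖w‖ := by linarith [mem_ball_zero_iff.1 hw]
  rw [norm_kern]
  rcases le_total 0 b with hb | hb
  · rw [abs_of_nonneg hb]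
    calc ‖1 - w * conj u‖ ^ (-b) ≤ (1 - ‖w‖) ^ (-b) * 1 := by
          rw [mul_one]
          exact Real.rpow_le_rpow_of_nonpos hw1 (one_sub_norm_le_norm_one_sub_mul_conj w hu)
            (by linarith)
      _ ≤ _ := by gcongr; exact Real.one_le_rpow (by norm_num) hb
  · rw [abs_of_nonpos hb]
    calc ‖1 - w * conj u‖ ^ (-b) ≤ 1 * 2 ^ (-b) := by
          rw [one_mul]
          exact Real.rpow_le_rpow hpos.le (norm_one_sub_mul_conj_le_two hw hu) (by linarith)
      _ ≤ _ := by
          gcongr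
          exact Real.one_le_rpow_of_pos_of_le_one_of_nonpos hw1 (by linarith [norm_nonneg w])
            (by linarith)

lemma integrable_mul_kern {μ : Measure ℂ} (hμ : ∀ᵐ z ∂μ, z ∈ unitDisk) (b : ℝ) {h : ℂ → ℂ}
    (hi : Integrable h μ) {w : ℂ} (hw : w ∈ unitDisk) :
    Integrable (fun u => h u * kern b w u) μ :=
  hi.mul_bdd (c := (1 - ‖w‖) ^ (-|b|) * 2 ^ |b|)
    (aestronglyMeasurable_of_continuousOn hμ (continuousOn_kern b hw))
    (hμ.mono fun _ hu => norm_kern_le b hw hu)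

lemma sq_norm_kern_mul_inv_kern (b : ℝ) {w u : ℂ} (hw : w ∈ unitDisk) (hu : u ∈ unitDisk) :
    (‖kern b w u‖ ^ 2 : ℝ) * (kern b u w)⁻¹ = kern b w u := by
  rw [← conj_kern b hw hu, ← Complex.normSq_eq_norm_sq, ← Complex.mul_conj, mul_assoc,
    mul_inv_cancel₀ (by simpa using kern_ne_zero b hw hu), mul_one]

/-- Apply the mean value property to `(h / kern (2 + γ) · w) ∘ mobius w`. -/
theorem integral_mul_kern {γ : ℝ} (hγ : -1 < γ) {h : ℂ → ℂ}
    (hd : DifferentiableOn ℂ h unitDisk) (hi : Integrable h (weightedArea γ))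
    {w : ℂ} (hw : w ∈ unitDisk) :
    ∫ u, h u * kern (2 + γ) w u ∂weightedArea γ = h w := by
  have hdw := Real.rpow_pos_of_pos (defect_pos hw) (2 + γ)
  set D : ℝ := defect w ^ (2 + γ)
  set H : ℂ → ℂ := fun u => h u * (kern (2 + γ) u w)⁻¹
  set J : ℂ → ℝ≥0∞ := fun u => ENNReal.ofReal (D * ‖kern (2 + γ) w u‖ ^ 2)
  have hpres := measurePreserving_mobius γ hw
  have hJ : Measurable J := by
    have := measurable_kern_comp (F := fun _ => w) (2 + γ) measurable_const measurable_id
    fun_prop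
  have hJtop : ∀ᵐ u ∂weightedArea γ, J u < ∞ := by simp [J]
  have hHd : DifferentiableOn ℂ (fun u => H (mobius w u)) unitDisk :=
    (hd.mul (DifferentiableOn.inv (fun u hu =>
      (differentiableAt_kern_left _ hu hw).differentiableWithinAt)
      fun u hu => kern_ne_zero _ hu hw)).comp
      (fun u hu => (hasDerivAt_mobius hw hu).differentiableAt.differentiableWithinAt)
      fun u hu => mobius_mem hw hu
  have hHm := aestronglyMeasurable_of_continuousOn (ae_mem_unitDisk γ) hHd.continuousOn
  have hJH : (fun u => (J u).toReal • H (mobius w (mobius w u))) =ᵐ[weightedArea γ]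
      fun u => D * (h u * kern (2 + γ) w u) := by
    filter_upwards [ae_mem_unitDisk γ] with u hu
    have hker := sq_norm_kern_mul_inv_kern (2 + γ) hw hu
    rw [mobius_mobius hw hu, ENNReal.toReal_ofReal (by positivity), Complex.real_smul]
    push_cast at hker ⊢
    linear_combination (D * h u) * hker
  have hHi : Integrable (fun u => H (mobius w u)) (weightedArea γ) := by
    rw [← hpres.integrable_comp hHm]
    refine (integrable_withDensity_iff_integrable_smul' hJ hJtop).2 (Integrable.congr ?_ hJH.symm)
    exact (integrable_mul_kern (ae_mem_unitDisk γ) _ hi hw).const_mul _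
  have hHw : H w = D * h w := by
    simp only [H, kern, one_div, inv_inv]
    rw [← ofReal_defect, ← Complex.ofReal_cpow (defect_pos hw).le, mul_comm]
  have hmean := integral_weightedArea_eq_apply_zero hγ hHd hHi
  rw [mobius_zero, hHw] at hmean
  rw [← hpres.map_eq, integral_map hpres.aemeasurable (by rwa [hpres.map_eq]),
    integral_withDensity_eq_integral_toReal_smul hJ hJtop, integral_congr_ae hJH,
    integral_const_mul] at hmean
  exact mul_left_cancel₀ (by exact_mod_cast hdw.ne') hmean

end ReproducingFormula

section Bloch

/-- `IsBlochWith B g`: the function `g` is analytic on the disk and its Bloch seminorm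
`sup (1 - |z|²) |g' z|` is at most `B`. -/
structure IsBlochWith (B : ℝ) (g : ℂ → ℂ) : Prop where
  differentiableOn : DifferentiableOn ℂ g unitDisk
  defect_mul_norm_deriv_le : ∀ z ∈ unitDisk, defect z * ‖deriv g z‖ ≤ B

variable {B : ℝ} {g : ℂ → ℂ}

lemma IsBlochWith.nonneg (hg : IsBlochWith B g) : 0 ≤ B := by
  have h := hg.defect_mul_norm_deriv_le 0 (Metric.mem_ball_self one_pos)
  simp only [defect, norm_zero] at h
  linarith [norm_nonneg (deriv g 0)]

lemma IsBlochWith.hasDerivAt (hg : IsBlochWith B g) {z : ℂ} (hz : z ∈ unitDisk) :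
    HasDerivAt g (deriv g z) z :=
  (hg.differentiableOn.differentiableAt (Metric.isOpen_ball.mem_nhds hz)).hasDerivAt

lemma IsBlochWith.comp_mobius (hg : IsBlochWith B g) {a : ℂ} (ha : a ∈ unitDisk) :
    IsBlochWith B fun z => g (mobius a z) := by
  have hderiv : ∀ z ∈ unitDisk, HasDerivAt (fun z => g (mobius a z))
      (deriv g (mobius a z) * -(defect a / (1 - z * conj a) ^ 2)) z := fun z hz =>
    (hg.hasDerivAt (mobius_mem ha hz)).comp z (hasDerivAt_mobius ha hz)
  refine ⟨fun z hz => (hderiv z hz).differentiableAt.differentiableWithinAt, fun z hz => ?_⟩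
  calc defect z * ‖deriv (fun z => g (mobius a z)) z‖
      = defect (mobius a z) * ‖deriv g (mobius a z)‖ := by
        rw [(hderiv z hz).deriv, norm_mul, norm_neg, norm_div, norm_pow,
          Complex.norm_of_nonneg (defect_pos ha).le, defect_mobius ha hz]
        ring
    _ ≤ B := hg.defect_mul_norm_deriv_le _ (mobius_mem ha hz)

lemma IsBlochWith.comp_mul (hg : IsBlochWith B g) {r : ℝ} (hr0 : 0 ≤ r) (hr1 : r ≤ 1) :
    IsBlochWith B fun z => g (r * z) := by
  have hmem : ∀ z ∈ unitDisk, (r : ℂ) * z ∈ unitDisk := fun _ => ofReal_mul_mem_unitDisk hr0 hr1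
  have hderiv : ∀ z ∈ unitDisk, HasDerivAt (fun z => g (r * z)) (deriv g (r * z) * r) z :=
    fun z hz => (hg.hasDerivAt (hmem z hz)).comp z
      (by simpa using (hasDerivAt_id z).const_mul (r : ℂ))
  refine ⟨fun z hz => (hderiv z hz).differentiableAt.differentiableWithinAt, fun z hz => ?_⟩
  calc defect z * ‖deriv (fun z => g (r * z)) z‖
      = defect z * (‖deriv g (r * z)‖ * r) := by
        rw [(hderiv z hz).deriv, norm_mul, Complex.norm_of_nonneg hr0]
    _ ≤ defect (r * z) * (‖deriv g (r * z)‖ * 1) := by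
        have := (defect_pos (hmem z hz)).le
        have := defect_le_defect_ofReal_mul hr0 hr1 z
        gcongr
    _ ≤ B := by rw [mul_one]; exact hg.defect_mul_norm_deriv_le _ (hmem z hz)

lemma IsBlochWith.norm_deriv_ofReal_mul_mul_le (hg : IsBlochWith B g) {ζ : ℂ}
    (hζ : ζ ∈ unitDisk) {t : ℝ} (ht0 : 0 ≤ t) (ht1 : t ≤ 1) :
    ‖deriv g (t * ζ) * ζ‖ ≤ B * (‖ζ‖ / (1 - t * ‖ζ‖)) := by
  have hmem := ofReal_mul_mem_unitDisk ht0 ht1 hζ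
  have hnorm : ‖(t : ℂ) * ζ‖ = t * ‖ζ‖ := by rw [norm_mul, Complex.norm_of_nonneg ht0]
  have hpos := sub_pos.2 (mem_ball_zero_iff.1 hmem)
  have hdefect := one_sub_norm_le_defect hmem
  rw [hnorm] at hpos hdefect
  have hderiv : ‖deriv g (t * ζ)‖ ≤ B / (1 - t * ‖ζ‖) := by
    rw [le_div_iff₀' hpos]
    exact (mul_le_mul_of_nonneg_right hdefect (norm_nonneg _)).trans
      (hg.defect_mul_norm_deriv_le _ hmem)
  rw [norm_mul, ← mul_comm_div]
  gcongr

lemma IsBlochWith.norm_sub_apply_zero_le (hg : IsBlochWith B g) {ζ : ℂ} (hζ : ζ ∈ unitDisk) :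
    ‖g ζ - g 0‖ ≤ B * Real.log (2 / defect ζ) := by
  have hζ1 : 0 < 1 - ‖ζ‖ := sub_pos.2 (mem_ball_zero_iff.1 hζ)
  have hderiv : ∀ t ∈ Set.Icc (0 : ℝ) 1,
      HasDerivAt (fun t : ℝ => g (t * ζ) - g 0) (deriv g (t * ζ) * ζ) t := fun t ht => by
    have h : HasDerivAt (fun t : ℝ => (t : ℂ) * ζ) ζ t := by
      simpa using (Complex.ofRealCLM.hasDerivAt (x := t)).mul_const ζ
    exact ((hg.hasDerivAt (ofReal_mul_mem_unitDisk ht.1 ht.2 hζ)).comp t h).sub_const _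
  have hlog : ∀ t ∈ Set.Icc (0 : ℝ) 1, HasDerivAt (fun t : ℝ => -B * Real.log (1 - t * ‖ζ‖))
      (B * (‖ζ‖ / (1 - t * ‖ζ‖))) t := fun t ht => by
    have hpos : 0 < 1 - t * ‖ζ‖ := by nlinarith [ht.2, norm_nonneg ζ]
    have h : HasDerivAt (fun t : ℝ => 1 - t * ‖ζ‖) (-‖ζ‖) t := by
      simpa using ((hasDerivAt_id t).mul_const ‖ζ‖).const_sub 1
    exact ((h.log hpos.ne').const_mul (-B)).congr_deriv (by ring)
  have hmain := image_norm_le_of_norm_deriv_right_le_deriv_boundary'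
    (fun t ht => (hderiv t ht).continuousAt.continuousWithinAt)
    (fun t ht => (hderiv t (Set.Ico_subset_Icc_self ht)).hasDerivWithinAt) (by simp)
    (fun t ht => (hlog t ht).continuousAt.continuousWithinAt)
    (fun t ht => (hlog t (Set.Ico_subset_Icc_self ht)).hasDerivWithinAt)
    (fun t ht => hg.norm_deriv_ofReal_mul_mul_le hζ ht.1 ht.2.le) (Set.right_mem_Icc.2 zero_le_one)
  simp only [Complex.ofReal_one, one_mul] at hmain
  rw [neg_mul, ← mul_neg, ← Real.log_inv] at hmain
  refine hmain.trans (mul_le_mul_of_nonneg_left (Real.log_le_log (by positivity) ?_) hg.nonneg)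
  rw [inv_eq_one_div, div_le_div_iff₀ hζ1 (defect_pos hζ)]
  linarith [defect_le_two_mul_one_sub_norm hζ]

theorem IsBlochWith.norm_sub_le (hg : IsBlochWith B g) {a w : ℂ} (ha : a ∈ unitDisk)
    (hw : w ∈ unitDisk) : ‖g w - g a‖ ≤ B * Real.log (2 / defect (mobius a w)) := by
  have h := (hg.comp_mobius ha).norm_sub_apply_zero_le (mobius_mem ha hw)
  rwa [mobius_mobius ha hw, mobius_zero] at h

lemma IsBlochWith.norm_le (hg : IsBlochWith B g) {a : ℂ} (ha : a ∈ unitDisk) :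
    ‖g a‖ ≤ ‖g 0‖ + B * Real.log (2 / defect a) := by
  linarith [norm_le_norm_add_norm_sub' (g a) (g 0), hg.norm_sub_apply_zero_le ha]

end Bloch

section BergmanProjection

theorem hasDerivAt_integral_mul_kern {ν : Measure ℂ} (hν : ∀ᵐ u ∂ν, u ∈ unitDisk) (b : ℝ)
    {φ : ℂ → ℂ} (hφ : Integrable φ ν) {z : ℂ} (hz : z ∈ unitDisk) :
    HasDerivAt (fun z => ∫ u, φ u * kern b z u ∂ν)
      (∫ u, φ u * (b * conj u * kern (b + 1) z u) ∂ν) z := by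
  set ε := (1 - ‖z‖) / 2
  have hε : 0 < ε := half_pos (sub_pos.2 (mem_ball_zero_iff.1 hz))
  have hball : ∀ x ∈ Metric.ball z ε, x ∈ unitDisk ∧ ε ≤ 1 - ‖x‖ := fun x hx => by
    have hxz : ‖x - z‖ < ε := by simpa [dist_eq_norm] using hx
    have htri := norm_le_norm_add_norm_sub' x z
    have hsum : 2 * ε = 1 - ‖z‖ := by ring
    exact ⟨mem_ball_zero_iff.2 (by linarith), by linarith⟩
  have hmeas (c : ℝ) {x : ℂ} (hx : x ∈ unitDisk) : AEStronglyMeasurable (kern c x) ν :=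
    aestronglyMeasurable_of_continuousOn hν (continuousOn_kern c hx)
  refine (hasDerivAt_integral_of_dominated_loc_of_deriv_le (Metric.ball_mem_nhds z hε)
    (F := fun z u => φ u * kern b z u) (F' := fun z u => φ u * (b * conj u * kern (b + 1) z u))
    (bound := fun u => ‖φ u‖ * (|b| * 1 * (ε ^ (-|b + 1|) * 2 ^ |b + 1|)))
    ?_ (integrable_mul_kern hν b hφ hz) ?_ ?_ (hφ.norm.mul_const _) ?_).2
  · filter_upwards [Metric.ball_mem_nhds z hε] with x hx
    exact hφ.1.mul (hmeas b (hball x hx).1)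
  · exact hφ.1.mul ((Continuous.aestronglyMeasurable (by fun_prop)).mul (hmeas (b + 1) hz))
  · filter_upwards [hν] with u hu x hx
    obtain ⟨hx1, hxε⟩ := hball x hx
    have hkern : ‖kern (b + 1) x u‖ ≤ ε ^ (-|b + 1|) * 2 ^ |b + 1| := by
      refine (norm_kern_le (b + 1) hx1 hu).trans (mul_le_mul_of_nonneg_right ?_ (by positivity))
      exact Real.rpow_le_rpow_of_nonpos hε hxε (by simp)
    have hu1 := (mem_ball_zero_iff.1 hu).le
    rw [norm_mul, norm_mul, norm_mul, RCLike.norm_conj, Complex.norm_real, Real.norm_eq_abs]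
    gcongr
  · filter_upwards [hν] with u hu x hx
    exact (hasDerivAt_kern b (hball x hx).1 hu).const_mul _

lemma differentiableOn_integral_mul_kern {ν : Measure ℂ} (hν : ∀ᵐ u ∂ν, u ∈ unitDisk) (b : ℝ)
    {φ : ℂ → ℂ} (hφ : Integrable φ ν) :
    DifferentiableOn ℂ (fun z => ∫ u, φ u * kern b z u ∂ν) unitDisk := fun _ hz =>
  (hasDerivAt_integral_mul_kern hν b hφ hz).differentiableAt.differentiableWithinAt

/-- The Bergman projection of `L²(ω_β)` onto `L²_a(ω_β)`, extended to bounded functions. -/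
noncomputable def bergmanProj (β : ℝ) (φ : ℂ → ℂ) (w : ℂ) : ℂ :=
  ∫ u, φ u * kern (2 + β) w u ∂weightedArea β

lemma norm_integral_le_of_lintegral_le {X E : Type*} [MeasurableSpace X] [NormedAddCommGroup E]
    [NormedSpace ℝ E] {ν : Measure X} {F : X → E} {c : ℝ} (hc : 0 ≤ c)
    (h : ∫⁻ u, ‖F u‖ₑ ∂ν ≤ ENNReal.ofReal c) : ‖∫ u, F u ∂ν‖ ≤ c := by
  have hle := (enorm_integral_le_lintegral_enorm F).trans h
  rwa [← ofReal_norm, ENNReal.ofReal_le_ofReal_iff hc] at hle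

theorem exists_isBlochWith_bergmanProj {β : ℝ} (hβ : -1 < β) :
    ∃ B : ℝ, 0 < B ∧ ∀ φ : ℂ → ℂ, Measurable φ → (∀ z, ‖φ z‖ ≤ 1) →
      IsBlochWith B (bergmanProj β φ) ∧ ‖bergmanProj β φ 0‖ ≤ B := by
  have := isProbabilityMeasure_weightedArea hβ
  obtain ⟨C, hC, hFR⟩ := exists_lintegral_enorm_kern_le hβ one_pos
  have hβ2 : 0 < 2 + β := by linarith
  refine ⟨(2 + β) * C + 1, by positivity, fun φ hφ hφ1 => ?_⟩
  have hint : Integrable φ (weightedArea β) :=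
    Integrable.of_bound hφ.aestronglyMeasurable 1 (ae_of_all _ hφ1)
  refine ⟨⟨differentiableOn_integral_mul_kern (ae_mem_unitDisk β) _ hint, fun z hz => ?_⟩, ?_⟩
  · have hd := defect_pos hz
    have hpoint : ∀ u ∈ unitDisk, ‖φ u * (((2 + β : ℝ) : ℂ) * conj u * kern (2 + β + 1) z u)‖ₑ ≤
        ENNReal.ofReal (2 + β) * ‖kern (2 + β + 1) z u‖ₑ := fun u hu => by
      have hu1 := (mem_ball_zero_iff.1 hu).le
      rw [← ofReal_norm, ← ofReal_norm (kern _ _ _), ← ENNReal.ofReal_mul hβ2.le]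
      refine ENNReal.ofReal_le_ofReal ?_
      rw [norm_mul, norm_mul, norm_mul, RCLike.norm_conj, Complex.norm_of_nonneg hβ2.le]
      calc ‖φ u‖ * ((2 + β) * ‖u‖ * ‖kern (2 + β + 1) z u‖)
          ≤ 1 * ((2 + β) * 1 * ‖kern (2 + β + 1) z u‖) := by gcongr; exact hφ1 u
        _ = _ := by ring
    have hle : ‖deriv (bergmanProj β φ) z‖ ≤ (2 + β) * (C * defect z ^ (-1 : ℝ)) := by
      have hderiv : deriv (bergmanProj β φ) z = _ :=
        (hasDerivAt_integral_mul_kern (ae_mem_unitDisk β) (2 + β) hint hz).deriv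
      rw [hderiv]
      refine norm_integral_le_of_lintegral_le (by positivity)
        ((lintegral_mono_weightedArea hpoint).trans ?_)
      rw [lintegral_const_mul' _ _ ENNReal.ofReal_ne_top, ENNReal.ofReal_mul hβ2.le]
      gcongr
      exact hFR z hz
    calc defect z * ‖deriv (bergmanProj β φ) z‖
        ≤ defect z * ((2 + β) * (C * (defect z)⁻¹)) := by
          rw [Real.rpow_neg_one] at hle; gcongr
      _ = (2 + β) * C := by field_simp
      _ ≤ _ := by linarith
  · have hle : ‖bergmanProj β φ 0‖ ≤ 1 * (weightedArea β).real Set.univ :=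
      norm_integral_le_of_norm_le_const (ae_of_all _ fun u => by
        rw [kern_zero_left, mul_one]; exact hφ1 u)
    rw [probReal_univ] at hle
    nlinarith [mul_pos hβ2 hC]

end BergmanProjection

section Embedding

lemma bergmanNorm_eq {p : ℝ} (hp : 0 < p) (α : ℝ) (f : ℂ → ℂ) :
    bergmanNorm p α f = (∫⁻ z, ‖f z‖ₑ ^ p ∂weightedArea α) ^ (1 / p) := by
  unfold bergmanNorm
  rw [eLpNorm_eq_lintegral_rpow_enorm_toReal (by simpa using hp) (by simp),
    ENNReal.toReal_ofReal hp.le]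

lemma bergmanNorm_one (α : ℝ) (f : ℂ → ℂ) :
    bergmanNorm 1 α f = ∫⁻ z, ‖f z‖ₑ ∂weightedArea α := by
  rw [bergmanNorm_eq one_pos]; simp

lemma enorm_le_lintegral_mul_defect_rpow {γ : ℝ} (hγ : -1 < γ) {f : ℂ → ℂ}
    (hd : DifferentiableOn ℂ f unitDisk) (hi : Integrable f (weightedArea γ)) {z : ℂ}
    (hz : z ∈ unitDisk) :
    ‖f z‖ₑ ≤ (∫⁻ u, ‖f u‖ₑ ∂weightedArea γ) *
      ENNReal.ofReal (2 ^ (2 + γ) * defect z ^ (-(2 + γ))) := by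
  rw [← integral_mul_kern hγ hd hi hz]
  refine (enorm_integral_le_lintegral_enorm _).trans ?_
  rw [← lintegral_mul_const' _ _ ENNReal.ofReal_ne_top]
  refine lintegral_mono_weightedArea fun u hu => ?_
  rw [enorm_mul, enorm_kern]
  gcongr
  exact rpow_neg_le_mul_rpow_neg (defect_pos hz) two_pos
    (defect_le_two_mul_norm_one_sub_mul_conj hz hu) (by linarith)

lemma le_rpow_of_le_mul_rpow {p : ℝ} (hp0 : 0 < p) (hp1 : p ≤ 1) {x y : ℝ≥0∞} (hx : x ≠ ∞)
    (h : x ≤ y * x ^ (1 - p)) : x ≤ y ^ (1 / p) := by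
  have hp1' : 0 ≤ 1 - p := by linarith
  rcases eq_or_ne x 0 with rfl | hx0
  · exact zero_le
  have hpow0 : x ^ (1 - p) ≠ 0 := by simp [ENNReal.rpow_eq_zero_iff, hx0, hx]
  have hpow : x ^ p ≤ y := by
    rw [← ENNReal.mul_le_mul_iff_left hpow0 (ENNReal.rpow_ne_top_of_nonneg hp1' hx),
      ← ENNReal.rpow_add_of_nonneg _ _ hp0.le hp1', add_sub_cancel, ENNReal.rpow_one]
    exact h
  calc x = (x ^ p) ^ (1 / p) := by
        rw [← ENNReal.rpow_mul, mul_one_div_cancel hp0.ne', ENNReal.rpow_one]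
    _ ≤ y ^ (1 / p) := by gcongr

lemma one_lt_two_add_div {p α : ℝ} (hp0 : 0 < p) (hp1 : p ≤ 1) (hα : -1 < α) :
    1 < (2 + α) / p := by
  rw [lt_div_iff₀ hp0]; linarith

/-- Split `|f| = |f|^p |f|^(1 - p)` and apply the growth bound in `L¹_a(ω_γ)` to the second
factor. -/
lemma ofReal_defect_rpow_mul_enorm_le {p γ : ℝ} (hp0 : 0 < p) (hp1 : p ≤ 1) (hγ : -1 < γ)
    {f : ℂ → ℂ} (hd : DifferentiableOn ℂ f unitDisk) (hi : Integrable f (weightedArea γ)) {z : ℂ}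
    (hz : z ∈ unitDisk) :
    ENNReal.ofReal (defect z ^ ((2 + γ) * (1 - p))) * ‖f z‖ₑ ≤ ‖f z‖ₑ ^ p *
      ((∫⁻ z, ‖f z‖ₑ ∂weightedArea γ) * ENNReal.ofReal (2 ^ (2 + γ))) ^ (1 - p) := by
  have hp1' : 0 ≤ 1 - p := by linarith
  have hdz := defect_pos hz
  set I := ∫⁻ z, ‖f z‖ₑ ∂weightedArea γ
  set K : ℝ≥0∞ := ENNReal.ofReal (2 ^ (2 + γ))
  set d : ℝ≥0∞ := ENNReal.ofReal (defect z ^ ((2 + γ) * (1 - p)))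
  have hsplit : ‖f z‖ₑ = ‖f z‖ₑ ^ p * ‖f z‖ₑ ^ (1 - p) := by
    rw [← ENNReal.rpow_add_of_nonneg _ _ hp0.le hp1', add_sub_cancel, ENNReal.rpow_one]
  have hcancel : d * ENNReal.ofReal (defect z ^ (-(2 + γ))) ^ (1 - p) = 1 := by
    rw [ENNReal.ofReal_rpow_of_pos (by positivity), ← Real.rpow_mul hdz.le,
      ← ENNReal.ofReal_mul (by positivity), ← Real.rpow_add hdz, neg_mul, add_neg_cancel,
      Real.rpow_zero, ENNReal.ofReal_one]
  calc d * ‖f z‖ₑ = d * (‖f z‖ₑ ^ p * ‖f z‖ₑ ^ (1 - p)) := by rw [← hsplit]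
    _ ≤ d * (‖f z‖ₑ ^ p * (I * K * ENNReal.ofReal (defect z ^ (-(2 + γ)))) ^ (1 - p)) := by
        gcongr
        rw [mul_assoc, ← ENNReal.ofReal_mul (by positivity)]
        exact enorm_le_lintegral_mul_defect_rpow hγ hd hi hz
    _ = d * ENNReal.ofReal (defect z ^ (-(2 + γ))) ^ (1 - p) *
          (‖f z‖ₑ ^ p * (I * K) ^ (1 - p)) := by
        rw [ENNReal.mul_rpow_of_nonneg _ _ hp1']; ring
    _ = _ := by rw [hcancel, one_mul]

theorem exists_lintegral_le_bergmanNorm {p α : ℝ} (hp0 : 0 < p) (hp1 : p ≤ 1) (hα : -1 < α) :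
    ∃ C : ℝ≥0∞, C ≠ ∞ ∧ ∀ f : ℂ → ℂ, DifferentiableOn ℂ f unitDisk →
      Integrable f (weightedArea ((2 + α) / p - 2)) →
      ∫⁻ z, ‖f z‖ₑ ∂weightedArea ((2 + α) / p - 2) ≤ C * bergmanNorm p α f := by
  have hp1' : 0 ≤ 1 - p := by linarith
  set γ := (2 + α) / p - 2 with hγ_def
  have hγ : -1 < γ := by linarith [one_lt_two_add_div hp0 hp1 hα]
  have hexp : γ - α = (2 + γ) * (1 - p) := by rw [hγ_def]; field_simp; ring
  set c : ℝ≥0∞ := ENNReal.ofReal ((1 + γ) / (1 + α))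
  set K : ℝ≥0∞ := ENNReal.ofReal (2 ^ (2 + γ))
  refine ⟨(c * K ^ (1 - p)) ^ (1 / p), ?_, fun f hd hi => ?_⟩
  · exact ENNReal.rpow_ne_top_of_nonneg (by positivity) (ENNReal.mul_ne_top ENNReal.ofReal_ne_top
      (ENNReal.rpow_ne_top_of_nonneg hp1' ENNReal.ofReal_ne_top))
  set I := ∫⁻ z, ‖f z‖ₑ ∂weightedArea γ
  rw [bergmanNorm_eq hp0, ← ENNReal.mul_rpow_of_nonneg _ _ (by positivity)]
  refine le_rpow_of_le_mul_rpow hp0 hp1 hi.2.ne ?_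
  calc I = c * ∫⁻ z, ENNReal.ofReal (defect z ^ (γ - α)) * ‖f z‖ₑ ∂weightedArea α :=
        lintegral_weightedArea_eq_mul hα hγ _
    _ ≤ c * ∫⁻ z, ‖f z‖ₑ ^ p * (I * K) ^ (1 - p) ∂weightedArea α := by
        gcongr c * ?_
        rw [hexp]
        exact lintegral_mono_weightedArea fun z hz =>
          ofReal_defect_rpow_mul_enorm_le hp0 hp1 hγ hd hi hz
    _ = _ := by
        rw [lintegral_mul_const' _ _ (ENNReal.rpow_ne_top_of_nonneg hp1'
          (ENNReal.mul_ne_top hi.2.ne ENNReal.ofReal_ne_top)), ENNReal.mul_rpow_of_nonneg _ _ hp1']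
        ring

end Embedding

section Carleson

/-- The kernel test for Carleson measures: a substitute for the geometric condition that Carleson
squares of side `h` have measure `O(h ^ s)`, the parameter `t` being immaterial. -/
def KernelCarleson (μ : Measure ℂ) (s t : ℝ) : Prop :=
  ∃ C : ℝ, 0 < C ∧ ∀ a ∈ unitDisk,
    ∫⁻ w, ‖kern (s + t) a w‖ₑ ∂μ ≤ ENNReal.ofReal (C * defect a ^ (-t))

lemma differentiableOn_kern_left (b : ℝ) {a : ℂ} (ha : a ∈ unitDisk) :
    DifferentiableOn ℂ (fun w => kern b w a) unitDisk := fun _ hw =>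
  (differentiableAt_kern_left b hw ha).differentiableWithinAt

lemma enorm_kern_rpow (b : ℝ) {r : ℝ} (hr : 0 ≤ r) (z w : ℂ) :
    ‖kern b z w‖ₑ ^ r = ‖kern (b * r) z w‖ₑ := by
  rw [enorm_kern, enorm_kern, ENNReal.ofReal_rpow_of_nonneg (by positivity) hr,
    ← Real.rpow_mul (norm_nonneg _), neg_mul]

lemma le_one_add_rpow {q : ℝ} (hq : 1 ≤ q) (x : ℝ≥0∞) : x ≤ 1 + x ^ q := by
  rcases le_total x 1 with h | h
  · exact h.trans le_self_add
  · exact (by simpa using ENNReal.rpow_le_rpow_of_exponent_le h hq : x ≤ x ^ q).trans le_add_self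

variable {μ : Measure ℂ} {p α : ℝ}

lemma IsCarleson.exists_lintegral_rpow_le {q : ℝ} (hq : 0 < q) (h : IsCarleson μ q 1 α) :
    ∃ C : ℝ, 0 < C ∧ ∀ f : ℂ → ℂ, DifferentiableOn ℂ f unitDisk → ∀ A : ℝ, 0 ≤ A →
      ∫⁻ w, ‖f w‖ₑ ∂weightedArea α ≤ ENNReal.ofReal A →
      ∫⁻ w, ‖f w‖ₑ ^ q ∂μ ≤ ENNReal.ofReal ((C * A) ^ q) := by
  obtain ⟨C, hC, hcar⟩ := h
  refine ⟨C, hC, fun f hd A hA hle => ?_⟩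
  rw [← bergmanNorm_one] at hle
  have hnorm := hcar f ⟨hd, hle.trans_lt ENNReal.ofReal_lt_top⟩
  rw [eLpNorm_eq_lintegral_rpow_enorm_toReal (by simpa using hq) (by simp),
    ENNReal.toReal_ofReal hq.le] at hnorm
  have hroot : (∫⁻ w, ‖f w‖ₑ ^ q ∂μ) ^ (1 / q) ≤ ENNReal.ofReal (C * A) := by
    refine hnorm.trans ?_
    rw [ENNReal.ofReal_mul (NNReal.coe_nonneg C), ENNReal.ofReal_coe_nnreal]
    gcongr
  have hpow := ENNReal.rpow_le_rpow hroot hq.le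
  rwa [← ENNReal.rpow_mul, one_div_mul_cancel hq.ne', ENNReal.rpow_one,
    ENNReal.ofReal_rpow_of_nonneg (by positivity) hq.le] at hpow

theorem IsCarleson.kernelCarleson (hp0 : 0 < p) (hα : -1 < α) (h : IsCarleson μ (1 / p) 1 α)
    {t : ℝ} (ht : 0 < t) : KernelCarleson μ ((2 + α) / p) t := by
  obtain ⟨C, hC, hcar⟩ := h.exists_lintegral_rpow_le (one_div_pos.2 hp0)
  obtain ⟨C', hC', hFR⟩ := exists_lintegral_enorm_kern_le hα (t := p * t) (by positivity)
  refine ⟨(C * C') ^ (1 / p), by positivity, fun a ha => ?_⟩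
  have hda := defect_pos ha
  have htest := hcar (fun w => kern (2 + α + p * t) w a) (differentiableOn_kern_left _ ha)
    (C' * defect a ^ (-(p * t))) (by positivity)
    (by simpa only [enorm_kern_comm _ _ a] using hFR a ha)
  have hexp : (2 + α + p * t) * (1 / p) = (2 + α) / p + t := by field_simp
  simp only [enorm_kern_rpow _ (one_div_pos.2 hp0).le, hexp, enorm_kern_comm _ _ a] at htest
  refine htest.trans_eq ?_
  rw [← mul_assoc, Real.mul_rpow (by positivity) (by positivity), ← Real.rpow_mul hda.le]
  congr 3; field_simp

lemma IsBlochWith.norm_sub_le_rpow {B : ℝ} {g : ℂ → ℂ} (hg : IsBlochWith B g) {ε : ℝ} (hε : 0 < ε)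
    {a w : ℂ} (ha : a ∈ unitDisk) (hw : w ∈ unitDisk) :
    ‖g w - g a‖ ≤ B * (2 ^ ε / ε) *
      (defect a ^ (-ε) * defect w ^ (-ε) * ‖1 - w * conj a‖ ^ (2 * ε)) := by
  have hda := defect_pos ha
  have hdw := defect_pos hw
  have hN := norm_one_sub_mul_conj_pos hw ha
  have hdm := defect_pos (mobius_mem ha hw)
  have hlog := Real.log_le_rpow_div (x := 2 / defect (mobius a w)) (by positivity) hε
  refine (hg.norm_sub_le ha hw).trans ((mul_le_mul_of_nonneg_left hlog hg.nonneg).trans_eq ?_)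
  rw [defect_mobius ha hw, Real.div_rpow (by norm_num) (by positivity),
    Real.div_rpow (by positivity) (by positivity), Real.mul_rpow hda.le hdw.le,
    Real.rpow_neg hda.le, Real.rpow_neg hdw.le, Real.rpow_mul hN.le]
  norm_cast
  field_simp

lemma IsBlochWith.enorm_sub_mul_kern_le {B : ℝ} {g : ℂ → ℂ} (hg : IsBlochWith B g) {ε : ℝ}
    (hε : 0 < ε) (b : ℝ) {a w : ℂ} (ha : a ∈ unitDisk) (hw : w ∈ unitDisk) :
    ‖(g w - g a) * kern (b + 2 * ε) w a‖ₑ ≤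
      ENNReal.ofReal (B * (2 ^ ε / ε) * defect a ^ (-ε)) *
        (ENNReal.ofReal (defect w ^ (-ε)) * ‖kern b a w‖ₑ) := by
  have hB := hg.nonneg
  have hda := defect_pos ha
  have hdw := defect_pos hw
  have hN := norm_one_sub_mul_conj_pos hw ha
  rw [enorm_kern_comm, enorm_kern, ← ENNReal.ofReal_mul (by positivity),
    ← ENNReal.ofReal_mul (by positivity), ← ofReal_norm, norm_mul, norm_kern]
  refine ENNReal.ofReal_le_ofReal
    ((mul_le_mul_of_nonneg_right (hg.norm_sub_le_rpow hε ha hw) (by positivity)).trans_eq ?_)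
  rw [show -b = 2 * ε + -(b + 2 * ε) by ring, Real.rpow_add hN]
  ring

lemma exists_lintegral_sub_mul_kern_le (hα : -1 < α) {t : ℝ} (ht : 0 < t) :
    ∃ C : ℝ, 0 < C ∧ ∀ (B : ℝ) (g : ℂ → ℂ), IsBlochWith B g → ∀ a ∈ unitDisk,
      ∫⁻ w, ‖(g w - g a) * kern (2 + α + t) w a‖ₑ ∂weightedArea α ≤
        ENNReal.ofReal (C * B * defect a ^ (-t)) := by
  set ε := min t (α + 1) / 2
  have hε : 0 < ε := half_pos (lt_min ht (by linarith))
  have hεt : ε < t := by linarith [min_le_left t (α + 1), show 2 * ε = min t (α + 1) by ring]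
  have hεα : -1 < α - ε := by
    linarith [min_le_right t (α + 1), show 2 * ε = min t (α + 1) by ring]
  obtain ⟨C, hC, hFR⟩ := exists_lintegral_enorm_kern_le hεα (t := t - ε) (by linarith)
  set c : ℝ := (1 + α) / (1 + (α - ε))
  have hc : 0 < c := div_pos (by linarith) (by linarith)
  refine ⟨2 ^ ε / ε * c * C, by positivity, fun B g hg a ha => ?_⟩
  have hda := defect_pos ha
  have hB := hg.nonneg
  have hpoint : ∀ w ∈ unitDisk, ‖(g w - g a) * kern (2 + α + t) w a‖ₑ ≤
      ENNReal.ofReal (B * (2 ^ ε / ε) * defect a ^ (-ε)) * (ENNReal.ofReal (defect w ^ (-ε)) *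
        ‖kern (2 + (α - ε) + (t - ε)) a w‖ₑ) := fun w hw => by
    have h := hg.enorm_sub_mul_kern_le hε (2 + (α - ε) + (t - ε)) ha hw
    rwa [show 2 + (α - ε) + (t - ε) + 2 * ε = 2 + α + t by ring] at h
  calc _ ≤ _ := lintegral_mono_weightedArea hpoint
    _ = ENNReal.ofReal (B * (2 ^ ε / ε) * defect a ^ (-ε)) * (ENNReal.ofReal c *
          ∫⁻ w, ‖kern (2 + (α - ε) + (t - ε)) a w‖ₑ ∂weightedArea (α - ε)) := by
        rw [lintegral_const_mul' _ _ ENNReal.ofReal_ne_top, lintegral_weightedArea_eq_mul hεα hα]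
        congr 2
        refine lintegral_congr_weightedArea fun w hw => ?_
        have hdw := defect_pos hw
        rw [← mul_assoc, ← ENNReal.ofReal_mul (by positivity), ← Real.rpow_add hdw,
          show α - (α - ε) + -ε = 0 by ring, Real.rpow_zero, ENNReal.ofReal_one, one_mul]
    _ ≤ ENNReal.ofReal (B * (2 ^ ε / ε) * defect a ^ (-ε)) * (ENNReal.ofReal c *
          ENNReal.ofReal (C * defect a ^ (-(t - ε)))) := by
        gcongr
        exact hFR a ha
    _ = _ := by
        rw [← ENNReal.ofReal_mul hc.le, ← ENNReal.ofReal_mul (by positivity),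
          show -t = -ε + -(t - ε) by ring, Real.rpow_add hda]
        congr 1; ring

theorem IsCarleson.exists_lintegral_isBlochWith_le (hp0 : 0 < p) (hp1 : p ≤ 1) (hα : -1 < α)
    (h : IsCarleson μ (1 / p) 1 α) {B : ℝ} (hB : 0 < B) :
    ∃ C : ℝ, 0 < C ∧ ∀ g : ℂ → ℂ, IsBlochWith B g → ∀ a ∈ unitDisk,
      ∫⁻ w, ‖g w - g a‖ₑ * ‖kern ((2 + α) / p + 1) a w‖ₑ ∂μ ≤
        ENNReal.ofReal (C * defect a ^ (-1 : ℝ)) := by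
  obtain ⟨C, hC, hcar⟩ := h.exists_lintegral_rpow_le (one_div_pos.2 hp0)
  obtain ⟨C₁, hC₁, hker⟩ := h.kernelCarleson hp0 hα one_pos
  obtain ⟨C₂, hC₂, hosc⟩ := exists_lintegral_sub_mul_kern_le hα hp0
  refine ⟨C₁ + (C * (C₂ * B)) ^ (1 / p), by positivity, fun g hg a ha => ?_⟩
  have hda := defect_pos ha
  have hpow (w : ℂ) : ‖(g w - g a) * kern (2 + α + p) w a‖ₑ ^ (1 / p) =
      ‖g w - g a‖ₑ ^ (1 / p) * ‖kern ((2 + α) / p + 1) a w‖ₑ := by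
    rw [enorm_mul, ENNReal.mul_rpow_of_nonneg _ _ (by positivity),
      enorm_kern_rpow _ (by positivity),
      enorm_kern_comm, show (2 + α + p) * (1 / p) = (2 + α) / p + 1 by field_simp]
  have hint := hcar _ ((hg.differentiableOn.sub_const (g a)).mul
    (differentiableOn_kern_left (2 + α + p) ha)) _ (by positivity) (hosc B g hg a ha)
  calc _ ≤ ∫⁻ w, ‖kern ((2 + α) / p + 1) a w‖ₑ +
        ‖(g w - g a) * kern (2 + α + p) w a‖ₑ ^ (1 / p) ∂μ := by
        refine lintegral_mono fun w => ?_
        rw [hpow, ← one_add_mul]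
        gcongr
        exact le_one_add_rpow ((one_le_div₀ hp0).2 hp1) _
    _ = ∫⁻ w, ‖kern ((2 + α) / p + 1) a w‖ₑ ∂μ +
        ∫⁻ w, ‖(g w - g a) * kern (2 + α + p) w a‖ₑ ^ (1 / p) ∂μ :=
        lintegral_add_left (measurable_kern_comp _ measurable_const measurable_id).enorm _
    _ ≤ ENNReal.ofReal (C₁ * defect a ^ (-1 : ℝ)) +
        ENNReal.ofReal ((C * (C₂ * B * defect a ^ (-p))) ^ (1 / p)) :=
        add_le_add (hker a ha) hint
    _ = _ := by
        rw [← ENNReal.ofReal_add (by positivity) (by positivity)]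
        congr 1
        rw [← mul_assoc, Real.mul_rpow (by positivity) (by positivity), ← Real.rpow_mul hda.le,
          show -p * (1 / p) = -1 by field_simp]
        ring

end Carleson

section Toeplitz

lemma toeplitz_eq (μ : Measure ℂ) (β : ℝ) (f : ℂ → ℂ) (z : ℂ) :
    toeplitz μ β f z = ∫ w, f w * kern (2 + β) z w ∂μ := by
  unfold toeplitz kern
  simp only [mul_one_div]

lemma kern_ofReal_mul (b r : ℝ) (z w : ℂ) : kern b (r * z) w = kern b z (r * w) := by
  unfold kern
  congr 3
  rw [map_mul, Complex.conj_ofReal]; ring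

lemma norm_kern_ofReal_mul_le (b : ℝ) {r : ℝ} (hr0 : 0 ≤ r) (hr1 : r < 1) {w u : ℂ}
    (hw : w ∈ unitDisk) (hu : u ∈ unitDisk) :
    ‖kern b (r * w) u‖ ≤ (1 - r) ^ (-|b|) * 2 ^ |b| := by
  refine (norm_kern_le b (ofReal_mul_mem_unitDisk hr0 hr1.le hw) hu).trans ?_
  have hnorm : ‖(r : ℂ) * w‖ ≤ r := by
    rw [norm_mul, Complex.norm_of_nonneg hr0]
    exact mul_le_of_le_one_right hr0 (mem_ball_zero_iff.1 hw).le
  refine mul_le_mul_of_nonneg_right ?_ (by positivity)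
  exact Real.rpow_le_rpow_of_nonpos (by linarith) (by linarith) (by simp)

lemma norm_bergmanProj_ofReal_mul_le {β : ℝ} (hβ : -1 < β) {φ : ℂ → ℂ} (hφ1 : ∀ z, ‖φ z‖ ≤ 1)
    {r : ℝ} (hr0 : 0 ≤ r) (hr1 : r < 1) {w : ℂ} (hw : w ∈ unitDisk) :
    ‖bergmanProj β φ (r * w)‖ ≤ (1 - r) ^ (-|2 + β|) * 2 ^ |2 + β| := by
  have := isProbabilityMeasure_weightedArea hβ
  refine (norm_integral_le_of_norm_le_const ((ae_mem_unitDisk β).mono fun u hu => ?_)).trans_eq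
    (by rw [probReal_univ, mul_one])
  rw [norm_mul]
  exact (mul_le_of_le_one_left (norm_nonneg _) (hφ1 u)).trans
    (norm_kern_ofReal_mul_le (2 + β) hr0 hr1 hw hu)

variable {μ : Measure ℂ}

lemma differentiableOn_toeplitz (hμ : ∀ᵐ w ∂μ, w ∈ unitDisk) (β : ℝ) {f : ℂ → ℂ}
    (hf : Integrable f μ) : DifferentiableOn ℂ (toeplitz μ β f) unitDisk :=
  (differentiableOn_integral_mul_kern hμ (2 + β) hf).congr fun z _ => toeplitz_eq μ β f z

lemma integrable_kern [IsFiniteMeasure μ] (hμ : ∀ᵐ w ∂μ, w ∈ unitDisk) (b : ℝ) {z : ℂ}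
    (hz : z ∈ unitDisk) : Integrable (kern b z) μ := by
  simpa only [one_mul] using integrable_mul_kern hμ b (integrable_const (1 : ℂ)) hz

/-- The adjoint of `T_{μ,β}` with respect to the `L²(ω_β)` pairing is the embedding into `L²(μ)`.
The dilation by `r` makes all integrals converge. -/
theorem integral_mul_toeplitz [IsFiniteMeasure μ] (hμ : ∀ᵐ w ∂μ, w ∈ unitDisk) {β : ℝ}
    (hβ : -1 < β) {f : ℂ → ℂ} (hf : Integrable f μ) {φ : ℂ → ℂ} (hφ : Measurable φ)
    (hφ1 : ∀ u, ‖φ u‖ ≤ 1) {r : ℝ} (hr0 : 0 ≤ r) (hr1 : r < 1) :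
    ∫ u, conj (φ u) * toeplitz μ β f (r * u) ∂weightedArea β =
      ∫ w, f w * conj (bergmanProj β φ (r * w)) ∂μ := by
  have := isProbabilityMeasure_weightedArea hβ
  have hφc : Measurable fun u => conj (φ u) := Complex.continuous_conj.measurable.comp hφ
  have hint : Integrable
      (Function.uncurry fun u w => conj (φ u) * kern (2 + β) (r * u) w * f w)
      ((weightedArea β).prod μ) := by
    refine (hf.comp_snd (weightedArea β)).bdd_mul (c := (1 - r) ^ (-|2 + β|) * 2 ^ |2 + β|) ?_ ?_
    · exact ((hφc.comp measurable_fst).mul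
        (measurable_kern_comp _ (by fun_prop) (by fun_prop))).aestronglyMeasurable
    · filter_upwards [Measure.quasiMeasurePreserving_fst.ae (ae_mem_unitDisk β),
        Measure.quasiMeasurePreserving_snd.ae hμ] with q hq1 hq2
      rw [norm_mul, RCLike.norm_conj]
      exact (mul_le_of_le_one_left (norm_nonneg _) (hφ1 q.1)).trans
        (norm_kern_ofReal_mul_le (2 + β) hr0 hr1 hq1 hq2)
  calc ∫ u, conj (φ u) * toeplitz μ β f (r * u) ∂weightedArea β
      = ∫ u, ∫ w, conj (φ u) * kern (2 + β) (r * u) w * f w ∂μ ∂weightedArea β := by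
        congr with u
        rw [toeplitz_eq, ← integral_const_mul]
        congr with w
        ring
    _ = ∫ w, ∫ u, conj (φ u) * kern (2 + β) (r * u) w * f w ∂weightedArea β ∂μ :=
        integral_integral_swap hint
    _ = ∫ w, f w * conj (bergmanProj β φ (r * w)) ∂μ := by
        refine integral_congr_ae (hμ.mono fun w hw => ?_)
        simp only
        rw [integral_mul_const, mul_comm (f w), bergmanProj, ← integral_conj]
        congr 1
        refine integral_congr_ae ((ae_mem_unitDisk β).mono fun u hu => ?_)
        simp only
        rw [map_mul, conj_kern _ (ofReal_mul_mem_unitDisk hr0 hr1.le hw) hu, kern_ofReal_mul]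

lemma exists_measurable_sign {F : ℂ → ℂ} (hF : ContinuousOn F unitDisk) :
    ∃ φ : ℂ → ℂ, Measurable φ ∧ (∀ z, ‖φ z‖ ≤ 1) ∧
      ∀ z ∈ unitDisk, conj (φ z) * F z = ‖F z‖ := by
  have hm := measurable_indicator_of_continuousOn hF
  refine ⟨fun z => unitDisk.indicator F z / ‖unitDisk.indicator F z‖, by fun_prop, fun z => ?_,
    fun z hz => ?_⟩
  · rw [norm_div, Complex.norm_real, norm_norm]; exact div_self_le_one _
  · simp only [Set.indicator_of_mem hz]
    rcases eq_or_ne (F z) 0 with h | h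
    · simp [h]
    · have hne : (‖F z‖ : ℂ) ≠ 0 := by simpa using h
      rw [map_div₀, Complex.conj_ofReal, div_mul_eq_mul_div, Complex.conj_mul']
      field_simp

end Toeplitz

section LogBloch

variable {μ : Measure ℂ}

lemma kern_add_one (s : ℝ) {z w : ℂ} (hz : z ∈ unitDisk) (hw : w ∈ unitDisk) :
    kern (s + 1) z w = kern s z w + z * (conj w * kern (s + 1) z w) := by
  have h0 := one_sub_mul_conj_ne_zero hz hw
  have hmul : (1 - z * conj w) * kern (s + 1) z w = kern s z w := by
    unfold kern
    push_cast
    rw [Complex.cpow_add _ _ h0, Complex.cpow_one]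
    field_simp
  rw [← hmul]; ring

lemma KernelCarleson.exists_norm_integral_kern_le {s t : ℝ} (h : KernelCarleson μ s t)
    (hμ : ∀ᵐ w ∂μ, w ∈ unitDisk) (ht : 0 ≤ t) :
    ∃ C : ℝ, 0 < C ∧ ∀ a ∈ unitDisk, ‖∫ w, kern s a w ∂μ‖ ≤ C * defect a ^ (-t) := by
  obtain ⟨C, hC, hker⟩ := h
  refine ⟨2 ^ t * C, by positivity, fun a ha => ?_⟩
  have hda := defect_pos ha
  refine norm_integral_le_of_lintegral_le (by positivity) ?_
  rw [mul_assoc, ENNReal.ofReal_mul (by positivity)]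
  refine le_trans ?_ (mul_le_mul_right (hker a ha) _)
  rw [← lintegral_const_mul' _ _ ENNReal.ofReal_ne_top]
  refine lintegral_mono_ae (hμ.mono fun w hw => ?_)
  have hN := norm_one_sub_mul_conj_pos ha hw
  rw [enorm_kern, enorm_kern, ← ENNReal.ofReal_mul (by positivity)]
  refine ENNReal.ofReal_le_ofReal ?_
  calc ‖1 - a * conj w‖ ^ (-s)
      = ‖1 - a * conj w‖ ^ t * ‖1 - a * conj w‖ ^ (-(s + t)) := by
        rw [← Real.rpow_add hN]; congr 1; ring
    _ ≤ 2 ^ t * ‖1 - a * conj w‖ ^ (-(s + t)) := by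
        gcongr
        exact norm_one_sub_mul_conj_le_two ha hw

lemma log_two_div_defect_nonneg {a : ℂ} (ha : a ∈ unitDisk) : 0 ≤ Real.log (2 / defect a) :=
  Real.log_nonneg (by rw [le_div_iff₀ (defect_pos ha)]; linarith [defect_le_one a])

variable [IsFiniteMeasure μ]

lemma hasDerivAt_toeplitz_one (hμ : ∀ᵐ w ∂μ, w ∈ unitDisk) (s : ℝ) {z : ℂ} (hz : z ∈ unitDisk) :
    HasDerivAt (toeplitz μ (s - 2) fun _ => 1) (s * ∫ w, conj w * kern (s + 1) z w ∂μ) z := by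
  have heq : (toeplitz μ (s - 2) fun _ => 1) = fun z => ∫ w, 1 * kern s z w ∂μ := by
    ext z; rw [toeplitz_eq, add_sub_cancel]
  rw [heq, ← integral_const_mul]
  refine (hasDerivAt_integral_mul_kern hμ s (integrable_const 1) hz).congr_deriv ?_
  congr with w
  ring

lemma norm_integral_kern_add_one_le (hμ : ∀ᵐ w ∂μ, w ∈ unitDisk) (s : ℝ) {z : ℂ}
    (hz : z ∈ unitDisk) :
    ‖∫ w, kern (s + 1) z w ∂μ‖ ≤
      ‖∫ w, kern s z w ∂μ‖ + ‖∫ w, conj w * kern (s + 1) z w ∂μ‖ := by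
  have hint : Integrable (fun w => conj w * kern (s + 1) z w) μ := by
    refine (integrable_kern hμ (s + 1) hz).bdd_mul (c := 1)
      Complex.continuous_conj.aestronglyMeasurable (hμ.mono fun w hw => ?_)
    rw [RCLike.norm_conj]; exact (mem_ball_zero_iff.1 hw).le
  calc ‖∫ w, kern (s + 1) z w ∂μ‖
      = ‖∫ w, kern s z w ∂μ + z * ∫ w, conj w * kern (s + 1) z w ∂μ‖ := by
        rw [← integral_const_mul, ← integral_add (integrable_kern hμ s hz) (hint.const_mul z)]
        exact congrArg _ (integral_congr_ae (hμ.mono fun w hw => kern_add_one s hz hw))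
    _ ≤ _ := (norm_add_le _ _).trans <| by
        rw [norm_mul]
        gcongr
        exact mul_le_of_le_one_left (norm_nonneg _) (mem_ball_zero_iff.1 hz).le

lemma exists_log_mul_norm_integral_kern_le (hμ : ∀ᵐ w ∂μ, w ∈ unitDisk) {s : ℝ} (hs : 0 < s)
    (hker : KernelCarleson μ s (1 / 2)) (hlb : MemLogBloch 1 (toeplitz μ (s - 2) fun _ => 1)) :
    ∃ C : ℝ, 0 < C ∧ ∀ a ∈ unitDisk,
      Real.log (2 / defect a) * ‖∫ w, kern (s + 1) a w ∂μ‖ ≤ C * defect a ^ (-1 : ℝ) := by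
  obtain ⟨C, hC, hsmall⟩ := hker.exists_norm_integral_kern_le hμ (by norm_num)
  obtain ⟨L, hL⟩ := hlb.2
  refine ⟨2 ^ (1 / 2 : ℝ) / (1 / 2) * C + |L| / s, by positivity, fun a ha => ?_⟩
  have hda := defect_pos ha
  have hlog0 := log_two_div_defect_nonneg ha
  have hlog : Real.log (2 / defect a) ≤
      2 ^ (1 / 2 : ℝ) / (1 / 2) * defect a ^ (-(1 / 2) : ℝ) := by
    refine (Real.log_le_rpow_div (ε := 1 / 2) (by positivity) (by norm_num)).trans_eq ?_
    rw [Real.div_rpow (by norm_num) hda.le, Real.rpow_neg hda.le]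
    ring
  have hderiv : Real.log (2 / defect a) * ‖∫ w, conj w * kern (s + 1) a w ∂μ‖ ≤
      |L| / s * defect a ^ (-1 : ℝ) := by
    have hLa := (hL ⟨a, ha, rfl⟩).trans (le_abs_self L)
    simp only [Real.rpow_one, (hasDerivAt_toeplitz_one hμ s ha).deriv, norm_mul,
      Complex.norm_of_nonneg hs.le, ← defect.eq_1] at hLa
    rw [Real.rpow_neg_one, ← div_eq_mul_inv, div_div, le_div_iff₀ (by positivity)]
    linarith
  have hhalf : defect a ^ (-(1 / 2) : ℝ) * defect a ^ (-(1 / 2) : ℝ) = defect a ^ (-1 : ℝ) := by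
    rw [← Real.rpow_add hda]; norm_num
  calc _ ≤ Real.log (2 / defect a) *
        (‖∫ w, kern s a w ∂μ‖ + ‖∫ w, conj w * kern (s + 1) a w ∂μ‖) := by
        gcongr
        exact norm_integral_kern_add_one_le hμ s ha
    _ = Real.log (2 / defect a) * ‖∫ w, kern s a w ∂μ‖ +
        Real.log (2 / defect a) * ‖∫ w, conj w * kern (s + 1) a w ∂μ‖ := by ring
    _ ≤ 2 ^ (1 / 2 : ℝ) / (1 / 2) * defect a ^ (-(1 / 2) : ℝ) *
        (C * defect a ^ (-(1 / 2) : ℝ)) + |L| / s * defect a ^ (-1 : ℝ) := by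
        gcongr
        exact hsmall a ha
    _ = _ := by rw [← hhalf]; ring

lemma IsCarleson.exists_norm_integral_mul_sub_le (hμ : ∀ᵐ w ∂μ, w ∈ unitDisk) {p α : ℝ}
    (hp0 : 0 < p) (hp1 : p ≤ 1) (hα : -1 < α) (h : IsCarleson μ (1 / p) 1 α) {B : ℝ}
    (hB : 0 < B) :
    ∃ C : ℝ, 0 < C ∧ ∀ g : ℂ → ℂ, IsBlochWith B g → ∀ m : ℂ → ℂ, Continuous m →
      (∀ w ∈ unitDisk, ‖m w‖ ≤ 1) → ∀ a ∈ unitDisk,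
      ‖∫ w, m w * g w * kern ((2 + α) / p + 1) a w ∂μ -
        g a * ∫ w, m w * kern ((2 + α) / p + 1) a w ∂μ‖ ≤ C * defect a ^ (-1 : ℝ) := by
  obtain ⟨C, hC, hosc⟩ := h.exists_lintegral_isBlochWith_le hp0 hp1 hα hB
  refine ⟨C, hC, fun g hg m hm hm1 a ha => ?_⟩
  have hda := defect_pos ha
  have hk := integrable_kern hμ ((2 + α) / p + 1) ha
  have hoscm : ∫⁻ w, ‖m w * ((g w - g a) * kern ((2 + α) / p + 1) a w)‖ₑ ∂μ ≤
      ENNReal.ofReal (C * defect a ^ (-1 : ℝ)) := by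
    refine (lintegral_mono_ae (hμ.mono fun w hw => ?_)).trans (hosc g hg a ha)
    rw [enorm_mul, ← enorm_mul (g w - g a), ← ofReal_norm (m w)]
    exact mul_le_of_le_one_left' (ENNReal.ofReal_le_one.2 (hm1 w hw))
  have hint : Integrable (fun w => m w * ((g w - g a) * kern ((2 + α) / p + 1) a w)) μ :=
    ⟨hm.aestronglyMeasurable.mul (((aestronglyMeasurable_of_continuousOn hμ
      hg.differentiableOn.continuousOn).sub aestronglyMeasurable_const).mul hk.1),
      hoscm.trans_lt ENNReal.ofReal_lt_top⟩
  have hmk : Integrable (fun w => m w * kern ((2 + α) / p + 1) a w) μ :=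
    hk.bdd_mul hm.aestronglyMeasurable (hμ.mono hm1)
  have hsplit : ∫ w, m w * g w * kern ((2 + α) / p + 1) a w ∂μ =
      ∫ w, m w * ((g w - g a) * kern ((2 + α) / p + 1) a w) ∂μ +
        g a * ∫ w, m w * kern ((2 + α) / p + 1) a w ∂μ := by
    rw [← integral_const_mul, ← integral_add hint (hmk.const_mul _)]
    congr with w
    ring
  rw [hsplit, add_sub_cancel_right]
  exact norm_integral_le_of_lintegral_le (by positivity) hoscm

/-- Replacing `g w` by `g a` costs a mean oscillation; what is left is `g a`, which grows
logarithmically, times the derivative of the logarithmic Bloch symbol. -/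
theorem exists_norm_integral_isBlochWith_mul_kern_le (hμ : ∀ᵐ w ∂μ, w ∈ unitDisk) {p α : ℝ}
    (hp0 : 0 < p) (hp1 : p ≤ 1) (hα : -1 < α) (hcar : IsCarleson μ (1 / p) 1 α)
    (hlb : MemLogBloch 1 (toeplitz μ ((2 + α) / p - 2) fun _ => 1)) {B : ℝ} (hB : 0 < B) :
    ∃ C : ℝ, 0 < C ∧ ∀ g : ℂ → ℂ, IsBlochWith B g → ‖g 0‖ ≤ B → ∀ a ∈ unitDisk,
      ‖∫ w, g w * kern ((2 + α) / p + 1) a w ∂μ‖ ≤ C * defect a ^ (-1 : ℝ) := by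
  obtain ⟨C₁, hC₁, hosc⟩ := hcar.exists_norm_integral_mul_sub_le hμ hp0 hp1 hα hB
  obtain ⟨C₂, hC₂, hlog⟩ := exists_log_mul_norm_integral_kern_le hμ
    (zero_lt_one.trans (one_lt_two_add_div hp0 hp1 hα))
    (hcar.kernelCarleson hp0 hα (by norm_num)) hlb
  obtain ⟨C₃, hC₃, hker⟩ := hcar.kernelCarleson hp0 hα one_pos
  set s := (2 + α) / p
  refine ⟨C₁ + B * C₃ + B * C₂, by positivity, fun g hg hg0 a ha => ?_⟩
  have hda := defect_pos ha
  have hoscA := hosc g hg (fun _ => 1) continuous_const (by simp) a ha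
  simp only [one_mul] at hoscA
  calc _ ≤ ‖g a * ∫ w, kern (s + 1) a w ∂μ‖ +
        ‖∫ w, g w * kern (s + 1) a w ∂μ - g a * ∫ w, kern (s + 1) a w ∂μ‖ :=
        norm_le_norm_add_norm_sub' _ _
    _ ≤ (B + B * Real.log (2 / defect a)) * ‖∫ w, kern (s + 1) a w ∂μ‖ +
        C₁ * defect a ^ (-1 : ℝ) := by
        rw [norm_mul]
        gcongr
        exact (hg.norm_le ha).trans (by linarith)
    _ = C₁ * defect a ^ (-1 : ℝ) + B * ‖∫ w, kern (s + 1) a w ∂μ‖ +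
        B * (Real.log (2 / defect a) * ‖∫ w, kern (s + 1) a w ∂μ‖) := by ring
    _ ≤ C₁ * defect a ^ (-1 : ℝ) + B * (C₃ * defect a ^ (-1 : ℝ)) +
        B * (C₂ * defect a ^ (-1 : ℝ)) := by
        gcongr _ + B * ?_ + B * ?_
        · exact norm_integral_le_of_lintegral_le (by positivity) (hker a ha)
        · exact hlog a ha
    _ = _ := by ring

end LogBloch

section Sufficiency

lemma lintegral_mul_defect_rpow_neg_one {γ δ : ℝ} (hγ : -1 < γ) (hδ : δ = γ + 1)
    (F : ℂ → ℝ≥0∞) :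
    ∫⁻ a, F a * ENNReal.ofReal (defect a ^ (-1 : ℝ)) ∂weightedArea δ =
      ENNReal.ofReal ((1 + δ) / (1 + γ)) * ∫⁻ a, F a ∂weightedArea γ := by
  rw [lintegral_weightedArea_eq_mul hγ (by linarith)]
  congr 1
  refine lintegral_congr_weightedArea fun a ha => ?_
  have hda := defect_pos ha
  rw [mul_comm (F a), ← mul_assoc, ← ENNReal.ofReal_mul (by positivity), ← Real.rpow_add hda,
    hδ, show γ + 1 - γ + -1 = 0 by ring, Real.rpow_zero, ENNReal.ofReal_one, one_mul]

variable {μ : Measure ℂ} {s : ℝ} {f g : ℂ → ℂ} {M N : ℝ}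

lemma integrable_of_norm_le_on_unitDisk {ν : Measure ℂ} [IsFiniteMeasure ν]
    (hν : ∀ᵐ z ∂ν, z ∈ unitDisk) (hf : ContinuousOn f unitDisk) (hM : ∀ z ∈ unitDisk, ‖f z‖ ≤ M) :
    Integrable f ν :=
  Integrable.of_bound (aestronglyMeasurable_of_continuousOn hν hf) M (hν.mono hM)

lemma KernelCarleson.integrable_prod [SFinite μ] (hker : KernelCarleson μ s 1) (hs : 1 < s)
    (hμ : ∀ᵐ w ∂μ, w ∈ unitDisk) (hf : ContinuousOn f unitDisk)
    (hfi : Integrable f (weightedArea (s - 2))) (hg : ContinuousOn g unitDisk)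
    (hN : ∀ z ∈ unitDisk, ‖g z‖ ≤ N) :
    Integrable (Function.uncurry fun a w => f a * kern (s + 1) w a * conj (g w))
      ((weightedArea (s - 1)).prod μ) := by
  obtain ⟨C, hC, hker⟩ := hker
  have := isProbabilityMeasure_weightedArea (γ := s - 1) (by linarith)
  have hmeas : AEStronglyMeasurable
      (Function.uncurry fun a w => f a * kern (s + 1) w a * conj (g w))
      ((weightedArea (s - 1)).prod μ) :=
    ((aestronglyMeasurable_of_continuousOn (ae_mem_unitDisk _) hf).comp_fst.mul
      (measurable_kern_comp _ measurable_snd measurable_fst).aestronglyMeasurable).mul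
      (Complex.continuous_conj.comp_aestronglyMeasurable
        (aestronglyMeasurable_of_continuousOn hμ hg)).comp_snd
  refine ⟨hmeas, ?_⟩
  rw [hasFiniteIntegral_iff_enorm, lintegral_prod _ hmeas.enorm]
  have hinner : ∀ a ∈ unitDisk, ∫⁻ w, ‖f a * kern (s + 1) w a * conj (g w)‖ₑ ∂μ ≤
      ENNReal.ofReal N * ENNReal.ofReal C *
        (‖f a‖ₑ * ENNReal.ofReal (defect a ^ (-1 : ℝ))) := fun a ha => by
    calc _ ≤ ∫⁻ w, ‖f a‖ₑ * ENNReal.ofReal N * ‖kern (s + 1) a w‖ₑ ∂μ := by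
          refine lintegral_mono_ae (hμ.mono fun w hw => ?_)
          rw [enorm_mul, enorm_mul, RCLike.enorm_conj, enorm_kern_comm, mul_right_comm]
          gcongr
          rw [← ofReal_norm]
          exact ENNReal.ofReal_le_ofReal (hN w hw)
      _ ≤ ‖f a‖ₑ * ENNReal.ofReal N * ENNReal.ofReal (C * defect a ^ (-1 : ℝ)) := by
          rw [lintegral_const_mul' _ _ (ENNReal.mul_ne_top enorm_ne_top ENNReal.ofReal_ne_top)]
          gcongr
          exact hker a ha
      _ = _ := by rw [ENNReal.ofReal_mul hC.le]; ring
  refine (lintegral_mono_weightedArea hinner).trans_lt ?_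
  rw [lintegral_const_mul' _ _ (ENNReal.mul_ne_top ENNReal.ofReal_ne_top ENNReal.ofReal_ne_top),
    lintegral_mul_defect_rpow_neg_one (γ := s - 2) (by linarith) (by ring)]
  exact ENNReal.mul_lt_top (ENNReal.mul_lt_top ENNReal.ofReal_lt_top ENNReal.ofReal_lt_top)
    (ENNReal.mul_lt_top ENNReal.ofReal_lt_top hfi.2)

/-- The reproducing formula of `L²_a(ω_{s-1})`, integrated against `ḡ dμ`. -/
lemma KernelCarleson.integral_mul_conj_eq [SFinite μ] (hker : KernelCarleson μ s 1) (hs : 1 < s)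
    (hμ : ∀ᵐ w ∂μ, w ∈ unitDisk) (hf : DifferentiableOn ℂ f unitDisk)
    (hM : ∀ z ∈ unitDisk, ‖f z‖ ≤ M) (hg : ContinuousOn g unitDisk)
    (hN : ∀ z ∈ unitDisk, ‖g z‖ ≤ N) :
    ∫ w, f w * conj (g w) ∂μ =
      ∫ a, f a * conj (∫ w, g w * kern (s + 1) a w ∂μ) ∂weightedArea (s - 1) := by
  have hs1 : -1 < s - 1 := by linarith
  have := isProbabilityMeasure_weightedArea hs1
  have := isProbabilityMeasure_weightedArea (γ := s - 2) (by linarith)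
  have hfi (γ : ℝ) [IsFiniteMeasure (weightedArea γ)] : Integrable f (weightedArea γ) :=
    integrable_of_norm_le_on_unitDisk (ae_mem_unitDisk γ) hf.continuousOn hM
  calc ∫ w, f w * conj (g w) ∂μ
      = ∫ w, ∫ a, f a * kern (s + 1) w a * conj (g w) ∂weightedArea (s - 1) ∂μ := by
        refine integral_congr_ae (hμ.mono fun w hw => ?_)
        have hrep := integral_mul_kern hs1 hf (hfi _) hw
        rw [show 2 + (s - 1) = s + 1 by ring] at hrep
        simp only [integral_mul_const, hrep]
    _ = ∫ a, ∫ w, f a * kern (s + 1) w a * conj (g w) ∂μ ∂weightedArea (s - 1) :=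
        (integral_integral_swap
          (hker.integrable_prod hs hμ hf.continuousOn (hfi _) hg hN)).symm
    _ = _ := by
        refine integral_congr_ae ((ae_mem_unitDisk _).mono fun a ha => ?_)
        simp only
        rw [← integral_conj, ← integral_const_mul]
        refine integral_congr_ae (hμ.mono fun w hw => ?_)
        simp only
        rw [map_mul, conj_kern _ ha hw]; ring

theorem exists_enorm_integral_mul_conj_le_bergmanNorm [IsFiniteMeasure μ]
    (hμ : ∀ᵐ w ∂μ, w ∈ unitDisk) {p α : ℝ} (hp0 : 0 < p) (hp1 : p ≤ 1) (hα : -1 < α)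
    (hcar : IsCarleson μ (1 / p) 1 α)
    (hlb : MemLogBloch 1 (toeplitz μ ((2 + α) / p - 2) fun _ => 1)) {B : ℝ} (hB : 0 < B) :
    ∃ C : ℝ≥0∞, C ≠ ∞ ∧ ∀ f g : ℂ → ℂ, DifferentiableOn ℂ f unitDisk →
      (∃ M, ∀ z ∈ unitDisk, ‖f z‖ ≤ M) → IsBlochWith B g → ‖g 0‖ ≤ B →
      (∃ N, ∀ z ∈ unitDisk, ‖g z‖ ≤ N) →
      ‖∫ w, f w * conj (g w) ∂μ‖ₑ ≤ C * bergmanNorm p α f := by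
  obtain ⟨C₁, hC₁, hbloch⟩ :=
    exists_norm_integral_isBlochWith_mul_kern_le hμ hp0 hp1 hα hcar hlb hB
  obtain ⟨C₂, hC₂, hemb⟩ := exists_lintegral_le_bergmanNorm hp0 hp1 hα
  have hker := hcar.kernelCarleson hp0 hα one_pos
  have hs := one_lt_two_add_div hp0 hp1 hα
  set s := (2 + α) / p
  have := isProbabilityMeasure_weightedArea (γ := s - 2) (by linarith)
  refine ⟨ENNReal.ofReal C₁ * (ENNReal.ofReal ((1 + (s - 1)) / (1 + (s - 2))) * C₂),
    ENNReal.mul_ne_top ENNReal.ofReal_ne_top (ENNReal.mul_ne_top ENNReal.ofReal_ne_top hC₂),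
    fun f g hf ⟨M, hM⟩ hg hg0 ⟨N, hN⟩ => ?_⟩
  have hpoint : ∀ a ∈ unitDisk, ‖f a * conj (∫ w, g w * kern (s + 1) a w ∂μ)‖ₑ ≤
      ENNReal.ofReal C₁ * (‖f a‖ₑ * ENNReal.ofReal (defect a ^ (-1 : ℝ))) := fun a ha => by
    rw [enorm_mul, RCLike.enorm_conj, mul_left_comm, ← ENNReal.ofReal_mul hC₁.le]
    gcongr
    rw [← ofReal_norm]
    exact ENNReal.ofReal_le_ofReal (hbloch g hg hg0 a ha)
  rw [hker.integral_mul_conj_eq hs hμ hf hM hg.differentiableOn.continuousOn hN]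
  calc _ ≤ _ := enorm_integral_le_lintegral_enorm _
    _ ≤ _ := lintegral_mono_weightedArea hpoint
    _ = ENNReal.ofReal C₁ * (ENNReal.ofReal ((1 + (s - 1)) / (1 + (s - 2))) *
          ∫⁻ a, ‖f a‖ₑ ∂weightedArea (s - 2)) := by
        rw [lintegral_const_mul' _ _ ENNReal.ofReal_ne_top,
          lintegral_mul_defect_rpow_neg_one (γ := s - 2) (by linarith) (by ring)]
    _ ≤ ENNReal.ofReal C₁ * (ENNReal.ofReal ((1 + (s - 1)) / (1 + (s - 2))) *
          (C₂ * bergmanNorm p α f)) := by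
        gcongr
        exact hemb f hf
          (integrable_of_norm_le_on_unitDisk (ae_mem_unitDisk _) hf.continuousOn hM)
    _ = _ := by ring

lemma exists_forall_norm_le_of_continuousOn_closedBall
    (hf : ContinuousOn f (Metric.closedBall 0 1)) : ∃ M : ℝ, ∀ z ∈ unitDisk, ‖f z‖ ≤ M :=
  ((isCompact_closedBall (0 : ℂ) 1).exists_bound_of_continuousOn hf).imp
    fun _ hM z hz => hM z (Metric.ball_subset_closedBall hz)

/-- The `L¹(ω_β)` norm of the dilate of a Toeplitz transform is attained by pairing with a
sign function. -/
lemma exists_lintegral_enorm_toeplitz_ofReal_mul_eq [IsFiniteMeasure μ]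
    (hμ : ∀ᵐ w ∂μ, w ∈ unitDisk) {β : ℝ} (hβ : -1 < β) (hf : Integrable f μ) {r : ℝ}
    (hr0 : 0 ≤ r) (hr1 : r < 1) :
    ∃ φ : ℂ → ℂ, Measurable φ ∧ (∀ z, ‖φ z‖ ≤ 1) ∧
      ∫⁻ u, ‖toeplitz μ β f (r * u)‖ₑ ∂weightedArea β =
        ‖∫ w, f w * conj (bergmanProj β φ (r * w)) ∂μ‖ₑ := by
  have := isProbabilityMeasure_weightedArea hβ
  have hcont : ContinuousOn (fun u : ℂ => toeplitz μ β f (r * u)) (Metric.closedBall 0 1) := by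
    refine (differentiableOn_toeplitz hμ β hf).continuousOn.comp (by fun_prop) fun u hu => ?_
    rw [mem_ball_zero_iff, norm_mul, Complex.norm_of_nonneg hr0]
    nlinarith [norm_nonneg u, mem_closedBall_zero_iff.1 hu]
  have hcont' := hcont.mono Metric.ball_subset_closedBall
  obtain ⟨φ, hφ, hφ1, hsign⟩ := exists_measurable_sign hcont'
  obtain ⟨M, hM⟩ := exists_forall_norm_le_of_continuousOn_closedBall hcont
  have hint : Integrable (fun u : ℂ => toeplitz μ β f (r * u)) (weightedArea β) :=
    integrable_of_norm_le_on_unitDisk (ae_mem_unitDisk β) hcont' hM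
  refine ⟨φ, hφ, hφ1, ?_⟩
  rw [← integral_mul_toeplitz hμ hβ hf hφ hφ1 hr0 hr1,
    integral_congr_ae ((ae_mem_unitDisk β).mono hsign), integral_complex_ofReal, ← ofReal_norm,
    Complex.norm_of_nonneg (integral_nonneg fun _ => norm_nonneg _),
    ofReal_integral_norm_eq_lintegral_enorm hint]

lemma lintegral_enorm_le_of_forall_ofReal_mul_le {γ : ℝ} {F : ℂ → ℂ}
    (hF : ContinuousOn F unitDisk) {K : ℝ≥0∞}
    (h : ∀ r : ℝ, 0 ≤ r → r < 1 → ∫⁻ u, ‖F (r * u)‖ₑ ∂weightedArea γ ≤ K) :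
    ∫⁻ u, ‖F u‖ₑ ∂weightedArea γ ≤ K := by
  obtain ⟨r, -, hr, hrlim⟩ := exists_seq_strictMono_tendsto' (zero_lt_one (α := ℝ))
  calc ∫⁻ u, ‖F u‖ₑ ∂weightedArea γ
      ≤ ∫⁻ u, liminf (fun n => ‖F (r n * u)‖ₑ) atTop ∂weightedArea γ := by
        refine lintegral_mono_weightedArea fun u hu => ?_
        have hlim : Tendsto (fun n => (r n : ℂ) * u) atTop (𝓝 u) := by
          simpa using ((Complex.continuous_ofReal.tendsto 1).comp hrlim).mul_const u
        exact ((hF.continuousAt (Metric.isOpen_ball.mem_nhds hu)).enorm.tendsto.comp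
          hlim).liminf_eq.ge
    _ ≤ liminf (fun n => ∫⁻ u, ‖F (r n * u)‖ₑ ∂weightedArea γ) atTop :=
        lintegral_liminf_le' fun n => (aestronglyMeasurable_of_continuousOn (ae_mem_unitDisk γ)
          (hF.comp (by fun_prop)
            fun _ => ofReal_mul_mem_unitDisk (hr n).1.le (hr n).2.le)).enorm
    _ ≤ K := liminf_le_of_frequently_le'
        (Frequently.of_forall fun n => h (r n) (hr n).1.le (hr n).2)

lemma exists_norm_eval_le (f : Polynomial ℂ) : ∃ M : ℝ, ∀ z ∈ unitDisk, ‖f.eval z‖ ≤ M :=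
  exists_forall_norm_le_of_continuousOn_closedBall f.continuous.continuousOn

lemma integrable_eval [IsFiniteMeasure μ] (hμ : ∀ᵐ w ∂μ, w ∈ unitDisk) (f : Polynomial ℂ) :
    Integrable (fun w => f.eval w) μ :=
  (exists_norm_eval_le f).elim fun _ hM =>
    integrable_of_norm_le_on_unitDisk hμ f.continuous.continuousOn hM

theorem toeplitzBounded_of_isCarleson [IsFiniteMeasure μ] (hμ : ∀ᵐ w ∂μ, w ∈ unitDisk)
    {p α β : ℝ} (hp0 : 0 < p) (hp1 : p ≤ 1) (hα : -1 < α) (hβ : -1 < β)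
    (hcar : IsCarleson μ (1 / p) 1 α)
    (hlb : MemLogBloch 1 (toeplitz μ ((2 + α) / p - 2) fun _ => 1)) :
    ToeplitzBounded μ β p α 1 β := by
  have := isProbabilityMeasure_weightedArea hα
  obtain ⟨B, hB, hproj⟩ := exists_isBlochWith_bergmanProj hβ
  obtain ⟨C, hC, hpair⟩ :=
    exists_enorm_integral_mul_conj_le_bergmanNorm hμ hp0 hp1 hα hcar hlb hB
  lift C to ℝ≥0 using hC
  have hdiff (f : Polynomial ℂ) := differentiableOn_toeplitz hμ β (integrable_eval hμ f)
  have hbound (f : Polynomial ℂ) : bergmanNorm 1 β (toeplitz μ β fun w => f.eval w) ≤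
      C * bergmanNorm p α fun w => f.eval w := by
    rw [bergmanNorm_one]
    refine lintegral_enorm_le_of_forall_ofReal_mul_le (hdiff f).continuousOn fun r hr0 hr1 => ?_
    obtain ⟨φ, hφ, hφ1, hnorm⟩ :=
      exists_lintegral_enorm_toeplitz_ofReal_mul_eq hμ hβ (integrable_eval hμ f) hr0 hr1
    obtain ⟨hbloch, hzero⟩ := hproj φ hφ hφ1
    rw [hnorm]
    exact hpair _ _ f.differentiable.differentiableOn (exists_norm_eval_le f)
      (hbloch.comp_mul hr0 hr1.le) (by simpa using hzero)
      ⟨_, fun w hw => norm_bergmanProj_ofReal_mul_le hβ hφ1 hr0 hr1 hw⟩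
  refine ⟨C, fun f => ⟨⟨hdiff f, (hbound f).trans_lt ?_⟩, hbound f⟩⟩
  obtain ⟨M, hM⟩ := exists_norm_eval_le f
  exact ENNReal.mul_lt_top ENNReal.coe_lt_top (MemLp.of_bound
    f.continuous.aestronglyMeasurable M ((ae_mem_unitDisk α).mono hM)).2

end Sufficiency

section DualForm

lemma enorm_le_lintegral_enorm_mul_kern {α γ : ℝ} (hα : -1 < α) (hαγ : α ≤ γ) {f : ℂ → ℂ}
    (hf : DifferentiableOn ℂ f unitDisk) (hfi : Integrable f (weightedArea α)) {w : ℂ}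
    (hw : w ∈ unitDisk) :
    ‖f w‖ₑ ≤ ENNReal.ofReal ((1 + γ) / (1 + α)) * ∫⁻ z, ‖f z‖ₑ *
      (ENNReal.ofReal (defect z ^ (γ - α)) * ‖kern (2 + γ) w z‖ₑ) ∂weightedArea α := by
  have hγ : -1 < γ := hα.trans_le hαγ
  have hfi' : Integrable f (weightedArea γ) := by
    refine ⟨aestronglyMeasurable_of_continuousOn (ae_mem_unitDisk γ) hf.continuousOn, ?_⟩
    rw [hasFiniteIntegral_iff_enorm, lintegral_weightedArea_eq_mul hα hγ]
    refine ENNReal.mul_lt_top ENNReal.ofReal_lt_top (lt_of_le_of_lt ?_ hfi.2)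
    refine lintegral_mono_weightedArea fun z hz => mul_le_of_le_one_left' ?_
    rw [ENNReal.ofReal_le_one]
    exact Real.rpow_le_one (defect_pos hz).le (defect_le_one z) (sub_nonneg.2 hαγ)
  calc ‖f w‖ₑ = ‖∫ z, f z * kern (2 + γ) w z ∂weightedArea γ‖ₑ := by
        rw [integral_mul_kern hγ hf hfi' hw]
    _ ≤ ∫⁻ z, ‖f z * kern (2 + γ) w z‖ₑ ∂weightedArea γ := enorm_integral_le_lintegral_enorm _
    _ = _ := by
        rw [lintegral_weightedArea_eq_mul hα hγ]
        simp only [enorm_mul, mul_left_comm]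

lemma exists_defect_mul_lintegral_enorm_kern_ofReal_mul_le {β : ℝ} (hβ : -1 < β) :
    ∃ C : ℝ≥0∞, C ≠ ∞ ∧ ∀ r : ℝ, 0 ≤ r → r ≤ 1 → ∀ z ∈ unitDisk,
      ENNReal.ofReal (defect z) * ∫⁻ w, ‖kern (2 + β + 1) (r * w) z‖ₑ ∂weightedArea β ≤ C := by
  obtain ⟨C, hC, hker⟩ := exists_lintegral_enorm_kern_le hβ one_pos
  refine ⟨ENNReal.ofReal C, ENNReal.ofReal_ne_top, fun r hr0 hr1 z hz => ?_⟩
  have hdz := defect_pos hz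
  have hle := defect_le_defect_ofReal_mul hr0 hr1 z
  have hswap (w : ℂ) : ‖kern (2 + β + 1) (r * w) z‖ₑ = ‖kern (2 + β + 1) (r * z) w‖ₑ := by
    rw [kern_ofReal_mul, enorm_kern_comm]
  simp only [hswap]
  calc _ ≤ ENNReal.ofReal (defect z) * ENNReal.ofReal (C * defect (r * z) ^ (-1 : ℝ)) := by
        gcongr
        exact hker _ (ofReal_mul_mem_unitDisk hr0 hr1 hz)
    _ ≤ ENNReal.ofReal C := by
        rw [← ENNReal.ofReal_mul hdz.le, Real.rpow_neg_one, mul_left_comm, ← div_eq_mul_inv]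
        exact ENNReal.ofReal_le_ofReal
          (mul_le_of_le_one_right hC.le (div_le_one_of_le₀ hle (hdz.le.trans hle)))

theorem exists_lintegral_enorm_ofReal_mul_le {β : ℝ} (hβ : -1 < β) :
    ∃ C : ℝ≥0∞, C ≠ ∞ ∧ ∀ F : ℂ → ℂ, DifferentiableOn ℂ F unitDisk →
      Integrable F (weightedArea β) → ∀ r : ℝ, 0 ≤ r → r ≤ 1 →
      ∫⁻ u, ‖F (r * u)‖ₑ ∂weightedArea β ≤ C * ∫⁻ u, ‖F u‖ₑ ∂weightedArea β := by
  obtain ⟨C, hC, hker⟩ := exists_defect_mul_lintegral_enorm_kern_ofReal_mul_le hβ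
  have := isProbabilityMeasure_weightedArea hβ
  refine ⟨ENNReal.ofReal ((1 + (β + 1)) / (1 + β)) * C,
    ENNReal.mul_ne_top ENNReal.ofReal_ne_top hC, fun F hF hi r hr0 hr1 => ?_⟩
  calc ∫⁻ w, ‖F (r * w)‖ₑ ∂weightedArea β
      ≤ ∫⁻ w, ENNReal.ofReal ((1 + (β + 1)) / (1 + β)) * ∫⁻ z, ‖F z‖ₑ *
          (ENNReal.ofReal (defect z) * ‖kern (2 + β + 1) (r * w) z‖ₑ)
          ∂weightedArea β ∂weightedArea β := by
        refine lintegral_mono_weightedArea fun w hw => ?_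
        have hrep := enorm_le_lintegral_enorm_mul_kern hβ (le_add_of_nonneg_right zero_le_one)
          hF hi (ofReal_mul_mem_unitDisk hr0 hr1 hw)
        simpa only [add_sub_cancel_left, Real.rpow_one, ← add_assoc] using hrep
    _ = ENNReal.ofReal ((1 + (β + 1)) / (1 + β)) * ∫⁻ z, ‖F z‖ₑ * (ENNReal.ofReal (defect z) *
          ∫⁻ w, ‖kern (2 + β + 1) (r * w) z‖ₑ ∂weightedArea β) ∂weightedArea β := by
        rw [lintegral_const_mul' _ _ ENNReal.ofReal_ne_top, lintegral_lintegral_swap]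
        · simp only [lintegral_const_mul' _ _ enorm_ne_top,
            lintegral_const_mul' _ _ ENNReal.ofReal_ne_top]
        · have hFm := aestronglyMeasurable_of_continuousOn (ae_mem_unitDisk β) hF.continuousOn
          have hkm := measurable_kern_comp (2 + β + 1)
            (measurable_fst.const_mul (r : ℂ)) (measurable_snd (α := ℂ) (β := ℂ))
          exact hFm.enorm.comp_snd.mul
            ((measurable_defect.comp measurable_snd).ennreal_ofReal.mul hkm.enorm).aemeasurable
    _ ≤ ENNReal.ofReal ((1 + (β + 1)) / (1 + β)) *
          ∫⁻ z, C * ‖F z‖ₑ ∂weightedArea β := by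
        refine mul_le_mul_right (lintegral_mono_weightedArea fun z hz => ?_) _
        rw [mul_comm]
        gcongr
        exact hker r hr0 hr1 z hz
    _ = _ := by rw [lintegral_const_mul' _ _ hC, mul_assoc]

variable {μ : Measure ℂ} [IsFiniteMeasure μ] {p α β : ℝ}

lemma ToeplitzBounded.exists_enorm_integral_eval_mul_le (hμ : ∀ᵐ w ∂μ, w ∈ unitDisk)
    (hβ : -1 < β) (h : ToeplitzBounded μ β p α 1 β) :
    ∃ C : ℝ≥0∞, C ≠ ∞ ∧ ∀ f : Polynomial ℂ, ∀ φ : ℂ → ℂ, Measurable φ → (∀ z, ‖φ z‖ ≤ 1) →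
      ∀ r : ℝ, 0 ≤ r → r < 1 →
      ‖∫ w, f.eval w * conj (bergmanProj β φ (r * w)) ∂μ‖ₑ ≤
        C * bergmanNorm p α fun w => f.eval w := by
  obtain ⟨C₁, hC₁⟩ := h
  obtain ⟨C₂, hC₂, hdil⟩ := exists_lintegral_enorm_ofReal_mul_le hβ
  refine ⟨C₂ * C₁, ENNReal.mul_ne_top hC₂ ENNReal.coe_ne_top, fun f φ hφ hφ1 r hr0 hr1 => ?_⟩
  obtain ⟨⟨hd, hlt⟩, hle⟩ := hC₁ f
  rw [bergmanNorm_one] at hlt hle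
  rw [← integral_mul_toeplitz hμ hβ (integrable_eval hμ f) hφ hφ1 hr0 hr1]
  calc _ ≤ ∫⁻ u, ‖conj (φ u) * toeplitz μ β (fun w => f.eval w) (r * u)‖ₑ ∂weightedArea β :=
        enorm_integral_le_lintegral_enorm _
    _ ≤ ∫⁻ u, ‖toeplitz μ β (fun w => f.eval w) (r * u)‖ₑ ∂weightedArea β := by
        refine lintegral_mono fun u => ?_
        rw [enorm_mul, RCLike.enorm_conj, ← ofReal_norm (φ u)]
        exact mul_le_of_le_one_left' (ENNReal.ofReal_le_one.2 (hφ1 u))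
    _ ≤ C₂ * ∫⁻ u, ‖toeplitz μ β (fun w => f.eval w) u‖ₑ ∂weightedArea β :=
        hdil _ hd ⟨aestronglyMeasurable_of_continuousOn (ae_mem_unitDisk β) hd.continuousOn, hlt⟩
          r hr0 hr1.le
    _ ≤ _ := by rw [mul_assoc]; gcongr

lemma exists_polynomial_tendstoUniformlyOn {f : ℂ → ℂ} {R : ℝ} (hR : 1 < R)
    (hf : DifferentiableOn ℂ f (Metric.ball 0 R)) :
    ∃ P : ℕ → Polynomial ℂ, TendstoUniformlyOn (fun n w => (P n).eval w) f atTop unitDisk := by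
  obtain ⟨S, hS1, hSR⟩ := exists_between hR
  lift S to ℝ≥0 using zero_le_one.trans hS1.le
  have hseries := (hf.mono (Metric.closedBall_subset_ball hSR)).hasFPowerSeriesOnBall
    (show 0 < S by exact_mod_cast zero_lt_one.trans hS1)
  have hunif := hseries.tendstoUniformlyOn (r' := 1) (by exact_mod_cast hS1)
  refine ⟨fun n => ∑ k ∈ Finset.range n,
    Polynomial.monomial k ((cauchyPowerSeries f 0 S).coeff k), ?_⟩
  simp only [zero_add, NNReal.coe_one] at hunif
  refine hunif.congr (Eventually.of_forall fun n w _ => ?_)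
  simp only [FormalMultilinearSeries.partialSum, Polynomial.eval_finsetSum,
    Polynomial.eval_monomial, FormalMultilinearSeries.apply_eq_pow_smul_coeff, smul_eq_mul,
    mul_comm]

lemma tendsto_bergmanNorm (hp : 0 < p) (hα : -1 < α) {F : ℕ → ℂ → ℂ} {f : ℂ → ℂ} {M : ℝ}
    (hF : ∀ n, ContinuousOn (F n) unitDisk) (hM : ∀ᶠ n in atTop, ∀ w ∈ unitDisk, ‖F n w‖ ≤ M)
    (hlim : ∀ w ∈ unitDisk, Tendsto (fun n => F n w) atTop (𝓝 (f w))) :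
    Tendsto (fun n => bergmanNorm p α (F n)) atTop (𝓝 (bergmanNorm p α f)) := by
  have := isProbabilityMeasure_weightedArea hα
  simp only [bergmanNorm_eq hp]
  refine ((ENNReal.continuous_rpow_const).tendsto _).comp
    (tendsto_lintegral_filter_of_dominated_convergence' (fun _ => ENNReal.ofReal M ^ p)
      (Eventually.of_forall fun n => ?_) (hM.mono fun n hn => ?_) ?_ ?_)
  · exact (aestronglyMeasurable_of_continuousOn (ae_mem_unitDisk α) (hF n)).enorm.pow_const p
  · filter_upwards [ae_mem_unitDisk α] with w hw
    rw [← ofReal_norm]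
    gcongr
    exact hn w hw
  · simp [hp.le]
  · filter_upwards [ae_mem_unitDisk α] with w hw
    exact ((ENNReal.continuous_rpow_const).tendsto _).comp (hlim w hw).enorm

lemma ToeplitzBounded.exists_enorm_integral_mul_le (hμ : ∀ᵐ w ∂μ, w ∈ unitDisk) (hp : 0 < p)
    (hα : -1 < α) (hβ : -1 < β) (h : ToeplitzBounded μ β p α 1 β) :
    ∃ C : ℝ≥0∞, C ≠ ∞ ∧ ∀ f : ℂ → ℂ, ∀ R : ℝ, 1 < R → DifferentiableOn ℂ f (Metric.ball 0 R) →
      ∀ φ : ℂ → ℂ, Measurable φ → (∀ z, ‖φ z‖ ≤ 1) → ∀ r : ℝ, 0 ≤ r → r < 1 →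
      ‖∫ w, f w * conj (bergmanProj β φ (r * w)) ∂μ‖ₑ ≤ C * bergmanNorm p α f := by
  obtain ⟨C, hC, hpol⟩ := h.exists_enorm_integral_eval_mul_le hμ hβ
  have := isProbabilityMeasure_weightedArea hβ
  refine ⟨C, hC, fun f R hR hf φ hφ hφ1 r hr0 hr1 => ?_⟩
  obtain ⟨P, hP⟩ := exists_polynomial_tendstoUniformlyOn hR hf
  obtain ⟨M, hM⟩ := exists_forall_norm_le_of_continuousOn_closedBall
    (hf.continuousOn.mono (Metric.closedBall_subset_ball hR))
  have hPM : ∀ᶠ n in atTop, ∀ w ∈ unitDisk, ‖(P n).eval w‖ ≤ M + 1 := by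
    filter_upwards [Metric.tendstoUniformlyOn_iff.1 hP 1 one_pos] with n hn w hw
    have hdist := hn w hw
    rw [dist_comm, dist_eq_norm] at hdist
    linarith [norm_le_norm_add_norm_sub' ((P n).eval w) (f w), hM w hw]
  have hlim (w) (hw : w ∈ unitDisk) := hP.tendsto_at hw
  have hintegral : Tendsto (fun n => ∫ w, (P n).eval w * conj (bergmanProj β φ (r * w)) ∂μ) atTop
      (𝓝 (∫ w, f w * conj (bergmanProj β φ (r * w)) ∂μ)) := by
    have hproj : AEStronglyMeasurable (fun w => conj (bergmanProj β φ (r * w))) μ := by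
      refine Complex.continuous_conj.comp_aestronglyMeasurable
        (aestronglyMeasurable_of_continuousOn hμ ?_)
      exact (differentiableOn_integral_mul_kern (ae_mem_unitDisk β) (2 + β)
        (Integrable.of_bound hφ.aestronglyMeasurable 1 (ae_of_all _ hφ1))).continuousOn.comp
        (by fun_prop) fun _ => ofReal_mul_mem_unitDisk hr0 hr1.le
    refine tendsto_integral_filter_of_dominated_convergence
      (fun _ => (M + 1) * ((1 - r) ^ (-|2 + β|) * 2 ^ |2 + β|))
      (Eventually.of_forall fun n => (P n).continuous.aestronglyMeasurable.mul hproj)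
      (hPM.mono fun n hn => hμ.mono fun w hw => ?_) (integrable_const _)
      (hμ.mono fun w hw => (hlim w hw).mul_const _)
    rw [norm_mul, RCLike.norm_conj]
    exact mul_le_mul (hn w hw) (norm_bergmanProj_ofReal_mul_le hβ hφ1 hr0 hr1 hw)
      (norm_nonneg _) ((norm_nonneg _).trans (hn w hw))
  exact le_of_tendsto_of_tendsto' hintegral.enorm
    (ENNReal.Tendsto.const_mul (tendsto_bergmanNorm hp hα
      (fun n => (P n).continuous.continuousOn) hPM hlim) (Or.inr hC))
    fun n => hpol (P n) φ hφ hφ1 r hr0 hr1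

end DualForm

section TestFunctions

variable {μ : Measure ℂ} [IsFiniteMeasure μ] {p α β : ℝ}

lemma exists_bergmanNorm_kern_le (hp : 0 < p) (hα : -1 < α) :
    ∃ C : ℝ, 0 < C ∧ ∀ b ∈ unitDisk, bergmanNorm p α (fun w => kern ((2 + α) / p + 1) w b) ≤
      ENNReal.ofReal (C * defect b ^ (-1 : ℝ)) := by
  obtain ⟨C, hC, hker⟩ := exists_lintegral_enorm_kern_le hα hp
  refine ⟨C ^ (1 / p), by positivity, fun b hb => ?_⟩
  have hdb := defect_pos hb
  have hpow (w : ℂ) : ‖kern ((2 + α) / p + 1) w b‖ₑ ^ p = ‖kern (2 + α + p) b w‖ₑ := by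
    rw [enorm_kern_rpow _ hp.le, enorm_kern_comm,
      show ((2 + α) / p + 1) * p = 2 + α + p by field_simp]
  rw [bergmanNorm_eq hp]
  simp only [hpow]
  calc _ ≤ ENNReal.ofReal (C * defect b ^ (-p)) ^ (1 / p) := by
        gcongr
        exact hker b hb
    _ = _ := by
        rw [ENNReal.ofReal_rpow_of_pos (by positivity),
          Real.mul_rpow hC.le (by positivity), ← Real.rpow_mul hdb.le,
          show -p * (1 / p) = -1 by field_simp]

lemma differentiableOn_kern_left_ball (s : ℝ) {b : ℂ} (hb : b ∈ unitDisk) :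
    DifferentiableOn ℂ (fun w => kern s w b) (Metric.ball 0 (2 / (1 + ‖b‖))) := fun w hw => by
  have hlt : ‖w * conj b‖ < 1 := by
    have hw' := mem_ball_zero_iff.1 hw
    rw [lt_div_iff₀ (by positivity)] at hw'
    rw [norm_mul, RCLike.norm_conj]
    nlinarith [norm_nonneg w, mem_ball_zero_iff.1 hb]
  have hslit : 1 - w * conj b ∈ Complex.slitPlane := by
    simpa [sub_eq_add_neg] using Complex.mem_slitPlane_of_norm_lt_one (z := -(w * conj b))
      (by rwa [norm_neg])
  have hne : (1 - w * conj b) ^ (s : ℂ) ≠ 0 := by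
    rw [Complex.cpow_ne_zero_iff]
    exact Or.inl (Complex.slitPlane_ne_zero hslit)
  have hbase : DifferentiableAt ℂ (fun w => 1 - w * conj b) w := by fun_prop
  exact ((differentiableAt_const 1).div (hbase.cpow_const hslit) hne).differentiableWithinAt

theorem ToeplitzBounded.exists_norm_integral_mul_kern_mul_le (hμ : ∀ᵐ w ∂μ, w ∈ unitDisk)
    (hp : 0 < p) (hα : -1 < α) (hβ : -1 < β) (h : ToeplitzBounded μ β p α 1 β) :
    ∃ C : ℝ, 0 < C ∧ ∀ q : ℂ → ℂ, Differentiable ℂ q → (∀ z ∈ unitDisk, ‖q z‖ ≤ 1) →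
      ∀ b ∈ unitDisk, ∀ φ : ℂ → ℂ, Measurable φ → (∀ z, ‖φ z‖ ≤ 1) → ∀ r : ℝ, 0 ≤ r → r < 1 →
      ‖∫ w, q w * kern ((2 + α) / p + 1) w b * conj (bergmanProj β φ (r * w)) ∂μ‖ ≤
        C * defect b ^ (-1 : ℝ) := by
  obtain ⟨C₁, hC₁, hpair⟩ := h.exists_enorm_integral_mul_le hμ hp hα hβ
  obtain ⟨C₂, hC₂, hnorm⟩ := exists_bergmanNorm_kern_le hp hα
  lift C₁ to ℝ≥0 using hC₁
  refine ⟨(C₁ + 1) * C₂, by positivity, fun q hq hq1 b hb φ hφ hφ1 r hr0 hr1 => ?_⟩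
  have hdb := defect_pos hb
  have hR : 1 < 2 / (1 + ‖b‖) := by
    rw [lt_div_iff₀ (by positivity)]
    linarith [mem_ball_zero_iff.1 hb]
  rw [← ENNReal.ofReal_le_ofReal_iff (by positivity), ofReal_norm]
  calc _ ≤ C₁ * bergmanNorm p α (fun w => q w * kern ((2 + α) / p + 1) w b) :=
        hpair _ _ hR (hq.differentiableOn.mul (differentiableOn_kern_left_ball _ hb))
          φ hφ hφ1 r hr0 hr1
    _ ≤ C₁ * bergmanNorm p α (fun w => kern ((2 + α) / p + 1) w b) := by
        gcongr
        refine eLpNorm_mono_ae ((ae_mem_unitDisk α).mono fun w hw => ?_)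
        rw [norm_mul]
        exact mul_le_of_le_one_left (norm_nonneg _) (hq1 w hw)
    _ ≤ C₁ * ENNReal.ofReal (C₂ * defect b ^ (-1 : ℝ)) := by
        gcongr
        exact hnorm b hb
    _ ≤ _ := by
        rw [← ENNReal.ofReal_coe_nnreal, ← ENNReal.ofReal_mul C₁.coe_nonneg, mul_assoc]
        gcongr
        exact le_add_of_nonneg_right zero_le_one

end TestFunctions

section KernelTest

lemma exists_bergmanProj_eq {β : ℝ} (hβ : -1 < β) {h : ℂ → ℂ} (hd : DifferentiableOn ℂ h unitDisk)
    (h1 : ∀ z ∈ unitDisk, ‖h z‖ ≤ 1) :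
    ∃ φ : ℂ → ℂ, Measurable φ ∧ (∀ z, ‖φ z‖ ≤ 1) ∧ ∀ w ∈ unitDisk, bergmanProj β φ w = h w := by
  have := isProbabilityMeasure_weightedArea hβ
  have hint : Integrable h (weightedArea β) :=
    integrable_of_norm_le_on_unitDisk (ae_mem_unitDisk β) hd.continuousOn h1
  refine ⟨unitDisk.indicator h, measurable_indicator_of_continuousOn hd.continuousOn,
    fun z => ?_, fun w hw => ?_⟩
  · by_cases hz : z ∈ unitDisk
    · rw [Set.indicator_of_mem hz]; exact h1 z hz
    · rw [Set.indicator_of_notMem hz, norm_zero]; exact zero_le_one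
  · rw [bergmanProj, ← integral_mul_kern hβ hd hint hw]
    exact integral_congr_ae ((ae_mem_unitDisk β).mono fun u hu => by
      simp only [Set.indicator_of_mem hu])

lemma enorm_integral_mul_conj_self {X : Type*} [MeasurableSpace X] {ν : Measure X} {F : X → ℂ}
    (hF : MemLp F 2 ν) :
    ‖∫ x, F x * conj (F x) ∂ν‖ₑ = ∫⁻ x, ‖F x‖ₑ ^ 2 ∂ν := by
  have hsq (x : X) : F x * conj (F x) = ((‖F x‖ ^ 2 : ℝ) : ℂ) := by
    rw [Complex.mul_conj']; push_cast; rfl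
  simp only [hsq]
  rw [integral_complex_ofReal, ← ofReal_norm, Complex.norm_of_nonneg (by positivity),
    ofReal_integral_eq_lintegral_ofReal (hF.integrable_norm_pow two_ne_zero)
      (ae_of_all _ fun _ => by positivity)]
  exact lintegral_congr fun x => by rw [ENNReal.ofReal_pow (norm_nonneg _), ofReal_norm]

/-- A dilation moves the pole of the kernel away from the circle, so that the reciprocal dilation
turns the kernel at `b` into a bounded function. -/
lemma exists_dilated_kern {s : ℝ} (hs : 0 ≤ s) {b : ℂ} (hb : b ∈ unitDisk) :
    ∃ r : ℝ, 0 ≤ r ∧ r < 1 ∧ ∃ k : ℂ → ℂ, DifferentiableOn ℂ k unitDisk ∧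
      (∀ u ∈ unitDisk, ‖k u‖ ≤ 4 ^ s * defect b ^ (-s)) ∧ ∀ w, k (r * w) = kern s w b := by
  have hb1 := mem_ball_zero_iff.1 hb
  have hr0 : 0 < (1 + ‖b‖) / 2 := by positivity
  have hnorm : ‖b / ((1 + ‖b‖) / 2 : ℝ)‖ = 1 - (1 - ‖b‖) / (1 + ‖b‖) := by
    rw [norm_div, Complex.norm_of_nonneg hr0.le]
    field_simp; ring
  have hgap : defect b ≤ 4 * ((1 - ‖b‖) / (1 + ‖b‖)) := by
    rw [defect, mul_div_assoc', le_div_iff₀ (by positivity)]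
    nlinarith [norm_nonneg b, sq_nonneg (1 - ‖b‖)]
  have hmem : b / ((1 + ‖b‖) / 2 : ℝ) ∈ unitDisk := by
    rw [unitDisk, mem_ball_zero_iff, hnorm]
    linarith [defect_pos hb]
  refine ⟨(1 + ‖b‖) / 2, hr0.le, by linarith, fun u => kern s u (b / ((1 + ‖b‖) / 2 : ℝ)),
    differentiableOn_kern_left s hmem, fun u hu => ?_, fun w => ?_⟩
  · rw [norm_kern]
    refine rpow_neg_le_mul_rpow_neg (defect_pos hb) four_pos ?_ hs
    have hlow := one_sub_norm_le_norm_one_sub_mul_conj (b / ((1 + ‖b‖) / 2 : ℝ)) hu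
    rw [norm_one_sub_mul_conj_comm, hnorm] at hlow
    linarith
  · simp only [kern_ofReal_mul]
    rw [mul_div_cancel₀ _ (by exact_mod_cast hr0.ne')]

variable {μ : Measure ℂ} [IsFiniteMeasure μ] {p α β : ℝ}

lemma ToeplitzBounded.exists_norm_integral_kern_mul_conj_le (hμ : ∀ᵐ w ∂μ, w ∈ unitDisk)
    (hp : 0 < p) (hα : -1 < α) (hβ : -1 < β) (h : ToeplitzBounded μ β p α 1 β) :
    ∃ C : ℝ, 0 < C ∧ ∀ b ∈ unitDisk,
      ‖∫ w, kern ((2 + α) / p + 1) w b * conj (kern ((2 + α) / p + 1) w b) ∂μ‖ ≤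
        C * defect b ^ (-((2 + α) / p + 2)) := by
  obtain ⟨C, hC, hpair⟩ := h.exists_norm_integral_mul_kern_mul_le hμ hp hα hβ
  have hs : 0 ≤ (2 + α) / p + 1 := by
    have : 0 < 2 + α := by linarith
    positivity
  set s := (2 + α) / p
  refine ⟨4 ^ (s + 1) * C, by positivity, fun b hb => ?_⟩
  have hdb := defect_pos hb
  obtain ⟨r, hr0, hr1, k, hk, hkM, hkr⟩ := exists_dilated_kern hs hb
  set M : ℝ := 4 ^ (s + 1) * defect b ^ (-(s + 1))
  have hM : 0 < M := by positivity
  obtain ⟨φ, hφ, hφ1, hφk⟩ := exists_bergmanProj_eq hβ (hk.const_mul (M⁻¹ : ℂ)) fun u hu => by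
    rw [norm_mul, norm_inv, Complex.norm_of_nonneg hM.le, ← div_eq_inv_mul]
    exact div_le_one_of_le₀ (hkM u hu) hM.le
  have hproj : ∫ w, 1 * kern (s + 1) w b * conj (bergmanProj β φ (r * w)) ∂μ =
      (M⁻¹ : ℂ) * ∫ w, kern (s + 1) w b * conj (kern (s + 1) w b) ∂μ := by
    rw [← integral_const_mul]
    refine integral_congr_ae (hμ.mono fun w hw => ?_)
    simp only [hφk _ (ofReal_mul_mem_unitDisk hr0 hr1.le hw), hkr, map_mul, map_inv₀,
      Complex.conj_ofReal]
    ring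
  have hone := hpair (fun _ => 1) (differentiable_const 1) (by simp) b hb φ hφ hφ1 r hr0 hr1
  rw [hproj, norm_mul, norm_inv, Complex.norm_of_nonneg hM.le, inv_mul_le_iff₀ hM] at hone
  refine hone.trans_eq ?_
  rw [show -(s + 2) = -(s + 1) + -1 by ring, Real.rpow_add hdb]
  ring

theorem ToeplitzBounded.kernelCarleson (hμ : ∀ᵐ w ∂μ, w ∈ unitDisk) (hp : 0 < p) (hα : -1 < α)
    (hβ : -1 < β) (h : ToeplitzBounded μ β p α 1 β) :
    KernelCarleson μ ((2 + α) / p) ((2 + α) / p + 2) := by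
  obtain ⟨C, hC, hself⟩ := h.exists_norm_integral_kern_mul_conj_le hμ hp hα hβ
  set s := (2 + α) / p
  refine ⟨C, hC, fun b hb => ?_⟩
  have hLp : MemLp (fun w => kern (s + 1) w b) 2 μ :=
    MemLp.of_bound (aestronglyMeasurable_of_continuousOn hμ
      (differentiableOn_kern_left (s + 1) hb).continuousOn) _ (hμ.mono fun w hw => by
        rw [← conj_kern _ hb hw, RCLike.norm_conj]
        exact norm_kern_le (s + 1) hb hw)
  calc ∫⁻ w, ‖kern (s + (s + 2)) b w‖ₑ ∂μ = ∫⁻ w, ‖kern (s + 1) w b‖ₑ ^ 2 ∂μ := by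
        refine lintegral_congr fun w => ?_
        rw [← ENNReal.rpow_two, enorm_kern_rpow _ zero_le_two, enorm_kern_comm]
        ring_nf
    _ = ENNReal.ofReal ‖∫ w, kern (s + 1) w b * conj (kern (s + 1) w b) ∂μ‖ := by
        rw [ofReal_norm, enorm_integral_mul_conj_self hLp]
    _ ≤ _ := ENNReal.ofReal_le_ofReal (hself b hb)

end KernelTest

section CarlesonEmbedding

lemma lintegral_mul_rpow_le {X : Type*} [MeasurableSpace X] {ν : Measure X} {q : ℝ} (hq : 1 ≤ q)
    {h k : X → ℝ≥0∞} (hh : AEMeasurable h ν) (hk : AEMeasurable k ν) (hfin : ∀ᵐ x ∂ν, h x < ∞) :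
    (∫⁻ x, h x * k x ∂ν) ^ q ≤ (∫⁻ x, h x ∂ν) ^ (q - 1) * ∫⁻ x, h x * k x ^ q ∂ν := by
  have hq0 : 0 < q := zero_lt_one.trans_le hq
  have hjensen := eLpNorm'_le_eLpNorm'_mul_rpow_measure_univ (μ := ν.withDensity h) (f := k)
    one_pos hq (hk.mono_ac (withDensity_absolutelyContinuous _ _)).aestronglyMeasurable
  simp only [eLpNorm', enorm_eq_self, ENNReal.rpow_one, div_one, withDensity_apply _ .univ,
    Measure.restrict_univ] at hjensen
  rw [lintegral_withDensity_eq_lintegral_mul_non_measurable₀ _ hh hfin,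
    lintegral_withDensity_eq_lintegral_mul_non_measurable₀ _ hh hfin] at hjensen
  calc _ ≤ _ := ENNReal.rpow_le_rpow hjensen hq0.le
    _ = _ := by
      rw [ENNReal.mul_rpow_of_nonneg _ _ hq0.le, ← ENNReal.rpow_mul, ← ENNReal.rpow_mul,
        one_div_mul_cancel hq0.ne', ENNReal.rpow_one,
        show (1 - 1 / q) * q = q - 1 by field_simp, mul_comm]
      rfl

lemma exists_enorm_rpow_le_lintegral_mul_kern {α q t : ℝ} (hα : -1 < α) (hq : 1 ≤ q)
    (ht : 0 ≤ t) :
    ∃ C : ℝ, 0 < C ∧ ∀ f : ℂ → ℂ, DifferentiableOn ℂ f unitDisk → Integrable f (weightedArea α) →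
      ∀ w ∈ unitDisk, ‖f w‖ₑ ^ q ≤ ENNReal.ofReal C *
        ((∫⁻ z, ‖f z‖ₑ ∂weightedArea α) ^ (q - 1) * ∫⁻ z, ‖f z‖ₑ *
          (ENNReal.ofReal (defect z ^ t) * ‖kern ((2 + α) * q + t) z w‖ₑ) ∂weightedArea α) := by
  have hq0 : 0 < q := zero_lt_one.trans_le hq
  have hαγ : α ≤ α + t / q := le_add_of_nonneg_right (by positivity)
  have hC : 0 < (1 + (α + t / q)) / (1 + α) := div_pos (by linarith) (by linarith)
  refine ⟨((1 + (α + t / q)) / (1 + α)) ^ q, by positivity, fun f hf hfi w hw => ?_⟩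
  have hker : Measurable fun z =>
      ENNReal.ofReal (defect z ^ (α + t / q - α)) * ‖kern (2 + (α + t / q)) w z‖ₑ :=
    (measurable_defect.pow_const _).ennreal_ofReal.mul
      (measurable_kern_comp _ measurable_const measurable_id).enorm
  calc ‖f w‖ₑ ^ q ≤ _ :=
        ENNReal.rpow_le_rpow (enorm_le_lintegral_enorm_mul_kern hα hαγ hf hfi hw) hq0.le
    _ ≤ ENNReal.ofReal (((1 + (α + t / q)) / (1 + α)) ^ q) *
          ((∫⁻ z, ‖f z‖ₑ ∂weightedArea α) ^ (q - 1) * ∫⁻ z, ‖f z‖ₑ *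
            (ENNReal.ofReal (defect z ^ (α + t / q - α)) * ‖kern (2 + (α + t / q)) w z‖ₑ) ^ q
              ∂weightedArea α) := by
        rw [ENNReal.mul_rpow_of_nonneg _ _ hq0.le, ENNReal.ofReal_rpow_of_pos hC]
        exact mul_le_mul_right (lintegral_mul_rpow_le hq hfi.1.enorm hker.aemeasurable
          (ae_of_all _ fun _ => enorm_lt_top)) _
    _ = _ := by
        congr 2
        refine lintegral_congr_weightedArea fun z hz => ?_
        have hdz := defect_pos hz
        rw [ENNReal.mul_rpow_of_nonneg _ _ hq0.le, enorm_kern_rpow _ hq0.le, enorm_kern_comm,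
          ENNReal.ofReal_rpow_of_pos (by positivity), ← Real.rpow_mul hdz.le]
        congr 3 <;> field_simp <;> ring_nf

variable {μ : Measure ℂ} {α q t : ℝ}

theorem KernelCarleson.exists_lintegral_rpow_le [SFinite μ] (hμ : ∀ᵐ w ∂μ, w ∈ unitDisk)
    (hα : -1 < α) (hq : 1 ≤ q) (ht : 0 ≤ t) (h : KernelCarleson μ ((2 + α) * q) t) :
    ∃ C : ℝ, 0 < C ∧ ∀ f : ℂ → ℂ, DifferentiableOn ℂ f unitDisk → Integrable f (weightedArea α) →
      ∫⁻ w, ‖f w‖ₑ ^ q ∂μ ≤ ENNReal.ofReal C * (∫⁻ z, ‖f z‖ₑ ∂weightedArea α) ^ q := by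
  obtain ⟨C₁, hC₁, hpt⟩ := exists_enorm_rpow_le_lintegral_mul_kern hα hq ht
  obtain ⟨C₂, hC₂, hker⟩ := h
  have := isProbabilityMeasure_weightedArea hα
  refine ⟨C₁ * C₂, by positivity, fun f hf hfi => ?_⟩
  set X := ∫⁻ z, ‖f z‖ₑ ∂weightedArea α
  have hX : X ≠ ∞ := hfi.2.ne
  calc ∫⁻ w, ‖f w‖ₑ ^ q ∂μ
      ≤ ∫⁻ w, ENNReal.ofReal C₁ * (X ^ (q - 1) * ∫⁻ z, ‖f z‖ₑ * (ENNReal.ofReal (defect z ^ t) *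
          ‖kern ((2 + α) * q + t) z w‖ₑ) ∂weightedArea α) ∂μ :=
        lintegral_mono_ae (hμ.mono (hpt f hf hfi))
    _ = ENNReal.ofReal C₁ * (X ^ (q - 1) * ∫⁻ z, ‖f z‖ₑ * (ENNReal.ofReal (defect z ^ t) *
          ∫⁻ w, ‖kern ((2 + α) * q + t) z w‖ₑ ∂μ) ∂weightedArea α) := by
        rw [lintegral_const_mul' _ _ ENNReal.ofReal_ne_top, lintegral_const_mul' _ _
          (ENNReal.rpow_ne_top_of_nonneg (sub_nonneg.2 hq) hX), lintegral_lintegral_swap]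
        · simp only [lintegral_const_mul' _ _ enorm_ne_top,
            lintegral_const_mul' _ _ ENNReal.ofReal_ne_top]
        · exact hfi.1.enorm.comp_snd.mul
            (((measurable_defect.comp measurable_snd).pow_const t).ennreal_ofReal.mul
              (measurable_kern_comp _ measurable_snd measurable_fst).enorm).aemeasurable
    _ ≤ ENNReal.ofReal C₁ * (X ^ (q - 1) *
          ∫⁻ z, ‖f z‖ₑ * ENNReal.ofReal C₂ ∂weightedArea α) := by
        refine mul_le_mul_right (mul_le_mul_right (lintegral_mono_weightedArea fun z hz =>
          mul_le_mul_right ?_ _) _) _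
        have hdz := defect_pos hz
        refine (mul_le_mul_right (hker z hz) _).trans_eq ?_
        rw [← ENNReal.ofReal_mul (by positivity), mul_left_comm, ← Real.rpow_add hdz,
          add_neg_cancel, Real.rpow_zero, mul_one]
    _ = ENNReal.ofReal (C₁ * C₂) * (X ^ (q - 1) * X ^ (1 : ℝ)) := by
        rw [lintegral_mul_const' _ _ ENNReal.ofReal_ne_top, ENNReal.ofReal_mul hC₁.le,
          ENNReal.rpow_one]
        ring
    _ = _ := by
        rw [← ENNReal.rpow_add_of_nonneg _ _ (sub_nonneg.2 hq) zero_le_one, sub_add_cancel]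

theorem KernelCarleson.isCarleson [SFinite μ] (hμ : ∀ᵐ w ∂μ, w ∈ unitDisk)
    (hα : -1 < α) (hq : 1 ≤ q) (ht : 0 ≤ t) (h : KernelCarleson μ ((2 + α) * q) t) :
    IsCarleson μ q 1 α := by
  obtain ⟨C, hC, hle⟩ := h.exists_lintegral_rpow_le hμ hα hq ht
  have hq0 : 0 < q := zero_lt_one.trans_le hq
  refine ⟨(C ^ (1 / q)).toNNReal, Real.toNNReal_pos.2 (by positivity), fun f hf => ?_⟩
  have hfi : Integrable f (weightedArea α) :=
    ⟨aestronglyMeasurable_of_continuousOn (ae_mem_unitDisk α) hf.1.continuousOn,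
      (bergmanNorm_one α f).symm.trans_lt hf.2⟩
  rw [eLpNorm_eq_lintegral_rpow_enorm_toReal (by simpa using hq0) ENNReal.ofReal_ne_top,
    ENNReal.toReal_ofReal hq0.le, bergmanNorm_one]
  refine (ENNReal.rpow_le_rpow (hle f hf.1 hfi) (by positivity)).trans_eq ?_
  rw [ENNReal.mul_rpow_of_nonneg _ _ (by positivity), ← ENNReal.rpow_mul,
    mul_one_div_cancel hq0.ne', ENNReal.rpow_one, ENNReal.ofReal_rpow_of_pos hC, ENNReal.ofReal]

theorem ToeplitzBounded.isCarleson [IsFiniteMeasure μ] {p β : ℝ} (hμ : ∀ᵐ w ∂μ, w ∈ unitDisk)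
    (hp0 : 0 < p) (hp1 : p ≤ 1) (hα : -1 < α) (hβ : -1 < β)
    (h : ToeplitzBounded μ β p α 1 β) : IsCarleson μ (1 / p) 1 α := by
  have hα2 : 0 < 2 + α := by linarith
  have hker := ToeplitzBounded.kernelCarleson hμ hp0 hα hβ h
  rw [show (2 + α) / p = (2 + α) * (1 / p) by ring] at hker
  exact KernelCarleson.isCarleson hμ hα (one_le_one_div hp0 hp1) (by positivity) hker

end CarlesonEmbedding

section LogBlochNecessity

lemma exists_log_le_norm_bergmanProj {β : ℝ} (hβ : -1 < β) :
    ∃ C : ℝ, 0 < C ∧ ∀ ζ ∈ unitDisk, ∃ φ : ℂ → ℂ, Measurable φ ∧ (∀ z, ‖φ z‖ ≤ 1) ∧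
      Real.log (2 / defect ζ) ≤ C * ‖bergmanProj β φ ζ‖ := by
  have := isProbabilityMeasure_weightedArea hβ
  obtain ⟨C, hC, hlow⟩ := exists_log_le_lintegral_enorm_kern hβ
  refine ⟨C, hC, fun ζ hζ => ?_⟩
  obtain ⟨φ, hφ, hφ1, hsign⟩ := exists_measurable_sign (continuousOn_kern (2 + β) hζ)
  refine ⟨fun u => conj (φ u), Complex.continuous_conj.measurable.comp hφ,
    fun u => (RCLike.norm_conj _).trans_le (hφ1 u), ?_⟩
  have hproj : bergmanProj β (fun u => conj (φ u)) ζ =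
      ((∫ u, ‖kern (2 + β) ζ u‖ ∂weightedArea β : ℝ) : ℂ) := by
    rw [← integral_complex_ofReal]
    exact integral_congr_ae ((ae_mem_unitDisk β).mono hsign)
  have hnonneg : 0 ≤ ∫ u, ‖kern (2 + β) ζ u‖ ∂weightedArea β :=
    integral_nonneg fun _ => norm_nonneg _
  have hle := hlow ζ hζ
  rw [← ofReal_integral_norm_eq_lintegral_enorm (integrable_kern (ae_mem_unitDisk β) _ hζ),
    ← ENNReal.ofReal_mul hC.le, ENNReal.ofReal_le_ofReal_iff (by positivity)] at hle
  rwa [hproj, Complex.norm_of_nonneg hnonneg]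

variable {μ : Measure ℂ} [IsFiniteMeasure μ] {p α β : ℝ}

/-- The functions bounded by `1` whose projections are as large as possible at `r z` reproduce the
logarithm; the Carleson condition absorbs the oscillation of the projection. -/
lemma ToeplitzBounded.exists_log_ofReal_mul_mul_norm_integral_le (hμ : ∀ᵐ w ∂μ, w ∈ unitDisk)
    (hp0 : 0 < p) (hp1 : p ≤ 1) (hα : -1 < α) (hβ : -1 < β) (h : ToeplitzBounded μ β p α 1 β)
    (hcar : IsCarleson μ (1 / p) 1 α) :
    ∃ C : ℝ, 0 < C ∧ ∀ z ∈ unitDisk, ∀ r : ℝ, 0 ≤ r → r < 1 →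
      Real.log (2 / defect (r * z)) * ‖∫ w, conj w * kern ((2 + α) / p + 1) z w ∂μ‖ ≤
        C * defect z ^ (-1 : ℝ) := by
  obtain ⟨B, hB, hbloch⟩ := exists_isBlochWith_bergmanProj hβ
  obtain ⟨C₁, hC₁, hpair⟩ := h.exists_norm_integral_mul_kern_mul_le hμ hp0 hα hβ
  obtain ⟨C₂, hC₂, hosc⟩ := hcar.exists_norm_integral_mul_sub_le hμ hp0 hp1 hα hB
  obtain ⟨c, hc, hlow⟩ := exists_log_le_norm_bergmanProj hβ
  set s := (2 + α) / p
  refine ⟨c * (C₁ + C₂), by positivity, fun z hz r hr0 hr1 => ?_⟩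
  obtain ⟨φ, hφ, hφ1, hlog⟩ := hlow _ (ofReal_mul_mem_unitDisk hr0 hr1.le hz)
  set I := ∫ w, conj w * kern (s + 1) z w ∂μ
  set J := ∫ w, conj w * bergmanProj β φ (r * w) * kern (s + 1) z w ∂μ
  have hJ : ‖J‖ ≤ C₁ * defect z ^ (-1 : ℝ) := by
    have hid := hpair id differentiable_id (fun w hw => (mem_ball_zero_iff.1 hw).le)
      z hz φ hφ hφ1 r hr0 hr1
    rw [← RCLike.norm_conj, ← integral_conj] at hid
    refine le_of_eq_of_le (congrArg _ (integral_congr_ae (hμ.mono fun w hw => ?_))) hid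
    simp only [map_mul, conj_kern _ hw hz, RingHomCompTriple.comp_apply, RingHom.id_apply, id]
    ring
  have hJI : ‖J - bergmanProj β φ (r * z) * I‖ ≤ C₂ * defect z ^ (-1 : ℝ) :=
    hosc _ ((hbloch φ hφ hφ1).1.comp_mul hr0 hr1.le) _ Complex.continuous_conj
      (fun w hw => (RCLike.norm_conj w).trans_le (mem_ball_zero_iff.1 hw).le) z hz
  calc Real.log (2 / defect (r * z)) * ‖I‖ ≤ c * ‖bergmanProj β φ (r * z)‖ * ‖I‖ := by gcongr
    _ = c * ‖bergmanProj β φ (r * z) * I‖ := by rw [norm_mul, mul_assoc]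
    _ ≤ c * (‖J‖ + ‖J - bergmanProj β φ (r * z) * I‖) := by
        gcongr
        exact norm_le_norm_add_norm_sub _ _
    _ ≤ c * (C₁ * defect z ^ (-1 : ℝ) + C₂ * defect z ^ (-1 : ℝ)) := by gcongr
    _ = _ := by ring

theorem ToeplitzBounded.exists_log_mul_norm_integral_le (hμ : ∀ᵐ w ∂μ, w ∈ unitDisk)
    (hp0 : 0 < p) (hp1 : p ≤ 1) (hα : -1 < α) (hβ : -1 < β) (h : ToeplitzBounded μ β p α 1 β)
    (hcar : IsCarleson μ (1 / p) 1 α) :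
    ∃ C : ℝ, 0 < C ∧ ∀ z ∈ unitDisk,
      Real.log (2 / defect z) * ‖∫ w, conj w * kern ((2 + α) / p + 1) z w ∂μ‖ ≤
        C * defect z ^ (-1 : ℝ) := by
  obtain ⟨C, hC, hr⟩ := h.exists_log_ofReal_mul_mul_norm_integral_le hμ hp0 hp1 hα hβ hcar
  refine ⟨C, hC, fun z hz => ?_⟩
  have hdz := (defect_pos hz).ne'
  have hlog : ContinuousAt (fun r : ℝ => Real.log (2 / defect (r * z))) 1 := by
    have hdefect : ContinuousAt (fun r : ℝ => defect (r * z)) 1 := by unfold defect; fun_prop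
    exact (continuousAt_const.div hdefect (by simpa using hdz)).log (by simpa using hdz)
  have hlim := (hlog.tendsto.mul_const
    ‖∫ w, conj w * kern ((2 + α) / p + 1) z w ∂μ‖).mono_left
      (nhdsWithin_le_nhds (s := Set.Iio 1))
  rw [Complex.ofReal_one, one_mul] at hlim
  refine le_of_tendsto hlim ?_
  filter_upwards [Ioo_mem_nhdsLT zero_lt_one] with r hr01
  exact hr z hz r hr01.1.le hr01.2

theorem ToeplitzBounded.memLogBloch (hμ : ∀ᵐ w ∂μ, w ∈ unitDisk) (hp0 : 0 < p) (hp1 : p ≤ 1)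
    (hα : -1 < α) (hβ : -1 < β) (h : ToeplitzBounded μ β p α 1 β)
    (hcar : IsCarleson μ (1 / p) 1 α) :
    MemLogBloch 1 (toeplitz μ ((2 + α) / p - 2) fun _ => 1) := by
  obtain ⟨C, _, hlog⟩ := h.exists_log_mul_norm_integral_le hμ hp0 hp1 hα hβ hcar
  have hs := zero_lt_one.trans (one_lt_two_add_div hp0 hp1 hα)
  refine ⟨differentiableOn_toeplitz hμ _ (integrable_const 1), (2 + α) / p * C, ?_⟩
  rintro _ ⟨z, hz, rfl⟩
  have hdz := defect_pos hz
  have hbound := hlog z hz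
  rw [Real.rpow_neg_one, ← div_eq_mul_inv, le_div_iff₀ hdz] at hbound
  simp only [Real.rpow_one, (hasDerivAt_toeplitz_one hμ _ hz).deriv, norm_mul,
    Complex.norm_of_nonneg hs.le, ← defect.eq_1]
  calc _ = (2 + α) / p * (Real.log (2 / defect z) *
        ‖∫ w, conj w * kern ((2 + α) / p + 1) z w ∂μ‖ * defect z) := by ring
    _ ≤ _ := by gcongr

end LogBlochNecessity

end BergmanToeplitz

theorem theorem1p1 (μ : MeasureTheory.Measure ℂ) [MeasureTheory.IsFiniteMeasure μ]
    (hμ : μ (BergmanToeplitz.unitDisk)ᶜ = 0)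
    (p α β : ℝ) (hp0 : 0 < p) (hp1 : p ≤ 1) (hα : -1 < α) (hβ : -1 < β) :
    BergmanToeplitz.ToeplitzBounded μ β p α 1 β ↔
      BergmanToeplitz.IsCarleson μ (1 / p) 1 α ∧
        BergmanToeplitz.MemLogBloch 1
          (BergmanToeplitz.toeplitz μ ((2 + α) / p - 2) fun _ => 1) := by
  have hμ' : ∀ᵐ w ∂μ, w ∈ BergmanToeplitz.unitDisk := hμ
  constructor
  · intro h
    have hcar := h.isCarleson hμ' hp0 hp1 hα hβ
    exact ⟨hcar, h.memLogBloch hμ' hp0 hp1 hα hβ hcar⟩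
  · rintro ⟨hcar, hlb⟩
    exact BergmanToeplitz.toeplitzBounded_of_isCarleson hμ' hp0 hp1 hα hβ hcar hlb
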